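/- For $n\ge 1$ let $B_n$ be the braid group on $n$ strands, with standard generators $a_1,\dots,a_{n-1}$; a positive $n$-braid is a product of generators $a_i$ (no inverses). For positive integers $p,q$ let $T_{p,q}$ be the positive torus link, that is, the oriented link (up to isotopy) that is the closure of the $p$-braid $(a_1a_2\cdots a_{p-1})^q$. Deleting a generator in a positive braid $\beta$ means removing one letter $a_i$ from some positive braid word that represents $\beta$. For links $K$ and $T$ that are closures of positive braids, $K$ is called subword-adjacent to $T$ if, for some positive integer $k$, there are positive $k$-braids $\beta_1,\beta_2$ with closures $K$ and $T$, respectively, such that $\beta_1$ is obtained from $\beta_2$ by successively deleting (finitely many, possibly no) generators. Proposition. Let $m$ and $n$ be positive integers. (1) If $n\le \frac{2m^2+4}{3}-m$, then $T_{2,n}$ is subword-adjacent to $T_{m,m}$. (2) If $n\le \frac{2m^2-m+5}{3}$ and $(m,n)\ne(1,2)$, then $T_{2,n}$ is subword-adjacent to $T_{m,m+1}$. -/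

import Mathlib

/-! ### Oriented polygonal links in three-space and their isotopy classes -/

/-- Points of three-space, with coordinates `(x, y, z)`. -/
abbrev R3 : Type := ℝ × ℝ × ℝ

/-- An oriented polygonal link: a finite set of directed straight edges `(tail, head)` that form
pairwise disjoint, simple, closed, oriented polygons. Every head of an edge is the tail of an edge,
no two edges have the same tail or the same head, and two distinct edges (as closed segments) can
meet only in a common endpoint. -/
structure PolygonalLink where
  edges : Set (R3 × R3)
  finite : edges.Finite
  tail_ne_head : ∀ e ∈ edges, e.1 ≠ e.2
  closed : ∀ e ∈ edges, ∃ f ∈ edges, f.1 = e.2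
  tail_inj : ∀ e ∈ edges, ∀ f ∈ edges, e.1 = f.1 → e = f
  head_inj : ∀ e ∈ edges, ∀ f ∈ edges, e.2 = f.2 → e = f
  embedded : ∀ e ∈ edges, ∀ f ∈ edges, e ≠ f → ∀ p ∈ segment ℝ e.1 e.2, p ∈ segment ℝ f.1 f.2 →
    (p = e.1 ∨ p = e.2) ∧ (p = f.1 ∨ p = f.2)

/-- The underlying point set of a polygonal link. -/
def PolygonalLink.carrier (L : PolygonalLink) : Set R3 :=
  ⋃ e ∈ L.edges, segment ℝ e.1 e.2

/-- The classical elementary deformation (`Δ`-move) of polygonal links: an edge from `a` to `b` is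
replaced by the two edges from `a` to `c` and from `c` to `b`, where the closed triangle `a b c`
meets the link exactly in the edge `a b`. The triangle may be degenerate, which (as `L'` is again
a link) means that `c` subdivides the edge. -/
def DeltaMove (L L' : PolygonalLink) : Prop :=
  ∃ a b c : R3, (a, b) ∈ L.edges ∧
    convexHull ℝ {a, b, c} ∩ L.carrier = segment ℝ a b ∧
    L'.edges = (L.edges \ {(a, b)}) ∪ {(a, c), (c, b)}

/-- (Oriented, tame) links up to isotopy: polygonal links modulo the equivalence relation generated
by `Δ`-moves. -/
def LinkType : Type := Quot DeltaMove

/-- The isotopy class of a polygonal link. -/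
def PolygonalLink.isotopyClass (L : PolygonalLink) : LinkType := Quot.mk DeltaMove L

/-! ### Braid groups -/

/-- Artin's relators; the generator `a_i`, `1 ≤ i ≤ n - 1`, has the index `i - 1 : Fin (n - 1)`. -/
def braidRelators (n : ℕ) : Set (FreeGroup (Fin (n - 1))) :=
  {r | ∃ i j : Fin (n - 1), (i : ℕ) + 1 = j ∧
      r = (FreeGroup.of i * FreeGroup.of j * FreeGroup.of i) *
        (FreeGroup.of j * FreeGroup.of i * FreeGroup.of j)⁻¹} ∪
  {r | ∃ i j : Fin (n - 1), (i : ℕ) + 2 ≤ j ∧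
      r = (FreeGroup.of i * FreeGroup.of j) * (FreeGroup.of j * FreeGroup.of i)⁻¹}

/-- The braid group on `n` strands. -/
abbrev BraidGroup (n : ℕ) : Type := PresentedGroup (braidRelators n)

/-- Positive braid words on `n` strands. -/
abbrev PosWord (n : ℕ) : Type := List (Fin (n - 1))

/-- The braid that a positive braid word represents. -/
def PosWord.braid {n : ℕ} (w : PosWord n) : BraidGroup n :=
  (w.map fun i => PresentedGroup.of i).prod

/-- The positive braids: the elements of the submonoid generated by the standard generators. -/
def IsPositiveBraid {n : ℕ} (β : BraidGroup n) : Prop :=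
  β ∈ Submonoid.closure (Set.range fun i : Fin (n - 1) =>
    (PresentedGroup.of i : BraidGroup n))

/-- `β'` is obtained from the positive braid `β` by deleting one generator in some positive braid
word that represents `β`. -/
def DeletesGenerator {n : ℕ} (β β' : BraidGroup n) : Prop :=
  ∃ (u v : PosWord n) (i : Fin (n - 1)),
    PosWord.braid (u ++ i :: v) = β ∧ PosWord.braid (u ++ v) = β'

/-! ### The closure of a positive braid word -/

/-- The edges of the piece of braid for one letter: the generator that exchanges the positions `i`
and `i + 1` (counted from `0`), in the slab `t ≤ y ≤ t + 1`. Strands run in the direction of `y`, and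
the strand position `k = 0, …, n - 1` is the line `x = k`, `z = 0`. The strand that passes from
position `i` to `i + 1` goes over (larger `z`) the one that passes from `i + 1` to `i`; this is a
positive crossing. -/
inductive IsLetterEdge (n i t : ℕ) : R3 × R3 → Prop
  | straight (k : ℕ) (hk : k < n) (h : k ≠ i) (h' : k ≠ i + 1) :
      IsLetterEdge n i t ((k, t, 0), (k, t + 1, 0))
  | overUp : IsLetterEdge n i t ((i, t, 0), (i + 1 / 2, t + 1 / 2, 1))
  | overDown : IsLetterEdge n i t ((i + 1 / 2, t + 1 / 2, 1), (i + 1, t + 1, 0))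
  | under : IsLetterEdge n i t ((i + 1, t, 0), (i, t + 1, 0))

/-- The edges that close a braid lying in `0 ≤ y ≤ l`: for each position `k`, the end `y = l` is
joined to the end `y = 0` inside the plane `x = k` and below the braid. So all strands run around
one axis, parallel to the `x`-axis. -/
inductive IsClosingEdge (n l : ℕ) : R3 × R3 → Prop
  | top (k : ℕ) (hk : k < n) : IsClosingEdge n l ((k, l, 0), (k, l + 1, -1))
  | back (k : ℕ) (hk : k < n) : IsClosingEdge n l ((k, l + 1, -1), (k, -1, -1))
  | bottom (k : ℕ) (hk : k < n) : IsClosingEdge n l ((k, -1, -1), (k, 0, 0))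

/-- The edges of the closure of a positive braid word: its letters are stacked in the direction of
`y`, and the strand positions are closed up. -/
def IsClosureEdge (n : ℕ) (w : PosWord n) (e : R3 × R3) : Prop :=
  (∃ (t : ℕ) (ht : t < w.length), IsLetterEdge n (w[t] : ℕ) t e) ∨ IsClosingEdge n w.length e

theorem isClosureEdge_finite (n : ℕ) (w : PosWord n) : {e | IsClosureEdge n w e}.Finite := by
  let F : Finset R3 :=
    ((Finset.range n ×ˢ Finset.range (w.length + 1)).image
      fun q : ℕ × ℕ => ((q.1 : ℝ), (q.2 : ℝ), (0 : ℝ))) ∪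
    ((Finset.range n ×ˢ Finset.range (w.length + 1)).image
      fun q : ℕ × ℕ => ((q.1 : ℝ) + 1 / 2, (q.2 : ℝ) + 1 / 2, (1 : ℝ))) ∪
    ((Finset.range n).image fun q : ℕ => ((q : ℝ), (w.length : ℝ) + 1, (-1 : ℝ))) ∪
    ((Finset.range n).image fun q : ℕ => ((q : ℝ), (-1 : ℝ), (-1 : ℝ)))
  have h1 : ∀ k t : ℕ, k < n → t ≤ w.length → ((k : ℝ), (t : ℝ), (0 : ℝ)) ∈ F := by
    intro k t hk ht
    simp only [F, Finset.mem_union, Finset.mem_image]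
    exact Or.inl (Or.inl (Or.inl ⟨(k, t), by simp; omega, rfl⟩))
  have h2 : ∀ k t : ℕ, k < n → t ≤ w.length →
      ((k : ℝ) + 1 / 2, (t : ℝ) + 1 / 2, (1 : ℝ)) ∈ F := by
    intro k t hk ht
    simp only [F, Finset.mem_union, Finset.mem_image]
    exact Or.inl (Or.inl (Or.inr ⟨(k, t), by simp; omega, rfl⟩))
  have h3 : ∀ k : ℕ, k < n → ((k : ℝ), (w.length : ℝ) + 1, (-1 : ℝ)) ∈ F := by
    intro k hk
    simp only [F, Finset.mem_union, Finset.mem_image]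
    exact Or.inl (Or.inr ⟨k, by simpa using hk, rfl⟩)
  have h4 : ∀ k : ℕ, k < n → ((k : ℝ), (-1 : ℝ), (-1 : ℝ)) ∈ F := by
    intro k hk
    simp only [F, Finset.mem_union, Finset.mem_image]
    exact Or.inr ⟨k, by simpa using hk, rfl⟩
  refine (F ×ˢ F).finite_toSet.subset ?_
  rintro e he
  rw [Finset.mem_coe, Finset.mem_product]
  rcases he with ⟨t, ht, he⟩ | he
  · cases he with
    | straight k hk h h' => exact ⟨h1 k t hk ht.le, by exact_mod_cast h1 k (t + 1) hk ht⟩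
    | overUp => exact ⟨h1 _ t (by omega) ht.le, h2 _ t (by omega) ht.le⟩
    | overDown =>
      exact ⟨h2 _ t (by omega) ht.le, by exact_mod_cast h1 (w[t] + 1) (t + 1) (by omega) ht⟩
    | under =>
      exact ⟨by exact_mod_cast h1 (w[t] + 1) t (by omega) ht.le,
        by exact_mod_cast h1 w[t] (t + 1) (by omega) ht⟩
  · cases he with
    | top k hk => exact ⟨h1 _ _ hk le_rfl, h3 k hk⟩
    | back k hk => exact ⟨h3 k hk, h4 k hk⟩
    | bottom k hk => exact ⟨h4 k hk, by exact_mod_cast h1 k 0 hk (Nat.zero_le _)⟩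

theorem exists_isClosureEdge_tail (n : ℕ) (w : PosWord n) (k t : ℕ) (hk : k < n)
    (ht : t ≤ w.length) :
    ∃ f, IsClosureEdge n w f ∧ f.1 = ((k : ℝ), (t : ℝ), (0 : ℝ)) := by
  rcases ht.eq_or_lt with rfl | ht
  · exact ⟨_, .inr (.top k hk), rfl⟩
  by_cases h : k = w[t]
  · exact ⟨_, .inl ⟨t, ht, .overUp⟩, by simp [h]⟩
  by_cases h' : k = w[t] + 1
  · exact ⟨_, .inl ⟨t, ht, .under⟩, by simp [h']⟩
  exact ⟨_, .inl ⟨t, ht, .straight k hk h h'⟩, rfl⟩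

theorem isClosureEdge_closed (n : ℕ) (w : PosWord n) (e : R3 × R3) (he : IsClosureEdge n w e) :
    ∃ f, IsClosureEdge n w f ∧ f.1 = e.2 := by
  rcases he with ⟨t, ht, he⟩ | he
  · cases he with
    | straight k hk h h' => exact_mod_cast exists_isClosureEdge_tail n w k (t + 1) hk ht
    | overUp => exact ⟨_, .inl ⟨t, ht, .overDown⟩, rfl⟩
    | overDown =>
      exact_mod_cast exists_isClosureEdge_tail n w (w[t] + 1) (t + 1) (by omega) ht
    | under => exact_mod_cast exists_isClosureEdge_tail n w w[t] (t + 1) (by omega) ht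
  · cases he with
    | top k hk => exact ⟨_, .inr (.back k hk), rfl⟩
    | back k hk => exact ⟨_, .inr (.bottom k hk), rfl⟩
    | bottom k hk => exact_mod_cast exists_isClosureEdge_tail n w k 0 hk (Nat.zero_le _)

theorem exists_of_mem_segment {a b p : R3} (h : p ∈ segment ℝ a b) :
    ∃ s : ℝ, 0 ≤ s ∧ s ≤ 1 ∧ p.1 = a.1 + s * (b.1 - a.1) ∧
      p.2.1 = a.2.1 + s * (b.2.1 - a.2.1) ∧ p.2.2 = a.2.2 + s * (b.2.2 - a.2.2) := by
  rw [segment_eq_image'] at h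
  obtain ⟨s, ⟨h0, h1⟩, rfl⟩ := h
  exact ⟨s, h0, h1, rfl, rfl, rfl⟩

theorem natCast_trichotomy (a b : ℕ) : a = b ∨ (a : ℝ) + 1 ≤ b ∨ (b : ℝ) + 1 ≤ a := by
  rcases lt_trichotomy a b with h | h | h
  · exact .inr (.inl (by exact_mod_cast h))
  · exact .inl h
  · exact .inr (.inr (by exact_mod_cast h))

theorem IsLetterEdge.coord {n i t : ℕ} {e : R3 × R3} (he : IsLetterEdge n i t e) :
    ((t : ℝ) ≤ e.1.2.1 ∧ e.1.2.1 + 1 / 2 ≤ t + 1) ∧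
      ((t : ℝ) + 1 / 2 ≤ e.2.2.1 ∧ e.2.2.1 ≤ t + 1) ∧ 0 ≤ e.1.2.2 ∧ 0 ≤ e.2.2.2 := by
  cases he <;> norm_num
  linarith

theorem IsLetterEdge.inj {n i t : ℕ} {e f : R3 × R3} (he : IsLetterEdge n i t e)
    (hf : IsLetterEdge n i t f) : (e.1 = f.1 → e = f) ∧ (e.2 = f.2 → e = f) := by
  cases he <;> cases hf <;> simp [Prod.ext_iff] <;> norm_cast <;> omega

theorem IsLetterEdge.embedded {n i t : ℕ} {e f : R3 × R3} (he : IsLetterEdge n i t e)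
    (hf : IsLetterEdge n i t f) (hne : e ≠ f) {p : R3} (hp : p ∈ segment ℝ e.1 e.2)
    (hq : p ∈ segment ℝ f.1 f.2) : p = e.1 ∨ p = e.2 := by
  obtain ⟨s, hs0, hs1, h1, h2, h3⟩ := exists_of_mem_segment hp
  obtain ⟨r, hr0, hr1, h4, h5, h6⟩ := exists_of_mem_segment hq
  suffices s = 0 ∨ s = 1 by
    rcases this with rfl | rfl
    · left; simp [Prod.ext_iff, h1, h2, h3]
    · right; simp [Prod.ext_iff, h1, h2, h3]
  rw [h1] at h4
  rw [h2] at h5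
  rw [h3] at h6
  clear hp hq h1 h2 h3
  cases he with
  | straight k hk h h' =>
    cases hf with
    | straight k' hk' _ _ =>
      have : k = k' := by
        simp at h4; exact_mod_cast h4
      exact absurd (by rw [this]) hne
    | _ =>
      exfalso
      simp only at h4 h5 h6
      rcases natCast_trichotomy k i with a | a | a
      · exact h a
      · linarith
      rcases natCast_trichotomy k (i + 1) with b | b | b
      · exact h' b
      · push_cast at b
        have : (k : ℝ) < i + 1 := by linarith
        norm_cast at this a
        omega
      · push_cast at b
        linarith
  | overUp =>
    cases hf with
    | straight k hk h h' =>
      left; simp only at h6; linarith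
    | overUp => exact absurd rfl hne
    | overDown => right; simp only at h5; linarith
    | under => left; simp only at h6; linarith
  | overDown =>
    cases hf with
    | straight k hk h h' =>
      right; simp only at h6; linarith
    | overDown => exact absurd rfl hne
    | overUp => left; simp only at h5; linarith
    | under => right; simp only at h6; linarith
  | under =>
    cases hf with
    | straight k hk h h' =>
      exfalso
      simp only at h4 h5 h6
      rcases natCast_trichotomy k i with a | a | a
      · exact h a
      · linarith
      rcases natCast_trichotomy k (i + 1) with b | b | b
      · exact h' b
      · push_cast at b
        have : (k : ℝ) < i + 1 := by linarith
        norm_cast at this a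
        omega
      · push_cast at b
        linarith
    | overUp => left; simp only at h5 h6; linarith
    | overDown => right; simp only at h5 h6; linarith
    | under => exact absurd rfl hne

theorem IsClosingEdge.inj {n l : ℕ} {e f : R3 × R3} (he : IsClosingEdge n l e)
    (hf : IsClosingEdge n l f) : (e.1 = f.1 → e = f) ∧ (e.2 = f.2 → e = f) := by
  have hl : (0 : ℝ) ≤ (l : ℝ) := Nat.cast_nonneg _
  cases he <;> cases hf <;> simp [Prod.ext_iff] <;> intros <;> linarith

theorem IsClosingEdge.embedded {n l : ℕ} {e f : R3 × R3} (he : IsClosingEdge n l e)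
    (hf : IsClosingEdge n l f) (hne : e ≠ f) {p : R3} (hp : p ∈ segment ℝ e.1 e.2)
    (hq : p ∈ segment ℝ f.1 f.2) : p = e.1 ∨ p = e.2 := by
  have hl : (0 : ℝ) ≤ (l : ℝ) := Nat.cast_nonneg _
  obtain ⟨s, hs0, hs1, h1, h2, h3⟩ := exists_of_mem_segment hp
  obtain ⟨r, hr0, hr1, h4, h5, h6⟩ := exists_of_mem_segment hq
  suffices s = 0 ∨ s = 1 by
    rcases this with rfl | rfl
    · left; simp [Prod.ext_iff, h1, h2, h3]
    · right; simp [Prod.ext_iff, h1, h2, h3]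
  rw [h1] at h4
  rw [h2] at h5
  rw [h3] at h6
  clear hp hq h1 h2 h3
  cases he with
  | top k hk =>
    cases hf with
    | top k' hk' =>
      have : k = k' := by
        simp at h4; exact_mod_cast h4
      exact absurd (by rw [this]) hne
    | back k' hk' => right; simp only at h6; linarith
    | bottom k' hk' => left; simp only at h5 h6; linarith
  | back k hk =>
    cases hf with
    | back k' hk' =>
      have : k = k' := by
        simp at h4; exact_mod_cast h4
      exact absurd (by rw [this]) hne
    | top k' hk' =>
      left; simp only at h5 h6
      have : r = 1 := by linarith
      subst this
      have : s * ((l : ℝ) + 2) = 0 := by linarith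
      rcases mul_eq_zero.1 this with h | h
      · exact h
      · linarith
    | bottom k' hk' =>
      right; simp only at h5 h6
      have : r = 0 := by linarith
      subst this
      have : (1 - s) * ((l : ℝ) + 2) = 0 := by linarith
      rcases mul_eq_zero.1 this with h | h
      · linarith
      · linarith
  | bottom k hk =>
    cases hf with
    | bottom k' hk' =>
      have : k = k' := by
        simp at h4; exact_mod_cast h4
      exact absurd (by rw [this]) hne
    | back k' hk' => left; simp only at h6; linarith
    | top k' hk' => right; simp only at h5 h6; linarith

theorem IsLetterEdge.mem_coord {n i t : ℕ} {e : R3 × R3} (he : IsLetterEdge n i t e)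
    {p : R3} (hp : p ∈ segment ℝ e.1 e.2) :
    (t : ℝ) ≤ p.2.1 ∧ p.2.1 ≤ t + 1 ∧ 0 ≤ p.2.2 ∧
      (p.2.1 = t ∨ p.2.1 = t + 1 → p = e.1 ∨ p = e.2) := by
  obtain ⟨s, hs0, hs1, h1, h2, h3⟩ := exists_of_mem_segment hp
  have key : s = 0 ∨ s = 1 → p = e.1 ∨ p = e.2 := by
    rintro (rfl | rfl)
    · left; simp [Prod.ext_iff, h1, h2, h3]
    · right; simp [Prod.ext_iff, h1, h2, h3]
  obtain ⟨⟨a1, a2⟩, ⟨a3, a4⟩, a5, a6⟩ := he.coord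
  refine ⟨by nlinarith, by nlinarith, by nlinarith, fun h => key ?_⟩
  rw [h2] at h
  cases he <;> simp only at h <;> rcases h with h | h <;>
    first | (left; linarith) | (right; linarith)

theorem IsClosingEdge.mem_coord {n l : ℕ} {e : R3 × R3} (he : IsClosingEdge n l e)
    {p : R3} (hp : p ∈ segment ℝ e.1 e.2) :
    p.2.2 ≤ 0 ∧ (p.2.2 = 0 → (p = e.1 ∨ p = e.2) ∧ (p.2.1 = 0 ∨ p.2.1 = l)) := by
  obtain ⟨s, hs0, hs1, h1, h2, h3⟩ := exists_of_mem_segment hp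
  have key : s = 0 ∨ s = 1 → p = e.1 ∨ p = e.2 := by
    rintro (rfl | rfl)
    · left; simp [Prod.ext_iff, h1, h2, h3]
    · right; simp [Prod.ext_iff, h1, h2, h3]
  cases he with
  | top k hk =>
    simp only at h1 h2 h3
    refine ⟨by linarith, fun h => ?_⟩
    have : s = 0 := by linarith
    exact ⟨key (.inl this), .inr (by rw [h2, this]; ring)⟩
  | back k hk =>
    simp only at h1 h2 h3
    exact ⟨by linarith, fun h => by linarith⟩
  | bottom k hk =>
    simp only at h1 h2 h3
    refine ⟨by linarith, fun h => ?_⟩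
    have : s = 1 := by linarith
    exact ⟨key (.inr this), .inl (by rw [h2, this]; ring)⟩

theorem isClosureEdge_tail_ne_head (n : ℕ) (w : PosWord n) (e : R3 × R3)
    (he : IsClosureEdge n w e) : e.1 ≠ e.2 := by
  have hl : (0 : ℝ) ≤ (w.length : ℝ) := Nat.cast_nonneg _
  rcases he with ⟨t, ht, he⟩ | he
  · cases he <;> simp [Prod.ext_iff]
  · cases he <;> simp [Prod.ext_iff]
    linarith

theorem IsLetterEdge.inj_closing {n i t l : ℕ} {e f : R3 × R3} (he : IsLetterEdge n i t e)
    (hf : IsClosingEdge n l f) (ht : t < l) : e.1 ≠ f.1 ∧ e.2 ≠ f.2 := by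
  obtain ⟨⟨a1, a2⟩, ⟨a3, a4⟩, a5, a6⟩ := he.coord
  have ht' : (t : ℝ) + 1 ≤ l := by exact_mod_cast ht
  have h0 : (0 : ℝ) ≤ t := Nat.cast_nonneg _
  refine ⟨fun h => ?_, fun h => ?_⟩
  · rw [h] at a1 a2 a5
    cases hf <;> norm_num at a5
    norm_num at a2
    linarith
  · rw [h] at a3 a4 a6
    cases hf <;> norm_num at a6
    norm_num at a3
    linarith

theorem isClosureEdge_inj (n : ℕ) (w : PosWord n) (e : R3 × R3) (he : IsClosureEdge n w e)
    (f : R3 × R3) (hf : IsClosureEdge n w f) : (e.1 = f.1 → e = f) ∧ (e.2 = f.2 → e = f) := by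
  rcases he with ⟨t, ht, he⟩ | he <;> rcases hf with ⟨t', ht', hf⟩ | hf
  · obtain ⟨⟨a1, a2⟩, ⟨a3, a4⟩, -⟩ := he.coord
    obtain ⟨⟨b1, b2⟩, ⟨b3, b4⟩, -⟩ := hf.coord
    rcases natCast_trichotomy t t' with h | h | h
    · subst h
      exact he.inj hf
    all_goals
      refine ⟨fun h' => ?_, fun h' => ?_⟩ <;>
      · have := congrArg (fun p : R3 => p.2.1) h'
        linarith
  · exact ⟨fun h => absurd h (he.inj_closing hf ht).1, fun h => absurd h (he.inj_closing hf ht).2⟩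
  · exact ⟨fun h => absurd h.symm (hf.inj_closing he ht').1,
      fun h => absurd h.symm (hf.inj_closing he ht').2⟩
  · exact he.inj hf

theorem isClosureEdge_embedded (n : ℕ) (w : PosWord n) (e : R3 × R3) (he : IsClosureEdge n w e)
    (f : R3 × R3) (hf : IsClosureEdge n w f) (hne : e ≠ f) (p : R3)
    (hp : p ∈ segment ℝ e.1 e.2) (hq : p ∈ segment ℝ f.1 f.2) : p = e.1 ∨ p = e.2 := by
  rcases he with ⟨t, ht, he⟩ | he <;> rcases hf with ⟨t', ht', hf⟩ | hf
  · obtain ⟨a1, a2, -, a3⟩ := he.mem_coord hp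
    obtain ⟨b1, b2, -⟩ := hf.mem_coord hq
    rcases natCast_trichotomy t t' with h | h | h
    · subst h
      exact he.embedded hf hne hp hq
    · exact a3 (.inr (by linarith))
    · exact a3 (.inl (by linarith))
  · obtain ⟨a1, a2, a3, a4⟩ := he.mem_coord hp
    obtain ⟨b1, b2⟩ := hf.mem_coord hq
    have ht' : (t : ℝ) + 1 ≤ w.length := by exact_mod_cast ht
    have h0 : (0 : ℝ) ≤ t := Nat.cast_nonneg _
    rcases (b2 (le_antisymm b1 a3)).2 with h | h
    · exact a4 (.inl (by linarith))
    · exact a4 (.inr (by linarith))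
  · obtain ⟨-, -, a3, -⟩ := hf.mem_coord hq
    obtain ⟨b1, b2⟩ := he.mem_coord hp
    exact (b2 (le_antisymm b1 a3)).1
  · exact he.embedded hf hne hp hq

/-- The closure of a positive braid word, as an oriented polygonal link. -/
def PosWord.closure {n : ℕ} (w : PosWord n) : PolygonalLink where
  edges := {e | IsClosureEdge n w e}
  finite := isClosureEdge_finite n w
  tail_ne_head := isClosureEdge_tail_ne_head n w
  closed := isClosureEdge_closed n w
  tail_inj e he f hf := (isClosureEdge_inj n w e he f hf).1
  head_inj e he f hf := (isClosureEdge_inj n w e he f hf).2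
  embedded e he f hf hne p hp hq :=
    ⟨isClosureEdge_embedded n w e he f hf hne p hp hq,
      isClosureEdge_embedded n w f hf e he hne.symm p hq hp⟩

/-! ### Torus links and subword-adjacency -/

/-- The link `K` is the closure of the positive braid `β`, that is, of a positive braid word that
represents `β`. -/
def IsClosureOf {n : ℕ} (K : LinkType) (β : BraidGroup n) : Prop :=
  ∃ w : PosWord n, w.braid = β ∧ w.closure.isotopyClass = K

/-- The positive torus link `T_{p,q}`: the closure of the braid word `(a_1 a_2 ⋯ a_{p-1})^q`. -/
def torusLink (p q : ℕ) : LinkType :=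
  PosWord.closure (n := p) (List.replicate q (List.finRange (p - 1))).flatten |>.isotopyClass

/-- `K` is subword-adjacent to `T`: for some `n`, there are positive `n`-braids `β₁` and `β₂` with
closures `K` and `T` such that `β₁` is obtained from `β₂` by successively deleting generators. -/
def SubwordAdjacent (K T : LinkType) : Prop :=
  ∃ n : ℕ, 0 < n ∧ ∃ β₁ β₂ : BraidGroup n, IsPositiveBraid β₁ ∧ IsPositiveBraid β₂ ∧
    IsClosureOf K β₁ ∧ IsClosureOf T β₂ ∧ Relation.ReflTransGen DeletesGenerator β₂ β₁

/-! Let C = a_0 a_1 ⋯ a_{m-2} be the Coxeter element (generators are indexed from 0), so that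
T_{m,q} is the closure of C^q = C^2 · C^{q-2}. Suppose that deleting letters turns C^{q-2} into a
product of r letters with even indices. These letters commute, and the closure of C^2 times such a
product is T_{2,m+r}: by braid relations all copies of the last generator but one become copies of
the previous generator, and Markov destabilisation then removes a strand
(`WordHasType.two_coxeter`). It remains to keep about 2m²/3 of the roughly m² letters. For n ≤ m a
cruder choice suffices: one Coxeter element and n - 1 letters a_0.

The count is recursive. `IsBraidSeq.ascend_pow_add` factors a power of C into a grid of ascending
products, a full twist on b + 1 strands, a grid of descending products, and a power of a smaller
Coxeter element. Here the twist and the smaller power both live on about m/2 strands. Half of the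
roughly m²/2 letters of the grids are even. The full twist, with about m²/4 letters, loses almost
nothing: it is a power of a product of two layers, one with even and one with odd letters
(`IsBraidSeq.layers_pow`), or becomes one when two letters are deleted
(`IsBraidSeq.reduces_two_poles`). A layer that is pushed through i rows of a grid has its indices
shifted by i. Layers alternate in parity, so if the i-th one crosses i rows, all of them become even
(`IsBraidSeq.keeps_pow`). Hence r(m) ≈ r(m/2) + m²/2, which gives 2m²/3; the exact bounds are
`IsBraidSeq.keeps_coxeter_pow` and `IsBraidSeq.keeps_coxeter_pow_succ`. A few small cases, in which
the recursion falls one letter short, use explicit words.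

Links are polygons modulo Δ-moves, so far commutation, the braid relation and destabilisation of
closures have to be realised by explicit Δ-moves. That a triangle avoids the rest of the link is
certified by affine functions. The moves for the two braid relations take place in a small lattice
box, where the certificates are integral and are checked by computation. -/

/-! ### Inserting and deleting a vertex of a polygonal link -/

/-- The affine function on three-space with the given coefficients. -/
def affineFn (q : ℝ × ℝ × ℝ × ℝ) (p : R3) : ℝ :=
  q.1 * p.1 + q.2.1 * p.2.1 + q.2.2.1 * p.2.2 + q.2.2.2

theorem affineFn_comb (q : ℝ × ℝ × ℝ × ℝ) {a b : R3} {s t : ℝ} (h : s + t = 1) :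
    affineFn q (s • a + t • b) = s * affineFn q a + t * affineFn q b := by
  obtain rfl : t = 1 - s := by linarith
  simp only [affineFn, Prod.fst_add, Prod.snd_add, Prod.smul_fst, Prod.smul_snd, smul_eq_mul]
  ring

theorem affineFn_nonpos_of_mem_segment {q : ℝ × ℝ × ℝ × ℝ} {a b p : R3} (ha : affineFn q a ≤ 0)
    (hb : affineFn q b ≤ 0) (hp : p ∈ segment ℝ a b) : affineFn q p ≤ 0 := by
  obtain ⟨s, t, hs, ht, hst, rfl⟩ := hp
  rw [affineFn_comb q hst]
  nlinarith

theorem mem_convexHull_triple {a b c p : R3} (hp : p ∈ convexHull ℝ {a, b, c}) :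
    ∃ s t u : ℝ, 0 ≤ s ∧ 0 ≤ t ∧ 0 ≤ u ∧ s + t + u = 1 ∧ p = s • a + t • b + u • c := by
  rw [convexHull_insert (by simp), mem_convexJoin] at hp
  obtain ⟨x, hx, y, hy, hp⟩ := hp
  rw [Set.mem_singleton_iff] at hx
  subst hx
  rw [convexHull_pair] at hy
  obtain ⟨t, u, ht, hu, htu, rfl⟩ := hy
  obtain ⟨s, r, hs, hr, hsr, rfl⟩ := hp
  refine ⟨s, r * t, r * u, hs, by positivity, by positivity, ?_, ?_⟩
  · rw [add_assoc, ← mul_add, htu, mul_one, hsr]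
  · rw [smul_add, smul_smul, smul_smul, add_assoc]

theorem affineFn_comb₃ (q : ℝ × ℝ × ℝ × ℝ) {a b c : R3} {s t u : ℝ} (h : s + t + u = 1) :
    affineFn q (s • a + t • b + u • c) =
      s * affineFn q a + t * affineFn q b + u * affineFn q c := by
  obtain rfl : u = 1 - s - t := by linarith
  simp only [affineFn, Prod.fst_add, Prod.snd_add, Prod.smul_fst, Prod.smul_snd, smul_eq_mul]
  ring

theorem PolygonalLink.ext_edges {L L' : PolygonalLink} (h : L.edges = L'.edges) : L = L' := by
  cases L; cases L'; cases h; rfl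

/-- The set `E` is the set of edges of a polygonal link of type `T`. -/
def IsEdgeSetOf (E : Set (R3 × R3)) (T : LinkType) : Prop :=
  ∃ L : PolygonalLink, L.edges = E ∧ L.isotopyClass = T

/-- This is how two links are shown to be isotopic: both are deformed until their edges coincide. -/
theorem IsEdgeSetOf.unique {E : Set (R3 × R3)} {T T' : LinkType} (h : IsEdgeSetOf E T)
    (h' : IsEdgeSetOf E T') : T = T' := by
  obtain ⟨L, h1, rfl⟩ := h
  obtain ⟨L', h2, rfl⟩ := h'
  rw [PolygonalLink.ext_edges (h1.trans h2.symm)]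

/-- `q` certifies that inserting the vertex `c` in the edge `a b` does not interfere with `e`. -/
def InsertCert (a b c : R3) (e : R3 × R3) (q : ℝ × ℝ × ℝ × ℝ) : Prop :=
  affineFn q e.1 ≤ 0 ∧ affineFn q e.2 ≤ 0 ∧ 0 ≤ affineFn q a ∧ 0 ≤ affineFn q b ∧ 0 < affineFn q c

/-- `q` certifies that deleting the vertex `c` between `a` and `b` does not interfere with `e`. -/
def DeleteCert (a b c : R3) (e : R3 × R3) (q : ℝ × ℝ × ℝ × ℝ) : Prop :=
  affineFn q e.1 ≤ 0 ∧ affineFn q e.2 ≤ 0 ∧ 0 ≤ affineFn q a ∧ 0 ≤ affineFn q b ∧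
    0 ≤ affineFn q c ∧ (0 < affineFn q a ∨ 0 < affineFn q b)

/-- `q` separates the segments `a c` and `c b` away from `c`. -/
def CornerCert (a b c : R3) (q : ℝ × ℝ × ℝ × ℝ) : Prop :=
  affineFn q c = 0 ∧ 0 < affineFn q a ∧ affineFn q b ≤ 0

theorem CornerCert.eq {a b c p : R3} {q : ℝ × ℝ × ℝ × ℝ} (h : CornerCert a b c q)
    (h1 : p ∈ segment ℝ a c) (h2 : p ∈ segment ℝ c b) : p = c := by
  have h3 := affineFn_nonpos_of_mem_segment h.1.le h.2.2 h2
  obtain ⟨s, t, hs, ht, hst, rfl⟩ := h1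
  rw [affineFn_comb q hst, h.1] at h3
  have : s = 0 := by
    have := h.2.1
    by_contra h0
    have : 0 < s := lt_of_le_of_ne hs (Ne.symm h0)
    nlinarith [mul_pos this h.2.1]
  subst this
  obtain rfl : t = 1 := by linarith
  simp

theorem segment_subset_triangle (a b c : R3) : segment ℝ a b ⊆ convexHull ℝ {a, b, c} := by
  rw [← convexHull_pair]
  exact convexHull_mono (by intro x; simp; tauto)

/-- Off its side `a b` the triangle lies where `q` is positive, while `e` lies where `q` is
nonpositive; so `e` meets the triangle in that side only, and meets the new edges only in `a` or
`b`. Triangles may be degenerate, and the corner certificate excludes that `a c` and `c b` overlap.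
-/
theorem IsEdgeSetOf.insert {E : Set (R3 × R3)} {T : LinkType} {a b c : R3}
    (h : IsEdgeSetOf (E ∪ {(a, b)}) T) (hr : ∃ q, CornerCert a b c q) (hbc : b ≠ c)
    (hE : ∀ e ∈ E, e ≠ (a, b) ∧ ∃ q, InsertCert a b c e q) :
    IsEdgeSetOf (E ∪ {(a, c), (c, b)}) T := by
  obtain ⟨L, hL, rfl⟩ := h
  obtain ⟨r, hr⟩ := hr
  have hmem : ∀ e, e ∈ L.edges ↔ e ∈ E ∨ e = (a, b) := fun e => by
    rw [hL]; rfl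
  have hac : a ≠ c := by
    rintro rfl
    exact hr.2.1.ne' hr.1
  have hab : a ≠ b := L.tail_ne_head (a, b) ((hmem _).2 (.inr rfl))
  have hab' : (a, b) ∈ L.edges := (hmem _).2 (.inr rfl)
  have hEL : ∀ e ∈ E, e ∈ L.edges := fun e he => (hmem e).2 (.inl he)
  -- `c` is not an endpoint of another edge
  have hc1 : ∀ e ∈ E, e.1 ≠ c ∧ e.2 ≠ c := by
    intro e he
    obtain ⟨-, q, h1, h2, -, -, h5⟩ := hE e he
    refine ⟨?_, ?_⟩ <;> rintro rfl <;> linarith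
  have hca : ∀ e ∈ E, ∀ p, p ∈ segment ℝ e.1 e.2 → p ∈ segment ℝ a c → p = a := by
    intro e he p hp hp'
    obtain ⟨-, q, h1, h2, h3, h4, h5⟩ := hE e he
    have h6 := affineFn_nonpos_of_mem_segment h1 h2 hp
    obtain ⟨s, t, hs, ht, hst, rfl⟩ := hp'
    rw [affineFn_comb q hst] at h6
    have : t = 0 := by
      by_contra h0
      have : 0 < t := lt_of_le_of_ne ht (Ne.symm h0)
      nlinarith [mul_pos this h5, mul_nonneg hs h3]
    subst this
    obtain rfl : s = 1 := by linarith
    simp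
  have hcb : ∀ e ∈ E, ∀ p, p ∈ segment ℝ e.1 e.2 → p ∈ segment ℝ c b → p = b := by
    intro e he p hp hp'
    obtain ⟨-, q, h1, h2, h3, h4, h5⟩ := hE e he
    have h6 := affineFn_nonpos_of_mem_segment h1 h2 hp
    obtain ⟨s, t, hs, ht, hst, rfl⟩ := hp'
    rw [affineFn_comb q hst] at h6
    have : s = 0 := by
      by_contra h0
      have : 0 < s := lt_of_le_of_ne hs (Ne.symm h0)
      nlinarith [mul_pos this h5, mul_nonneg ht h4]
    subst this
    obtain rfl : t = 1 := by linarith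
    simp
  have haend : ∀ e ∈ E, a ∈ segment ℝ e.1 e.2 → a = e.1 ∨ a = e.2 := fun e he hp =>
    (L.embedded e (hEL e he) _ hab' (hE e he).1 a hp (left_mem_segment _ _ _)).1
  have hbend : ∀ e ∈ E, b ∈ segment ℝ e.1 e.2 → b = e.1 ∨ b = e.2 := fun e he hp =>
    (L.embedded e (hEL e he) _ hab' (hE e he).1 b hp (right_mem_segment _ _ _)).1
  let L' : PolygonalLink :=
    { edges := E ∪ {(a, c), (c, b)}
      finite := by
        refine Set.Finite.union (L.finite.subset hEL) (by simp)
      tail_ne_head := by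
        rintro e (he | rfl | rfl)
        · exact L.tail_ne_head e (hEL e he)
        · exact hac
        · exact hbc.symm
      closed := by
        have key : ∀ e ∈ L.edges, ∃ f ∈ E ∪ {(a, c), (c, b)}, f.1 = e.2 := by
          intro e he
          obtain ⟨f, hf, hfe⟩ := L.closed e he
          rcases (hmem f).1 hf with hf | rfl
          · exact ⟨f, .inl hf, hfe⟩
          · exact ⟨(a, c), .inr (.inl rfl), hfe⟩
        rintro e (he | rfl | rfl)
        · exact key e (hEL e he)
        · exact ⟨(c, b), .inr (.inr rfl), rfl⟩
        · exact key (a, b) hab'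
      tail_inj := by
        rintro e (he | rfl | rfl) f (hf | rfl | rfl) hef
        · exact L.tail_inj e (hEL e he) f (hEL f hf) hef
        · exact absurd (L.tail_inj e (hEL e he) _ hab' hef) (hE e he).1
        · exact absurd hef (hc1 e he).1
        · exact absurd (L.tail_inj f (hEL f hf) _ hab' hef.symm) (hE f hf).1
        · rfl
        · exact absurd hef hac
        · exact absurd hef.symm (hc1 f hf).1
        · exact absurd hef.symm hac
        · rfl
      head_inj := by
        rintro e (he | rfl | rfl) f (hf | rfl | rfl) hef
        · exact L.head_inj e (hEL e he) f (hEL f hf) hef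
        · exact absurd hef (hc1 e he).2
        · exact absurd (L.head_inj e (hEL e he) _ hab' hef) (hE e he).1
        · exact absurd hef.symm (hc1 f hf).2
        · rfl
        · exact absurd hef.symm hbc
        · exact absurd (L.head_inj f (hEL f hf) _ hab' hef.symm) (hE f hf).1
        · exact absurd hef hbc
        · rfl
      embedded := by
        have k1 : ∀ e ∈ E, ∀ p ∈ segment ℝ e.1 e.2, p ∈ segment ℝ a c →
            (p = e.1 ∨ p = e.2) ∧ (p = a ∨ p = c) := by
          intro e he p hp hp'
          obtain rfl := hca e he p hp hp'
          exact ⟨haend e he hp, .inl rfl⟩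
        have k2 : ∀ e ∈ E, ∀ p ∈ segment ℝ e.1 e.2, p ∈ segment ℝ c b →
            (p = e.1 ∨ p = e.2) ∧ (p = c ∨ p = b) := by
          intro e he p hp hp'
          obtain rfl := hcb e he p hp hp'
          exact ⟨hbend e he hp, .inr rfl⟩
        rintro e (he | rfl | rfl) f (hf | rfl | rfl) hef p hp hp'
        · exact L.embedded e (hEL e he) f (hEL f hf) hef p hp hp'
        · exact k1 e he p hp hp'
        · exact k2 e he p hp hp'
        · exact (k1 f hf p hp' hp).symm
        · exact absurd rfl hef
        · obtain rfl := hr.eq hp hp'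
          exact ⟨.inr rfl, .inl rfl⟩
        · exact (k2 f hf p hp' hp).symm
        · obtain rfl := hr.eq hp' hp
          exact ⟨.inl rfl, .inr rfl⟩
        · exact absurd rfl hef }
  refine ⟨L', rfl, (Quot.sound ⟨a, b, c, hab', ?_, ?_⟩).symm⟩
  · apply Set.Subset.antisymm
    · rintro p ⟨hp, hp'⟩
      simp only [PolygonalLink.carrier, Set.mem_iUnion] at hp'
      obtain ⟨e, he, hpe⟩ := hp'
      rcases (hmem e).1 he with he | rfl
      · obtain ⟨-, q, h1, h2, h3, h4, h5⟩ := hE e he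
        have h6 := affineFn_nonpos_of_mem_segment h1 h2 hpe
        obtain ⟨s, t, u, hs, ht, hu, hst, rfl⟩ := mem_convexHull_triple hp
        rw [affineFn_comb₃ q hst] at h6
        have : u = 0 := by
          by_contra h0
          have : 0 < u := lt_of_le_of_ne hu (Ne.symm h0)
          nlinarith [mul_pos this h5, mul_nonneg ht h4, mul_nonneg hs h3]
        subst this
        exact ⟨s, t, hs, ht, by linarith, by simp⟩
      · exact hpe
    · intro p hp
      refine ⟨segment_subset_triangle a b c hp, ?_⟩
      simp only [PolygonalLink.carrier, Set.mem_iUnion]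
      exact ⟨_, hab', hp⟩
  · rw [hL]
    ext e
    constructor
    · rintro (he | he)
      · exact .inl ⟨.inl he, (hE e he).1⟩
      · exact .inr he
    · rintro (⟨he | he, h⟩ | he)
      · exact .inl he
      · exact absurd he h
      · exact .inr he

/-- The inverse Δ-move needs weaker certificates, because the link is already embedded along `a c`
and `c b`. Where `e` meets the triangle, the weight of `a` or of `b` vanishes by the sign of `q`, so
the point lies on one of these two edges and is an endpoint of it. It is not `c`, whose two edges
are exactly the ones to be removed. -/
theorem IsEdgeSetOf.delete {E : Set (R3 × R3)} {T : LinkType} {a b c : R3}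
    (h : IsEdgeSetOf (E ∪ {(a, c), (c, b)}) T) (hab : a ≠ b)
    (hE : ∀ e ∈ E, e ≠ (a, c) ∧ e ≠ (c, b) ∧ ∃ q, DeleteCert a b c e q) :
    IsEdgeSetOf (E ∪ {(a, b)}) T := by
  obtain ⟨L, hL, rfl⟩ := h
  have hmem : ∀ e, e ∈ L.edges ↔ e ∈ E ∨ e = (a, c) ∨ e = (c, b) := fun e => by
    rw [hL]; rfl
  have hac : (a, c) ∈ L.edges := (hmem _).2 (.inr (.inl rfl))
  have hcb : (c, b) ∈ L.edges := (hmem _).2 (.inr (.inr rfl))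
  have hEL : ∀ e ∈ E, e ∈ L.edges := fun e he => (hmem e).2 (.inl he)
  have hne1 : a ≠ c := L.tail_ne_head _ hac
  have hne2 : c ≠ b := L.tail_ne_head _ hcb
  have hta : ∀ e ∈ E, e.1 ≠ a := fun e he h => (hE e he).1 (L.tail_inj e (hEL e he) _ hac h)
  have hhb : ∀ e ∈ E, e.2 ≠ b := fun e he h => (hE e he).2.1 (L.head_inj e (hEL e he) _ hcb h)
  have hce : ∀ e ∈ E, c ∉ segment ℝ e.1 e.2 := by
    intro e he hc
    have := (L.embedded e (hEL e he) _ hac (hE e he).1 c hc (right_mem_segment _ _ _)).1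
    rcases this with h | h
    · exact (hE e he).2.1 (L.tail_inj e (hEL e he) _ hcb h.symm)
    · exact (hE e he).1 (L.head_inj e (hEL e he) _ hac h.symm)
  have haend : ∀ e ∈ E, a ∈ segment ℝ e.1 e.2 → a = e.1 ∨ a = e.2 := fun e he hp =>
    (L.embedded e (hEL e he) _ hac (hE e he).1 a hp (left_mem_segment _ _ _)).1
  have hbend : ∀ e ∈ E, b ∈ segment ℝ e.1 e.2 → b = e.1 ∨ b = e.2 := fun e he hp =>
    (L.embedded e (hEL e he) _ hcb (hE e he).2.1 b hp (right_mem_segment _ _ _)).1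
  -- the triangle meets the other edges at most in `a` and `b`
  have htri : ∀ e ∈ E, ∀ p ∈ segment ℝ e.1 e.2, p ∈ convexHull ℝ {a, b, c} → p = a ∨ p = b := by
    intro e he p hp hp'
    obtain ⟨hn1, hn2, q, h1, h2, h3, h4, h5, h6⟩ := hE e he
    have h7 := affineFn_nonpos_of_mem_segment h1 h2 hp
    obtain ⟨s, t, u, hs, ht, hu, hst, hp''⟩ := mem_convexHull_triple hp'
    rw [hp'', affineFn_comb₃ q hst] at h7
    rcases h6 with h6 | h6
    · have : s = 0 := by
        by_contra h0
        have : 0 < s := lt_of_le_of_ne hs (Ne.symm h0)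
        nlinarith [mul_pos this h6, mul_nonneg ht h4, mul_nonneg hu h5]
      subst this
      have hp3 : p ∈ segment ℝ c b := ⟨u, t, hu, ht, by linarith, by rw [hp'']; simp [add_comm]⟩
      rcases (L.embedded e (hEL e he) _ hcb hn2 p hp hp3).2 with h | h
      · exact absurd ((show p = c from h) ▸ hp) (hce e he)
      · exact .inr h
    · have : t = 0 := by
        by_contra h0
        have : 0 < t := lt_of_le_of_ne ht (Ne.symm h0)
        nlinarith [mul_pos this h6, mul_nonneg hs h3, mul_nonneg hu h5]
      subst this
      have hp3 : p ∈ segment ℝ a c := ⟨s, u, hs, hu, by linarith, by rw [hp'']; simp⟩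
      rcases (L.embedded e (hEL e he) _ hac hn1 p hp hp3).2 with h | h
      · exact .inl h
      · exact absurd ((show p = c from h) ▸ hp) (hce e he)
  let L' : PolygonalLink :=
    { edges := E ∪ {(a, b)}
      finite := by
        refine Set.Finite.union (L.finite.subset hEL) (by simp)
      tail_ne_head := by
        rintro e (he | rfl)
        · exact L.tail_ne_head e (hEL e he)
        · exact hab
      closed := by
        have key : ∀ e ∈ L.edges, e.2 ≠ c → ∃ f ∈ E ∪ {(a, b)}, f.1 = e.2 := by
          intro e he hec
          obtain ⟨f, hf, hfe⟩ := L.closed e he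
          rcases (hmem f).1 hf with hf | rfl | rfl
          · exact ⟨f, .inl hf, hfe⟩
          · exact ⟨(a, b), .inr rfl, hfe⟩
          · exact absurd hfe.symm hec
        rintro e (he | rfl)
        · exact key e (hEL e he) fun h => hce e he (h ▸ right_mem_segment _ _ _)
        · exact key (c, b) hcb hne2.symm
      tail_inj := by
        rintro e (he | rfl) f (hf | rfl) hef
        · exact L.tail_inj e (hEL e he) f (hEL f hf) hef
        · exact absurd hef (hta e he)
        · exact absurd hef.symm (hta f hf)
        · rfl
      head_inj := by
        rintro e (he | rfl) f (hf | rfl) hef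
        · exact L.head_inj e (hEL e he) f (hEL f hf) hef
        · exact absurd hef (hhb e he)
        · exact absurd hef.symm (hhb f hf)
        · rfl
      embedded := by
        have k1 : ∀ e ∈ E, ∀ p ∈ segment ℝ e.1 e.2, p ∈ segment ℝ a b →
            (p = e.1 ∨ p = e.2) ∧ (p = a ∨ p = b) := by
          intro e he p hp hp'
          rcases htri e he p hp (segment_subset_triangle a b c hp') with rfl | rfl
          · exact ⟨haend e he hp, .inl rfl⟩
          · exact ⟨hbend e he hp, .inr rfl⟩
        rintro e (he | rfl) f (hf | rfl) hef p hp hp'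
        · exact L.embedded e (hEL e he) f (hEL f hf) hef p hp hp'
        · exact k1 e he p hp hp'
        · exact (k1 f hf p hp' hp).symm
        · exact absurd rfl hef }
  refine ⟨L', rfl, Quot.sound ⟨a, b, c, .inr rfl, ?_, ?_⟩⟩
  · apply Set.Subset.antisymm
    · rintro p ⟨hp, hp'⟩
      simp only [PolygonalLink.carrier, Set.mem_iUnion] at hp'
      obtain ⟨e, he | rfl, hpe⟩ := hp'
      · rcases htri e he p hpe hp with rfl | rfl
        · exact left_mem_segment _ _ _
        · exact right_mem_segment _ _ _
      · exact hpe
    · intro p hp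
      refine ⟨segment_subset_triangle a b c hp, ?_⟩
      simp only [PolygonalLink.carrier, Set.mem_iUnion]
      exact ⟨(a, b), .inr rfl, hp⟩
  · rw [hL]
    ext e
    have hn : (a, b) ∉ E := fun h => hta _ h rfl
    constructor
    · rintro (he | he)
      · exact .inl ⟨.inl he, fun h => hn (h ▸ he)⟩
      · exact .inr he
    · rintro (⟨he | he, h⟩ | he)
      · exact .inl he
      · exact absurd he h
      · exact .inr he

/-! ### Certified local moves in a lattice box -/

/-- A point of the half-integral lattice, placed with the origin at `(i, t, 0)`. -/
noncomputable def latticePt (i t : ℕ) (p : ℤ × ℤ × ℤ) : R3 :=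
  ((i : ℝ) + (p.1 : ℝ) / 2, (t : ℝ) + (p.2.1 : ℝ) / 2, (p.2.2 : ℝ))

noncomputable def latticeEdge (i t : ℕ) (e : (ℤ × ℤ × ℤ) × (ℤ × ℤ × ℤ)) : R3 × R3 :=
  (latticePt i t e.1, latticePt i t e.2)

theorem latticePt_injective (i t : ℕ) : Function.Injective (latticePt i t) := by
  rintro ⟨x, y, z⟩ ⟨x', y', z'⟩ h
  simp only [latticePt, Prod.mk.injEq] at h
  obtain ⟨h1, h2, h3⟩ := h
  have h1' : (x : ℝ) = x' := by linarith
  have h2' : (y : ℝ) = y' := by linarith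
  norm_cast at h1' h2' h3
  simp [h1', h2', h3]

theorem latticeEdge_injective (i t : ℕ) : Function.Injective (latticeEdge i t) := by
  rintro ⟨a, b⟩ ⟨a', b'⟩ h
  simp only [latticeEdge, Prod.mk.injEq] at h
  rw [latticePt_injective i t h.1, latticePt_injective i t h.2]

/-- An affine function with integral coefficients. -/
def intFn (q : ℤ × ℤ × ℤ × ℤ) (p : ℤ × ℤ × ℤ) : ℤ :=
  q.1 * p.1 + q.2.1 * p.2.1 + q.2.2.1 * p.2.2 + q.2.2.2

/-- The coefficients, in the coordinates of `R3`, of an affine function on the lattice. -/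
noncomputable def latticeFn (i t : ℕ) (q : ℤ × ℤ × ℤ × ℤ) : ℝ × ℝ × ℝ × ℝ :=
  (2 * q.1, 2 * q.2.1, q.2.2.1, q.2.2.2 - 2 * q.1 * i - 2 * q.2.1 * t)

theorem affineFn_latticeFn (i t : ℕ) (q : ℤ × ℤ × ℤ × ℤ) (p : ℤ × ℤ × ℤ) :
    affineFn (latticeFn i t q) (latticePt i t p) = (intFn q p : ℝ) := by
  simp only [affineFn, latticeFn, latticePt, intFn]
  push_cast
  ring

abbrev LatticeEdge : Type := (ℤ × ℤ × ℤ) × (ℤ × ℤ × ℤ)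

/-- A local move in a box: inserting or deleting the vertex `c` between `a` and `b`, with a list of
affine functions that certify that it does not interfere with the other edges. -/
inductive BoxMove : Type
  | ins (a b c : ℤ × ℤ × ℤ) (r : ℤ × ℤ × ℤ × ℤ) (qs : List (ℤ × ℤ × ℤ × ℤ))
  | del (a b c : ℤ × ℤ × ℤ) (qs : List (ℤ × ℤ × ℤ × ℤ))

def insertCertB (a b c : ℤ × ℤ × ℤ) (e : LatticeEdge) (q : ℤ × ℤ × ℤ × ℤ) : Bool :=
  decide (intFn q e.1 ≤ 0) && decide (intFn q e.2 ≤ 0) && decide (0 ≤ intFn q a) &&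
    decide (0 ≤ intFn q b) && decide (0 < intFn q c)

def deleteCertB (a b c : ℤ × ℤ × ℤ) (e : LatticeEdge) (q : ℤ × ℤ × ℤ × ℤ) : Bool :=
  decide (intFn q e.1 ≤ 0) && decide (intFn q e.2 ≤ 0) && decide (0 ≤ intFn q a) &&
    decide (0 ≤ intFn q b) && decide (0 ≤ intFn q c) &&
    (decide (0 < intFn q a) || decide (0 < intFn q b))

/-- The point lies in the box with side lengths `w / 2`, `h / 2`. -/
def inBoxB (w h : ℤ) (p : ℤ × ℤ × ℤ) : Bool :=
  decide (0 ≤ p.1) && decide (p.1 ≤ w) && decide (0 ≤ p.2.1) && decide (p.2.1 ≤ h) &&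
    decide (0 ≤ p.2.2)

/-- The last two conditions exclude edges inside the faces `y = 0` and `y = h`. The diagram
continues beyond these faces, and a function that separates the box from an outer edge may vanish on
one of them. -/
def edgeInBoxB (w h : ℤ) (e : LatticeEdge) : Bool :=
  inBoxB w h e.1 && inBoxB w h e.2 && (decide (0 < e.1.2.1) || decide (0 < e.2.2.1)) &&
    (decide (e.1.2.1 < h) || decide (e.2.2.1 < h))

def BoxMove.run (w h : ℤ) (l : List LatticeEdge) : BoxMove → Option (List LatticeEdge)
  | .ins a b c r qs =>
    let l' := l.filter fun e => decide (e ≠ (a, b))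
    if decide ((a, b) ∈ l) && decide (b ≠ c) && inBoxB w h c && decide (0 < c.2.1) &&
      decide (c.2.1 < h) && decide (intFn r c = 0) && decide (0 < intFn r a) &&
      decide (intFn r b ≤ 0) && l'.all (fun e => qs.any (insertCertB a b c e)) then
      some ((a, c) :: (c, b) :: l') else none
  | .del a b c qs =>
    let l' := l.filter fun e => decide (e ≠ (a, c)) && decide (e ≠ (c, b))
    if decide ((a, c) ∈ l) && decide ((c, b) ∈ l) && decide (a ≠ b) && edgeInBoxB w h (a, b) &&
      l'.all (fun e => qs.any (deleteCertB a b c e)) then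
      some ((a, b) :: l') else none

def runBoxMoves (w h : ℤ) : List LatticeEdge → List BoxMove → Option (List LatticeEdge)
  | l, [] => some l
  | l, m :: ms => (m.run w h l).bind fun l' => runBoxMoves w h l' ms

/-- The moves `ms` turn `l` into `l'`. -/
def boxMovesB (w h : ℤ) (l l' : List LatticeEdge) (ms : List BoxMove) : Bool :=
  l.all (edgeInBoxB w h) &&
  match runBoxMoves w h l ms with
  | none => false
  | some k => k.all (fun e => decide (e ∈ l')) && l'.all (fun e => decide (e ∈ k))

/-- The edge `e` lies off the box with the corner `(i, t, 0)`. -/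
def OffBox (i t : ℕ) (w h : ℤ) (e : R3 × R3) : Prop :=
  (e.1.2.1 ≤ t ∧ e.2.2.1 ≤ t) ∨ ((t : ℝ) + h / 2 ≤ e.1.2.1 ∧ (t : ℝ) + h / 2 ≤ e.2.2.1) ∨
  (e.1.1 ≤ i - 1 ∧ e.2.1 ≤ i - 1) ∨ ((i : ℝ) + w / 2 + 1 ≤ e.1.1 ∧ (i : ℝ) + w / 2 + 1 ≤ e.2.1) ∨
  (e.1.2.2 ≤ -1 ∧ e.2.2.2 ≤ -1)

/-- Outer edges may touch the box in its first and last face, so positivity is available only away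
from one of the two. On the other sides there is a gap of length one. -/
theorem OffBox.exists_fn {i t : ℕ} {w h : ℤ} {e : R3 × R3} (he : OffBox i t w h e) :
    ∃ q, affineFn q e.1 ≤ 0 ∧ affineFn q e.2 ≤ 0 ∧
      (∀ p, inBoxB w h p = true → 0 ≤ affineFn q (latticePt i t p)) ∧
      ((∀ p, inBoxB w h p = true → 0 < p.2.1 → 0 < affineFn q (latticePt i t p)) ∨
        (∀ p, inBoxB w h p = true → p.2.1 < h → 0 < affineFn q (latticePt i t p))) := by
  have key : ∀ p : ℤ × ℤ × ℤ, inBoxB w h p = true →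
      (0 : ℝ) ≤ p.1 ∧ (p.1 : ℝ) ≤ w ∧ (0 : ℝ) ≤ p.2.1 ∧ (p.2.1 : ℝ) ≤ h ∧ (0 : ℝ) ≤ p.2.2 := by
    intro p hp
    simp only [inBoxB, Bool.and_eq_true, decide_eq_true_eq] at hp
    exact_mod_cast And.intro hp.1.1.1.1 (And.intro hp.1.1.1.2 (And.intro hp.1.1.2 (And.intro hp.1.2 hp.2)))
  rcases he with ⟨h1, h2⟩ | ⟨h1, h2⟩ | ⟨h1, h2⟩ | ⟨h1, h2⟩ | ⟨h1, h2⟩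
  · refine ⟨(0, 1, 0, -t), ?_, ?_, fun p hp => ?_, .inl fun p hp hp' => ?_⟩ <;>
      simp only [affineFn, latticePt]
    · linarith
    · linarith
    · linarith [(key p hp).2.2.1]
    · have : (0 : ℝ) < p.2.1 := by exact_mod_cast hp'
      linarith
  · refine ⟨(0, -1, 0, t + h / 2), ?_, ?_, fun p hp => ?_, .inr fun p hp hp' => ?_⟩ <;>
      simp only [affineFn, latticePt]
    · linarith
    · linarith
    · linarith [(key p hp).2.2.2.1]
    · have : (p.2.1 : ℝ) < h := by exact_mod_cast hp'
      linarith
  · refine ⟨(1, 0, 0, -i + 1), ?_, ?_, fun p hp => ?_, .inl fun p hp hp' => ?_⟩ <;>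
      simp only [affineFn, latticePt]
    · linarith
    · linarith
    · linarith [(key p hp).1]
    · linarith [(key p hp).1]
  · refine ⟨(-1, 0, 0, i + w / 2 + 1), ?_, ?_, fun p hp => ?_, .inl fun p hp hp' => ?_⟩ <;>
      simp only [affineFn, latticePt]
    · linarith
    · linarith
    · linarith [(key p hp).2.1]
    · linarith [(key p hp).2.1]
  · refine ⟨(0, 0, 1, 1), ?_, ?_, fun p hp => ?_, .inl fun p hp hp' => ?_⟩ <;>
      simp only [affineFn, latticePt]
    · linarith
    · linarith
    · linarith [(key p hp).2.2.2.2]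
    · linarith [(key p hp).2.2.2.2]

theorem OffBox.ne_latticeEdge {i t : ℕ} {w h : ℤ} {e : R3 × R3} (he : OffBox i t w h e)
    {f : LatticeEdge} (hf : edgeInBoxB w h f = true) : e ≠ latticeEdge i t f := by
  rintro rfl
  obtain ⟨q, h1, h2, -, h3⟩ := he.exists_fn
  simp only [edgeInBoxB, Bool.and_eq_true, Bool.or_eq_true, decide_eq_true_eq] at hf
  obtain ⟨⟨⟨hf1, hf2⟩, hf3⟩, hf4⟩ := hf
  simp only [latticeEdge] at h1 h2
  rcases h3 with h3 | h3
  · rcases hf3 with hf3 | hf3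
    · linarith [h3 _ hf1 hf3]
    · linarith [h3 _ hf2 hf3]
  · rcases hf4 with hf4 | hf4
    · linarith [h3 _ hf1 hf4]
    · linarith [h3 _ hf2 hf4]

theorem InsertCert.of_lattice {i t : ℕ} {a b c : ℤ × ℤ × ℤ} {e : LatticeEdge}
    {q : ℤ × ℤ × ℤ × ℤ} (h : insertCertB a b c e q = true) :
    InsertCert (latticePt i t a) (latticePt i t b) (latticePt i t c) (latticeEdge i t e)
      (latticeFn i t q) := by
  simp only [insertCertB, Bool.and_eq_true, decide_eq_true_eq] at h
  simp only [InsertCert, latticeEdge, affineFn_latticeFn]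
  exact_mod_cast And.intro h.1.1.1.1 (And.intro h.1.1.1.2 (And.intro h.1.1.2 (And.intro h.1.2 h.2)))

theorem DeleteCert.of_lattice {i t : ℕ} {a b c : ℤ × ℤ × ℤ} {e : LatticeEdge}
    {q : ℤ × ℤ × ℤ × ℤ} (h : deleteCertB a b c e q = true) :
    DeleteCert (latticePt i t a) (latticePt i t b) (latticePt i t c) (latticeEdge i t e)
      (latticeFn i t q) := by
  simp only [deleteCertB, Bool.and_eq_true, Bool.or_eq_true, decide_eq_true_eq] at h
  simp only [DeleteCert, latticeEdge, affineFn_latticeFn]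
  exact_mod_cast And.intro h.1.1.1.1.1 (And.intro h.1.1.1.1.2 (And.intro h.1.1.1.2 (And.intro h.1.1.2 (And.intro h.1.2 h.2))))

/-- Edges in the box are covered by the functions listed with the move, edges off the box by
`OffBox.exists_fn`. -/
theorem BoxMove.run_sound {i t : ℕ} {w h : ℤ} {O : Set (R3 × R3)} {T : LinkType}
    (hO : ∀ e ∈ O, OffBox i t w h e) {l l' : List LatticeEdge} {m : BoxMove}
    (hl : ∀ e ∈ l, edgeInBoxB w h e = true) (hm : m.run w h l = some l')
    (hT : IsEdgeSetOf (O ∪ latticeEdge i t '' {e | e ∈ l}) T) :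
    (∀ e ∈ l', edgeInBoxB w h e = true) ∧
      IsEdgeSetOf (O ∪ latticeEdge i t '' {e | e ∈ l'}) T := by
  have hbox : ∀ e ∈ l, inBoxB w h e.1 = true ∧ inBoxB w h e.2 = true := fun e he => by
    have := hl e he
    simp only [edgeInBoxB, Bool.and_eq_true] at this
    exact this.1.1
  cases m with
  | ins a b c r qs =>
    simp only [BoxMove.run, Option.ite_none_right_eq_some, Bool.and_eq_true, decide_eq_true_eq,
      Option.some.injEq] at hm
    obtain ⟨⟨⟨⟨⟨⟨⟨⟨⟨h1, h2⟩, h3⟩, h4⟩, h5⟩, h6⟩, h7⟩, h8⟩, h9⟩, rfl⟩ := hm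
    obtain ⟨ha, hb⟩ := hbox _ h1
    refine ⟨?_, ?_⟩
    · intro e he
      rw [List.mem_cons, List.mem_cons] at he
      rcases he with rfl | rfl | he
      · simp only [edgeInBoxB, ha, h3, h4, h5, decide_true, Bool.or_true, Bool.and_self]
      · simp only [edgeInBoxB, hb, h3, h4, h5, decide_true, Bool.true_or, Bool.and_self]
      · exact hl e (List.mem_of_mem_filter he)
    · have e1 : O ∪ latticeEdge i t '' {e | e ∈ l} =
          (O ∪ latticeEdge i t '' {e | e ∈ l ∧ e ≠ (a, b)}) ∪
            {(latticePt i t a, latticePt i t b)} := by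
        rw [Set.union_assoc]
        congr 1
        ext e
        constructor
        · rintro ⟨f, hf, rfl⟩
          by_cases hfa : f = (a, b)
          · right; subst hfa; rfl
          · exact .inl ⟨f, ⟨hf, hfa⟩, rfl⟩
        · rintro (⟨f, hf, rfl⟩ | rfl)
          · exact ⟨f, hf.1, rfl⟩
          · exact ⟨_, h1, rfl⟩
      rw [e1] at hT
      have := hT.insert (c := latticePt i t c)
        ⟨latticeFn i t r, by
          simp only [CornerCert, affineFn_latticeFn]
          exact_mod_cast And.intro h6 (And.intro h7 h8)⟩ (fun hh => h2 (latticePt_injective i t hh)) ?_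
      · convert this using 1
        rw [Set.union_assoc]
        congr 1
        ext e
        simp only [List.mem_cons, List.mem_filter, decide_eq_true_eq]
        constructor
        · rintro ⟨f, rfl | rfl | hf, rfl⟩
          · exact .inr (.inl rfl)
          · exact .inr (.inr rfl)
          · exact .inl ⟨f, hf, rfl⟩
        · rintro (⟨f, hf, rfl⟩ | rfl | rfl)
          · exact ⟨f, .inr (.inr hf), rfl⟩
          · exact ⟨_, .inl rfl, rfl⟩
          · exact ⟨_, .inr (.inl rfl), rfl⟩
      · rintro e (he | ⟨f, hf, rfl⟩)
        · refine ⟨(hO e he).ne_latticeEdge (f := (a, b)) (hl _ h1), ?_⟩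
          obtain ⟨q, g1, g2, g3, g4⟩ := (hO e he).exists_fn
          exact ⟨q, g1, g2, g3 _ ha, g3 _ hb, g4.elim (fun g => g _ h3 h4) (fun g => g _ h3 h5)⟩
        · refine ⟨fun hh => hf.2 (latticeEdge_injective i t (a₂ := (a, b)) hh), ?_⟩
          rw [List.all_eq_true] at h9
          have := h9 f (List.mem_filter.2 ⟨hf.1, by simpa using hf.2⟩)
          rw [List.any_eq_true] at this
          obtain ⟨q, -, hq⟩ := this
          exact ⟨_, InsertCert.of_lattice hq⟩
  | del a b c qs =>
    simp only [BoxMove.run, Option.ite_none_right_eq_some, Bool.and_eq_true, decide_eq_true_eq,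
      Option.some.injEq] at hm
    obtain ⟨⟨⟨⟨⟨h1, h2⟩, h3⟩, h4⟩, h5⟩, rfl⟩ := hm
    obtain ⟨ha, hc⟩ := hbox _ h1
    obtain ⟨-, hb⟩ := hbox _ h2
    refine ⟨?_, ?_⟩
    · intro e he
      rw [List.mem_cons] at he
      rcases he with rfl | he
      · exact h4
      · exact hl e (List.mem_of_mem_filter he)
    · have e1 : O ∪ latticeEdge i t '' {e | e ∈ l} =
          (O ∪ latticeEdge i t '' {e | e ∈ l ∧ e ≠ (a, c) ∧ e ≠ (c, b)}) ∪
            {(latticePt i t a, latticePt i t c), (latticePt i t c, latticePt i t b)} := by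
        rw [Set.union_assoc]
        congr 1
        ext e
        constructor
        · rintro ⟨f, hf, rfl⟩
          by_cases hfa : f = (a, c)
          · right; left; subst hfa; rfl
          by_cases hfb : f = (c, b)
          · right; right; subst hfb; rfl
          · exact .inl ⟨f, ⟨hf, hfa, hfb⟩, rfl⟩
        · rintro (⟨f, hf, rfl⟩ | rfl | rfl)
          · exact ⟨f, hf.1, rfl⟩
          · exact ⟨_, h1, rfl⟩
          · exact ⟨_, h2, rfl⟩
      rw [e1] at hT
      have := hT.delete (fun hh => h3 (latticePt_injective i t hh)) ?_
      · convert this using 1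
        rw [Set.union_assoc]
        congr 1
        ext e
        simp only [List.mem_cons, List.mem_filter, decide_eq_true_eq, Bool.and_eq_true]
        constructor
        · rintro ⟨f, rfl | hf, rfl⟩
          · exact .inr rfl
          · exact .inl ⟨f, hf, rfl⟩
        · rintro (⟨f, hf, rfl⟩ | rfl)
          · exact ⟨f, .inr hf, rfl⟩
          · exact ⟨_, .inl rfl, rfl⟩
      · rintro e (he | ⟨f, hf, rfl⟩)
        · refine ⟨(hO e he).ne_latticeEdge (f := (a, c)) (hl _ h1),
            (hO e he).ne_latticeEdge (f := (c, b)) (hl _ h2), ?_⟩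
          obtain ⟨q, g1, g2, g3, g4⟩ := (hO e he).exists_fn
          simp only [edgeInBoxB, Bool.and_eq_true, Bool.or_eq_true, decide_eq_true_eq] at h4
          refine ⟨q, g1, g2, g3 _ ha, g3 _ hb, g3 _ hc, ?_⟩
          rcases g4 with g4 | g4
          · exact h4.1.2.imp (g4 _ ha) (g4 _ hb)
          · exact h4.2.imp (g4 _ ha) (g4 _ hb)
        · refine ⟨fun hh => hf.2.1 (latticeEdge_injective i t (a₂ := (a, c)) hh),
            fun hh => hf.2.2 (latticeEdge_injective i t (a₂ := (c, b)) hh), ?_⟩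
          rw [List.all_eq_true] at h5
          have := h5 f (List.mem_filter.2 ⟨hf.1, by simpa using hf.2⟩)
          rw [List.any_eq_true] at this
          obtain ⟨q, -, hq⟩ := this
          exact ⟨_, DeleteCert.of_lattice hq⟩

theorem runBoxMoves_sound {i t : ℕ} {w h : ℤ} {O : Set (R3 × R3)} {T : LinkType}
    (hO : ∀ e ∈ O, OffBox i t w h e) (ms : List BoxMove) {l l' : List LatticeEdge}
    (hl : ∀ e ∈ l, edgeInBoxB w h e = true) (hm : runBoxMoves w h l ms = some l')
    (hT : IsEdgeSetOf (O ∪ latticeEdge i t '' {e | e ∈ l}) T) :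
    IsEdgeSetOf (O ∪ latticeEdge i t '' {e | e ∈ l'}) T := by
  induction ms generalizing l with
  | nil =>
    simp only [runBoxMoves, Option.some.injEq] at hm
    exact hm ▸ hT
  | cons m ms ih =>
    simp only [runBoxMoves, Option.bind_eq_some_iff] at hm
    obtain ⟨k, hk, hm⟩ := hm
    obtain ⟨h1, h2⟩ := BoxMove.run_sound hO hl hk hT
    exact ih h1 hm h2

theorem IsEdgeSetOf.boxMoves {i t : ℕ} {w h : ℤ} {O : Set (R3 × R3)} {T : LinkType}
    {l l' : List LatticeEdge} (ms : List BoxMove) (hms : boxMovesB w h l l' ms = true)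
    (hO : ∀ e ∈ O, OffBox i t w h e)
    (hT : IsEdgeSetOf (O ∪ latticeEdge i t '' {e | e ∈ l}) T) :
    IsEdgeSetOf (O ∪ latticeEdge i t '' {e | e ∈ l'}) T := by
  simp only [boxMovesB, Bool.and_eq_true] at hms
  obtain ⟨h1, h2⟩ := hms
  rw [List.all_eq_true] at h1
  cases hk : runBoxMoves w h l ms with
  | none => rw [hk] at h2; exact absurd h2 (by simp)
  | some k =>
    rw [hk] at h2
    simp only [Bool.and_eq_true, List.all_eq_true, decide_eq_true_eq] at h2
    have : {e | e ∈ l'} = {e | e ∈ k} := Set.ext fun e => ⟨h2.2 e, h2.1 e⟩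
    rw [this]
    exact runBoxMoves_sound hO ms h1 hk hT

/-! ### Braid diagrams as arrays of cells -/

/-- The edges of one cell (a position in a slab) of a braid diagram, in coordinates of the cell: `x`
says whether the strand crosses with the next one, `p` whether it crosses with the previous one. -/
def cellEdges (x p : Bool) : List LatticeEdge :=
  if x then [((0, 0, 0), (1, 1, 1)), ((1, 1, 1), (2, 2, 0)), ((2, 0, 0), (0, 2, 0))]
  else if p then [] else [((0, 0, 0), (0, 2, 0))]

def prevCol (X : ℕ → ℕ → Bool) (k s : ℕ) : Bool := decide (0 < k) && X (k - 1) s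

def cellEdgesAt (X : ℕ → ℕ → Bool) (k s : ℕ) : List LatticeEdge :=
  cellEdges (X k s) (prevCol X k s)

/-- The edges of the closed braid diagram on `n` strands with `l` slabs, where `X k s` says that the
strands at `k` and `k + 1` cross in the slab `s`. -/
def diagramEdges (n l : ℕ) (X : ℕ → ℕ → Bool) : Set (R3 × R3) :=
  {e | (∃ k s : ℕ, k < n ∧ s < l ∧ ∃ a ∈ cellEdgesAt X k s, e = latticeEdge k s a) ∨
    IsClosingEdge n l e}

def shiftPt (k s : ℕ) (p : ℤ × ℤ × ℤ) : ℤ × ℤ × ℤ := (p.1 + 2 * k, p.2.1 + 2 * s, p.2.2)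

def shiftEdge (k s : ℕ) (e : LatticeEdge) : LatticeEdge := (shiftPt k s e.1, shiftPt k s e.2)

theorem latticeEdge_shiftEdge (i t k s : ℕ) (e : LatticeEdge) :
    latticeEdge i t (shiftEdge k s e) = latticeEdge (i + k) (t + s) e := by
  simp only [latticeEdge, latticePt, shiftEdge, shiftPt, Prod.mk.injEq]
  push_cast
  exact ⟨⟨by ring, by ring, trivial⟩, by ring, by ring, trivial⟩

/-- The edges in a box of `W` positions and `H` slabs. -/
def boxEdges (W H : ℕ) (x : ℕ → ℕ → Bool) : List LatticeEdge :=
  (List.range W).flatMap fun k => (List.range H).flatMap fun s =>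
    (cellEdgesAt x k s).map (shiftEdge k s)

theorem mem_boxEdges {W H : ℕ} {x : ℕ → ℕ → Bool} {e : LatticeEdge} :
    e ∈ boxEdges W H x ↔ ∃ k s, k < W ∧ s < H ∧ ∃ a ∈ cellEdgesAt x k s, e = shiftEdge k s a := by
  simp only [boxEdges, List.mem_flatMap, List.mem_range, List.mem_map]
  constructor
  · rintro ⟨k, hk, s, hs, a, ha, rfl⟩
    exact ⟨k, s, hk, hs, a, ha, rfl⟩
  · rintro ⟨k, s, hk, hs, a, ha, rfl⟩
    exact ⟨k, hk, s, hs, a, ha, rfl⟩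

theorem cellEdges_coord {x p : Bool} {a : LatticeEdge} (ha : a ∈ cellEdges x p) :
    (0 ≤ a.1.1 ∧ a.1.1 ≤ 2 ∧ 0 ≤ a.2.1 ∧ a.2.1 ≤ 2 ∧ (x = false → a.1.1 = 0 ∧ a.2.1 = 0)) ∧
    (0 ≤ a.1.2.1 ∧ a.1.2.1 ≤ 2 ∧ 0 ≤ a.2.2.1 ∧ a.2.2.1 ≤ 2) ∧ 0 ≤ a.1.2.2 ∧ 0 ≤ a.2.2.2 := by
  cases x <;> cases p <;> simp [cellEdges] at ha <;> rcases ha with rfl | rfl | rfl <;> norm_num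

/-- The edges of a diagram outside of a box. -/
def outerEdges (n l : ℕ) (X : ℕ → ℕ → Bool) (i t W H : ℕ) : Set (R3 × R3) :=
  {e | (∃ k s : ℕ, k < n ∧ s < l ∧ ¬ ((i ≤ k ∧ k < i + W) ∧ (t ≤ s ∧ s < t + H)) ∧
      ∃ a ∈ cellEdgesAt X k s, e = latticeEdge k s a) ∨ IsClosingEdge n l e}

theorem diagramEdges_eq_outer_union_box {n l i t W H : ℕ} {X x : ℕ → ℕ → Bool} (hn : i + W ≤ n)
    (hl : t + H ≤ l) (hx : ∀ k s, k < W → s < H → X (i + k) (t + s) = x k s)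
    (hprev : ∀ s, s < H → prevCol X i (t + s) = false) :
    diagramEdges n l X =
      outerEdges n l X i t W H ∪ latticeEdge i t '' {e | e ∈ boxEdges W H x} := by
  have hcell : ∀ k s, k < W → s < H → cellEdgesAt X (i + k) (t + s) = cellEdgesAt x k s := by
    intro k s hk hs
    simp only [cellEdgesAt]
    rw [hx k s hk hs]
    congr 1
    rcases k with _ | k
    · rw [Nat.add_zero, hprev s hs]
      simp [prevCol]
    · have := hx k s (by omega) hs
      simpa [prevCol, ← add_assoc] using this
  ext e
  constructor
  · rintro (⟨k, s, hk, hs, a, ha, rfl⟩ | h)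
    · by_cases hb : (i ≤ k ∧ k < i + W) ∧ (t ≤ s ∧ s < t + H)
      · obtain ⟨⟨h1, h2⟩, h3, h4⟩ := hb
        obtain ⟨k, rfl⟩ := Nat.exists_eq_add_of_le h1
        obtain ⟨s, rfl⟩ := Nat.exists_eq_add_of_le h3
        rw [hcell k s (by omega) (by omega)] at ha
        exact .inr ⟨shiftEdge k s a, mem_boxEdges.2 ⟨k, s, by omega, by omega, a, ha, rfl⟩,
          latticeEdge_shiftEdge _ _ _ _ _⟩
      · exact .inl (.inl ⟨k, s, hk, hs, hb, a, ha, rfl⟩)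
    · exact .inl (.inr h)
  · rintro ((⟨k, s, hk, hs, -, a, ha, rfl⟩ | h) | ⟨b, hb, rfl⟩)
    · exact .inl ⟨k, s, hk, hs, a, ha, rfl⟩
    · exact .inr h
    · obtain ⟨k, s, hk, hs, a, ha, rfl⟩ := mem_boxEdges.1 hb
      rw [← hcell k s hk hs] at ha
      exact .inl ⟨i + k, t + s, by omega, by omega, a, ha, latticeEdge_shiftEdge _ _ _ _ _⟩

/-- A box of `W + 1` positions has width `W`. Nothing crosses its left boundary, so the edges in the
column before it are vertical and keep distance one. The closing edges lie beyond the last slab,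
before the first one, or in the plane `z = -1`. -/
theorem outerEdges_offBox {n l i t W H : ℕ} {X : ℕ → ℕ → Bool} (hl : t + H ≤ l)
    (hprev : ∀ s, s < H → prevCol X i (t + s) = false) {e : R3 × R3}
    (he : e ∈ outerEdges n l X i t (W + 1) H) : OffBox i t (2 * W : ℕ) (2 * H : ℕ) e := by
  rcases he with ⟨k, s, hk, hs, hb, a, ha, rfl⟩ | he
  · obtain ⟨⟨h1, h2, h3, h4, h5⟩, ⟨h6, h7, h8, h9⟩, -⟩ := cellEdges_coord ha
    have c : ∀ z : ℤ, (0 ≤ z → (0 : ℝ) ≤ z) ∧ (z ≤ 2 → (z : ℝ) ≤ 2) := fun z =>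
      ⟨fun h => by exact_mod_cast h, fun h => by exact_mod_cast h⟩
    have h1' := (c _).1 h1
    have h2' := (c _).2 h2
    have h3' := (c _).1 h3
    have h4' := (c _).2 h4
    have h6' := (c _).1 h6
    have h7' := (c _).2 h7
    have h8' := (c _).1 h8
    have h9' := (c _).2 h9
    simp only [OffBox, latticeEdge, latticePt]
    push_cast
    by_cases q1 : s < t
    · have : (s : ℝ) + 1 ≤ t := by exact_mod_cast q1
      left; constructor <;> linarith
    by_cases q2 : t + H ≤ s
    · have : (t : ℝ) + H ≤ s := by exact_mod_cast q2
      right; left; constructor <;> linarith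
    by_cases q3 : i + (W + 1) ≤ k
    · have : (i : ℝ) + (W + 1) ≤ k := by exact_mod_cast q3
      right; right; right; left; constructor <;> linarith
    have q4 : k < i := by
      by_contra; apply hb; omega
    right; right; left
    by_cases q5 : k + 1 = i
    · have hX : X k s = false := by
        have := hprev (s - t) (by omega)
        rw [show t + (s - t) = s by omega] at this
        simpa [prevCol, ← q5] using this
      obtain ⟨h10, h11⟩ := h5 hX
      have : (k : ℝ) + 1 = i := by exact_mod_cast q5
      rw [h10, h11]
      push_cast
      constructor <;> linarith
    · have : (k : ℝ) + 2 ≤ i := by exact_mod_cast (show k + 2 ≤ i by omega)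
      constructor <;> linarith
  · have : (t : ℝ) + H ≤ l := by exact_mod_cast hl
    have h0 : (0 : ℝ) ≤ t := Nat.cast_nonneg _
    simp only [OffBox]
    push_cast
    cases he with
    | top k hk => right; left; constructor <;> simp only <;> linarith
    | back k hk => right; right; right; right; constructor <;> simp
    | bottom k hk => left; constructor <;> simp only <;> linarith

/-- The column to the right of the box looks at the last column of the box through `prevCol`; hence
`hlast`. -/
theorem outerEdges_congr {n l i t W H : ℕ} {X X' : ℕ → ℕ → Bool}
    (h : ∀ k s, ¬ ((i ≤ k ∧ k < i + W) ∧ (t ≤ s ∧ s < t + H)) → X k s = X' k s)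
    (hlast : ∀ s, s < H → X (i + W - 1) (t + s) = X' (i + W - 1) (t + s)) :
    outerEdges n l X i t W H = outerEdges n l X' i t W H := by
  have key : ∀ k s, ¬ ((i ≤ k ∧ k < i + W) ∧ (t ≤ s ∧ s < t + H)) →
      cellEdgesAt X k s = cellEdgesAt X' k s := by
    intro k s hb
    simp only [cellEdgesAt]
    rw [h k s hb]
    congr 1
    simp only [prevCol]
    rcases Nat.eq_zero_or_pos k with rfl | hk
    · simp
    congr 1
    by_cases hb' : (i ≤ k - 1 ∧ k - 1 < i + W) ∧ (t ≤ s ∧ s < t + H)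
    · have : k - 1 = i + W - 1 := by omega
      rw [this]
      have := hlast (s - t) (by omega)
      rwa [show t + (s - t) = s by omega] at this
    · exact h _ _ hb'
  ext e
  constructor
  · rintro (⟨k, s, hk, hs, hb, a, ha, rfl⟩ | h)
    · exact .inl ⟨k, s, hk, hs, hb, a, key k s hb ▸ ha, rfl⟩
    · exact .inr h
  · rintro (⟨k, s, hk, hs, hb, a, ha, rfl⟩ | h)
    · exact .inl ⟨k, s, hk, hs, hb, a, (key k s hb).symm ▸ ha, rfl⟩
    · exact .inr h

/-- The diagram `X` has the content `x` in the box of `W + 1` positions and `H` slabs at `(i, t)`,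
and no crossing over the left boundary of the box. -/
structure HasBox (X x : ℕ → ℕ → Bool) (i t W H : ℕ) : Prop where
  content : ∀ k s, k < W + 1 → s < H → X (i + k) (t + s) = x k s
  left : ∀ s, s < H → prevCol X i (t + s) = false

theorem HasBox.isEdgeSetOf {n l i t W H : ℕ} {X x : ℕ → ℕ → Bool} {T : LinkType}
    {L : List LatticeEdge} (ms : List BoxMove)
    (hms : boxMovesB (2 * W : ℕ) (2 * H : ℕ) (boxEdges (W + 1) H x) L ms = true)
    (hn : i + (W + 1) ≤ n) (hl : t + H ≤ l) (hX : HasBox X x i t W H)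
    (hT : IsEdgeSetOf (diagramEdges n l X) T) :
    IsEdgeSetOf (outerEdges n l X i t (W + 1) H ∪ latticeEdge i t '' {e | e ∈ L}) T := by
  rw [diagramEdges_eq_outer_union_box hn hl hX.content hX.left] at hT
  exact hT.boxMoves ms hms fun e he => outerEdges_offBox hl hX.left he

/-- A local move of diagrams. -/
theorem HasBox.move {n l i t W H : ℕ} {X X' x x' : ℕ → ℕ → Bool} {T : LinkType}
    (ms : List BoxMove)
    (hms : boxMovesB (2 * W : ℕ) (2 * H : ℕ) (boxEdges (W + 1) H x) (boxEdges (W + 1) H x') ms = true)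
    (hn : i + (W + 1) ≤ n) (hl : t + H ≤ l) (hX : HasBox X x i t W H) (hX' : HasBox X' x' i t W H)
    (hlast : ∀ s, s < H → x W s = x' W s)
    (h : ∀ k s, ¬ ((i ≤ k ∧ k < i + (W + 1)) ∧ (t ≤ s ∧ s < t + H)) → X k s = X' k s)
    (hT : IsEdgeSetOf (diagramEdges n l X) T) : IsEdgeSetOf (diagramEdges n l X') T := by
  rw [diagramEdges_eq_outer_union_box hn hl hX'.content hX'.left,
    ← outerEdges_congr h fun s hs => by
      rw [show i + (W + 1) - 1 = i + W by omega, hX.content W s (by omega) hs,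
        hX'.content W s (by omega) hs, hlast s hs]]
  exact hX.isEdgeSetOf ms hms hn hl hT

/-- Deforming both diagrams to a common shape `L` avoids having to invert a list of moves. -/
theorem HasBox.unique {n l i t W H : ℕ} {X X' x x' : ℕ → ℕ → Bool} {T T' : LinkType}
    {L : List LatticeEdge} (ms ms' : List BoxMove)
    (hms : boxMovesB (2 * W : ℕ) (2 * H : ℕ) (boxEdges (W + 1) H x) L ms = true)
    (hms' : boxMovesB (2 * W : ℕ) (2 * H : ℕ) (boxEdges (W + 1) H x') L ms' = true)
    (hn : i + (W + 1) ≤ n) (hl : t + H ≤ l) (hX : HasBox X x i t W H) (hX' : HasBox X' x' i t W H)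
    (hlast : ∀ s, s < H → x W s = x' W s)
    (h : ∀ k s, ¬ ((i ≤ k ∧ k < i + (W + 1)) ∧ (t ≤ s ∧ s < t + H)) → X k s = X' k s)
    (hT : IsEdgeSetOf (diagramEdges n l X) T) (hT' : IsEdgeSetOf (diagramEdges n l X') T') :
    T = T' := by
  refine (hX.isEdgeSetOf ms hms hn hl hT).unique ?_
  rw [outerEdges_congr h fun s hs => by
      rw [show i + (W + 1) - 1 = i + W by omega, hX.content W s (by omega) hs,
        hX'.content W s (by omega) hs, hlast s hs]]
  exact hX'.isEdgeSetOf ms' hms' hn hl hT'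

/-! ### Explicit moves for far commutation and for the braid relation -/

/-- The vertices of the crossing are inserted one slab later and the old ones deleted. The integral
functions are certificates only: `slideUpMoves_check` verifies them. -/
def slideUpMoves : List BoxMove := [
  .del (1, 1, 1) (2, 4, 0) (2, 2, 0) [(0, 1, 0, -1), (0, 0, 1, 0)],
  .ins (2, 0, 0) (0, 2, 0) (2, 2, 0) (0, -1, 0, 2) [(0, -1, -2, 3), (0, 1, -1, 0), (1, 0, 0, 0)],
  .del (2, 2, 0) (0, 4, 0) (0, 2, 0) [(-1, 0, -1, 2), (0, 1, 0, -1)],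
  .ins (0, 0, 0) (1, 1, 1) (0, 2, 0) (-1, -1, 0, 2) [(-1, -1, 0, 4), (-1, 0, 0, 1)],
  .ins (1, 1, 1) (2, 4, 0) (1, 3, 1) (0, -1, 0, 3) [(0, 0, 1, 0), (0, 1, 1, -2)],
  .del (0, 2, 0) (1, 3, 1) (1, 1, 1) [(-1, 0, 0, 1), (0, 0, 1, 0)]]

def slideDownMoves : List BoxMove := [
  .del (0, 0, 0) (1, 3, 1) (0, 2, 0) [(-1, 0, 0, 1), (0, 0, 1, 0)],
  .ins (2, 2, 0) (0, 4, 0) (0, 2, 0) (1, 0, 0, 0) [(0, 1, -2, -1), (-1, -1, 0, 4), (-1, 0, 0, 2)],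
  .del (2, 0, 0) (0, 2, 0) (2, 2, 0) [(0, -1, 0, 2), (1, 0, -1, 0)],
  .ins (1, 3, 1) (2, 4, 0) (2, 2, 0) (-1, 0, 0, 2) [(1, 1, 0, -2), (1, 0, 0, -1)],
  .ins (0, 0, 0) (1, 3, 1) (1, 1, 1) (-1, 0, 0, 1) [(-1, -1, 0, 4), (0, 0, 1, 0)],
  .del (1, 1, 1) (2, 2, 0) (1, 3, 1) [(0, 1, 0, -1), (0, 0, 1, 0)]]

/-- The three strands run at three different levels, so each can be pulled to a path with a single
bend over the centre of the box. The bends have heights 3, 1 and 0, which gives `braidCommon`. -/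
def braidMovesLeft : List BoxMove := [
  .del (1, 1, 1) (3, 3, 1) (2, 2, 0) [(0, 1, 0, -1), (-1, 0, 0, 3), (0, 0, 1, 0), (0, -1, 0, 4)],
  .del (3, 3, 1) (4, 6, 0) (4, 4, 0) [(0, 0, -1, 1), (0, 0, 1, 0), (1, 0, 0, -2)],
  .del (0, 0, 0) (3, 3, 1) (1, 1, 1) [(-1, 0, 0, 3), (0, 0, 1, 0), (0, -1, 0, 4)],
  .ins (0, 0, 0) (3, 3, 1) (2, 3, 3) (-1, 0, 0, 2) [(-1, 0, 0, 3), (0, 0, 1, 0), (0, -1, 0, 4)],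
  .del (2, 3, 3) (4, 6, 0) (3, 3, 1) [(0, 0, 1, 0), (1, 0, 0, -2)],
  .ins (0, 2, 0) (0, 4, 0) (2, 3, 1) (0, -1, 0, 3) [(-1, 0, -1, 4), (0, 1, -1, 0), (0, 0, 1, 0), (0, -1, 0, 4)],
  .del (2, 0, 0) (2, 3, 1) (0, 2, 0) [(0, -1, 0, 3), (0, 1, -1, 0), (0, 0, 1, 0)],
  .del (2, 3, 1) (1, 5, 1) (0, 4, 0) [(-1, 0, 0, 2), (0, 1, 0, -3), (0, -1, 0, 5), (0, 0, 1, 0)],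
  .del (2, 3, 1) (2, 6, 0) (1, 5, 1) [(0, 1, 0, -3), (-1, 0, -1, 4), (0, 0, 1, 0)],
  .ins (4, 2, 0) (2, 4, 0) (2, 3, 0) (0, -1, 0, 3) [(0, -1, -1, 4), (0, 1, -1, -2)],
  .del (4, 0, 0) (2, 3, 0) (4, 2, 0) [(0, -1, 0, 3), (1, 0, 0, -2)],
  .del (2, 3, 0) (0, 6, 0) (2, 4, 0) [(-1, 0, 0, 2), (0, 1, 0, -3)]]

def braidMovesRight : List BoxMove := [
  .del (1, 3, 1) (3, 5, 1) (2, 4, 0) [(0, 0, 1, 0), (0, 1, 0, -3), (-1, 0, 0, 3)],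
  .del (0, 0, 0) (1, 3, 1) (0, 2, 0) [(-1, 0, 0, 1), (0, 0, 1, 0)],
  .del (1, 3, 1) (4, 6, 0) (3, 5, 1) [(0, 1, 0, -3), (0, 0, 1, 0)],
  .ins (1, 3, 1) (4, 6, 0) (2, 3, 3) (-1, 0, 0, 2) [(1, 0, 0, -1), (0, 1, 0, -2), (0, 0, 1, 0)],
  .del (0, 0, 0) (2, 3, 3) (1, 3, 1) [(-1, 0, 0, 2), (0, 0, 1, 0)],
  .ins (4, 2, 0) (4, 4, 0) (2, 3, 1) (0, -1, 0, 3) [(0, 1, -1, 0), (-1, 0, -1, 4), (0, 0, 1, 0)],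
  .del (3, 1, 1) (2, 3, 1) (4, 2, 0) [(0, -1, 0, 3), (1, 0, 0, -2), (0, 1, 0, -1), (0, 0, 1, 0)],
  .del (2, 3, 1) (2, 6, 0) (4, 4, 0) [(0, 1, 0, -3), (-1, 0, -1, 4), (0, 0, 1, 0)],
  .del (2, 0, 0) (2, 3, 1) (3, 1, 1) [(0, -1, 0, 3), (0, 1, -1, 0), (0, 0, 1, 0)],
  .ins (2, 2, 0) (0, 4, 0) (2, 3, 0) (0, -1, 0, 3) [(0, 1, -1, -2), (0, -1, -1, 4)],
  .del (4, 0, 0) (2, 3, 0) (2, 2, 0) [(0, -1, 0, 3), (1, 0, 0, -2)],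
  .del (2, 3, 0) (0, 6, 0) (0, 4, 0) [(-1, 0, 0, 2), (0, 1, 0, -3)]]

/-- A crossing of the first two strands in the slab `r`. -/
def slideBox (r : ℕ) (k s : ℕ) : Bool := decide (k = 0) && decide (s = r)

/-- Crossings of the first two strands in the slabs `0` and `2` and of the last two strands in the
slab `1`, or conversely. -/
def braidBoxLeft (k s : ℕ) : Bool :=
  (decide (k = 0) && (decide (s = 0) || decide (s = 2))) || (decide (k = 1) && decide (s = 1))

def braidBoxRight (k s : ℕ) : Bool :=
  (decide (k = 1) && (decide (s = 0) || decide (s = 2))) || (decide (k = 0) && decide (s = 1))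

/-- The common shape to which both sides of the braid relation are deformed. -/
def braidCommon : List LatticeEdge :=
  [((0, 0, 0), (2, 3, 3)), ((2, 3, 3), (4, 6, 0)), ((2, 0, 0), (2, 3, 1)), ((2, 3, 1), (2, 6, 0)),
    ((4, 0, 0), (2, 3, 0)), ((2, 3, 0), (0, 6, 0))]

theorem slideUpMoves_check : boxMovesB (2 * 1 : ℕ) (2 * 2 : ℕ) (boxEdges (1 + 1) 2 (slideBox 0))
    (boxEdges (1 + 1) 2 (slideBox 1)) slideUpMoves = true := by
  decide +kernel

theorem slideDownMoves_check : boxMovesB (2 * 1 : ℕ) (2 * 2 : ℕ) (boxEdges (1 + 1) 2 (slideBox 1))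
    (boxEdges (1 + 1) 2 (slideBox 0)) slideDownMoves = true := by
  decide +kernel

theorem braidMovesLeft_check : boxMovesB (2 * 2 : ℕ) (2 * 3 : ℕ) (boxEdges (2 + 1) 3 braidBoxLeft)
    braidCommon braidMovesLeft = true := by
  decide +kernel

theorem braidMovesRight_check : boxMovesB (2 * 2 : ℕ) (2 * 3 : ℕ)
    (boxEdges (2 + 1) 3 braidBoxRight) braidCommon braidMovesRight = true := by
  decide +kernel

/-! ### Closures of braid words -/

/-- The crossings of the braid word `w`; letters out of range stand for empty slabs. -/
def wordCrossings (n : ℕ) (w : List ℕ) (k s : ℕ) : Bool :=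
  decide (w[s]? = some k) && decide (k + 1 < n)

/-- The closed braid diagram of the word `w` on `n` strands has the type `T`. -/
def WordHasType (n : ℕ) (w : List ℕ) (T : LinkType) : Prop :=
  IsEdgeSetOf (diagramEdges n w.length (wordCrossings n w)) T

theorem WordHasType.unique {n : ℕ} {w : List ℕ} {T T' : LinkType} (h : WordHasType n w T)
    (h' : WordHasType n w T') : T = T' :=
  IsEdgeSetOf.unique h h'

theorem isLetterEdge_iff {n i t : ℕ} (hi : i + 1 < n) {e : R3 × R3} :
    IsLetterEdge n i t e ↔ ∃ k < n, ∃ a ∈ cellEdges (decide (k = i)) (decide (0 < k ∧ k - 1 = i)),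
      e = latticeEdge k t a := by
  have e1 : latticeEdge i t ((0, 0, 0), (1, 1, 1)) =
      (((i : ℝ), (t : ℝ), 0), ((i : ℝ) + 1 / 2, (t : ℝ) + 1 / 2, 1)) := by
    simp [latticeEdge, latticePt]
  have e2 : latticeEdge i t ((1, 1, 1), (2, 2, 0)) =
      (((i : ℝ) + 1 / 2, (t : ℝ) + 1 / 2, 1), ((i : ℝ) + 1, (t : ℝ) + 1, 0)) := by
    simp [latticeEdge, latticePt]
  have e3 : latticeEdge i t ((2, 0, 0), (0, 2, 0)) =
      (((i : ℝ) + 1, (t : ℝ), 0), ((i : ℝ), (t : ℝ) + 1, 0)) := by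
    simp [latticeEdge, latticePt]
  have e4 : ∀ k : ℕ, latticeEdge k t ((0, 0, 0), (0, 2, 0)) =
      (((k : ℝ), (t : ℝ), 0), ((k : ℝ), (t : ℝ) + 1, 0)) := by
    intro k
    simp [latticeEdge, latticePt]
  constructor
  · rintro (⟨k, hk, h, h'⟩ | _ | _ | _)
    · refine ⟨k, hk, ((0, 0, 0), (0, 2, 0)), ?_, (e4 k).symm⟩
      have : ¬ (0 < k ∧ k - 1 = i) := by omega
      simp [cellEdges, h, this]
    · exact ⟨i, by omega, _, by simp [cellEdges], e1.symm⟩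
    · exact ⟨i, by omega, ((1, 1, 1), (2, 2, 0)), by simp [cellEdges], e2.symm⟩
    · exact ⟨i, by omega, ((2, 0, 0), (0, 2, 0)), by simp [cellEdges], e3.symm⟩
  · rintro ⟨k, hk, a, ha, rfl⟩
    by_cases h : k = i
    · subst h
      simp only [cellEdges, decide_true, if_true, List.mem_cons, List.not_mem_nil, or_false] at ha
      rcases ha with rfl | rfl | rfl
      · rw [e1]; exact .overUp
      · rw [e2]; exact .overDown
      · rw [e3]; exact .under
    · by_cases h' : 0 < k ∧ k - 1 = i
      · simp [cellEdges, h, h'] at ha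
      · simp [cellEdges, h, h'] at ha
        subst ha
        rw [e4]
        exact .straight k hk h (by omega)

theorem setOf_isClosureEdge_eq (n : ℕ) (w : PosWord n) :
    {e | IsClosureEdge n w e} =
      diagramEdges n (w.map Fin.val).length (wordCrossings n (w.map Fin.val)) := by
  have key : ∀ t (ht : t < w.length) k, k < n →
      cellEdgesAt (wordCrossings n (w.map Fin.val)) k t =
        cellEdges (decide (k = (w[t] : ℕ))) (decide (0 < k ∧ k - 1 = (w[t] : ℕ))) := by
    intro t ht k hk
    have hw := w[t].2
    have h1 : ∀ j, wordCrossings n (w.map Fin.val) j t = decide (j = (w[t] : ℕ)) := by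
      intro j
      simp only [wordCrossings, List.getElem?_map, List.getElem?_eq_getElem ht, Option.map_some,
        Option.some.injEq]
      rw [← Bool.decide_and, decide_eq_decide]
      omega
    simp only [cellEdgesAt, prevCol, h1, ← Bool.decide_and]
  ext e
  constructor
  · rintro (⟨t, ht, he⟩ | he)
    · rw [isLetterEdge_iff (by omega)] at he
      obtain ⟨k, hk, a, ha, rfl⟩ := he
      exact .inl ⟨k, t, hk, by simpa using ht, a, by rw [key t ht k hk]; exact ha, rfl⟩
    · exact .inr (by simpa using he)
  · rintro (⟨k, t, hk, ht, a, ha, rfl⟩ | he)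
    · rw [List.length_map] at ht
      rw [key t ht k hk] at ha
      exact .inl ⟨t, ht, (isLetterEdge_iff (by omega)).2 ⟨k, hk, a, ha, rfl⟩⟩
    · exact .inr (by simpa using he)

theorem wordHasType_closure (n : ℕ) (w : PosWord n) :
    WordHasType n (w.map Fin.val) w.closure.isotopyClass :=
  ⟨w.closure, setOf_isClosureEdge_eq n w, rfl⟩

theorem exists_wordHasType {n : ℕ} {w : List ℕ} (hw : ∀ i ∈ w, i + 1 < n) :
    ∃ T, WordHasType n w T := by
  have : ∃ v : PosWord n, v.map Fin.val = w := by
    induction w with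
    | nil => exact ⟨[], rfl⟩
    | cons i w ih =>
      obtain ⟨v, rfl⟩ := ih fun j hj => hw j (List.mem_cons_of_mem _ hj)
      exact ⟨⟨i, by have := hw i (by simp); omega⟩ :: v, rfl⟩
  obtain ⟨v, rfl⟩ := this
  exact ⟨_, wordHasType_closure n v⟩

/-! ### Far commutation -/

/-- `Y` with the contents of the slabs `t` and `t + 1` replaced. -/
def withSlabs (Y : ℕ → ℕ → Bool) (t : ℕ) (p q : ℕ → Bool) (k s : ℕ) : Bool :=
  if s = t then p k else if s = t + 1 then q k else Y k s

theorem withSlabs_hasBox {Y : ℕ → ℕ → Bool} {t i r : ℕ} {p q : ℕ → Bool}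
    (hp : p i = decide (0 = r)) (hq : q i = decide (1 = r)) (hp' : p (i + 1) = false)
    (hq' : q (i + 1) = false) (hp'' : ∀ j, j + 1 = i → p j = false)
    (hq'' : ∀ j, j + 1 = i → q j = false) :
    HasBox (withSlabs Y t p q) (slideBox r) i t 1 2 := by
  constructor
  · intro k s hk hs
    interval_cases k <;> interval_cases s <;>
      simp [withSlabs, slideBox, hp, hq, hp', hq']
  · intro s hs
    rcases i with _ | i
    · simp [prevCol]
    · interval_cases s <;> simp [withSlabs, prevCol, hp'' i rfl, hq'' i rfl]

theorem IsEdgeSetOf.slide {n l t i r r' : ℕ} {Y : ℕ → ℕ → Bool} {p q p' q' : ℕ → Bool}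
    {T : LinkType} (hr : (r = 0 ∧ r' = 1) ∨ (r = 1 ∧ r' = 0)) (hi : i + 1 < n) (hl : t + 2 ≤ l)
    (hp : p i = decide (0 = r)) (hq : q i = decide (1 = r)) (hp0 : p' i = decide (0 = r'))
    (hq0 : q' i = decide (1 = r')) (hp' : p (i + 1) = false)
    (hq' : q (i + 1) = false) (hp'' : ∀ j, j + 1 = i → p j = false)
    (hq'' : ∀ j, j + 1 = i → q j = false) (hpp : ∀ j, j ≠ i → p j = p' j)
    (hqq : ∀ j, j ≠ i → q j = q' j)
    (hT : IsEdgeSetOf (diagramEdges n l (withSlabs Y t p q)) T) :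
    IsEdgeSetOf (diagramEdges n l (withSlabs Y t p' q')) T := by
  have hX : HasBox (withSlabs Y t p q) (slideBox r) i t 1 2 :=
    withSlabs_hasBox hp hq hp' hq' hp'' hq''
  have hX' : HasBox (withSlabs Y t p' q') (slideBox r') i t 1 2 :=
    withSlabs_hasBox hp0 hq0 (by rw [← hpp _ (by omega), hp']) (by rw [← hqq _ (by omega), hq'])
      (fun j hj => by rw [← hpp _ (by omega), hp'' j hj])
      (fun j hj => by rw [← hqq _ (by omega), hq'' j hj])
  have hcong : ∀ k s, ¬ ((i ≤ k ∧ k < i + (1 + 1)) ∧ (t ≤ s ∧ s < t + 2)) →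
      withSlabs Y t p q k s = withSlabs Y t p' q' k s := by
    intro k s hb
    simp only [withSlabs]
    split_ifs with h1 h2
    · exact hpp k (by omega)
    · exact hqq k (by omega)
    · rfl
  have hlast : ∀ s, s < 2 → slideBox r 1 s = slideBox r' 1 s := by simp [slideBox]
  rcases hr with ⟨rfl, rfl⟩ | ⟨rfl, rfl⟩
  · exact hX.move _ slideUpMoves_check hi hl hX' hlast hcong hT
  · exact hX.move _ slideDownMoves_check hi hl hX' hlast hcong hT

theorem wordCrossings_append_pair (n : ℕ) (u v : List ℕ) (i k : ℕ) :
    wordCrossings n (u ++ i :: k :: v) =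
      withSlabs (fun j s => wordCrossings n (if s < u.length then u else v) j
        (if s < u.length then s else s - (u.length + 2))) u.length
        (fun j => decide (j = i) && decide (j + 1 < n))
        (fun j => decide (j = k) && decide (j + 1 < n)) := by
  funext j s
  simp only [withSlabs, wordCrossings]
  split_ifs with h1 h2 h3
  · subst h1; simp [eq_comm]
  · subst h2; simp [eq_comm]
  · rw [List.getElem?_append_left h3]
  · rw [List.getElem?_append_right (by omega)]
    obtain ⟨r, hr⟩ : ∃ r, s - u.length = r + 2 := ⟨s - u.length - 2, by omega⟩
    rw [hr, show s - (u.length + 2) = r by omega]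
    simp

/-- Distant letters, and empty slabs, can be exchanged. -/
theorem WordHasType.swap {n i k : ℕ} {u v : List ℕ} {T : LinkType}
    (h : (i + 2 ≤ k ∨ k + 2 ≤ i) ∨ n ≤ i + 1 ∨ n ≤ k + 1)
    (hT : WordHasType n (u ++ i :: k :: v) T) : WordHasType n (u ++ k :: i :: v) T := by
  unfold WordHasType at hT ⊢
  rw [wordCrossings_append_pair] at hT ⊢
  have hl : (u ++ k :: i :: v).length = (u ++ i :: k :: v).length := by simp
  have hl2 : u.length + 2 ≤ (u ++ i :: k :: v).length := by simp
  rw [hl]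
  revert hT hl2
  generalize (u ++ i :: k :: v).length = l
  have hY : (fun j s => wordCrossings n (if s < u.length then u else v) j
        (if s < u.length then s else s - (u.length + 2))) = (fun j s =>
        wordCrossings n (if s < u.length then u else v) j
        (if s < u.length then s else s - (u.length + 2))) := rfl
  revert hY
  generalize (fun j s => wordCrossings n (if s < u.length then u else v) j
        (if s < u.length then s else s - (u.length + 2))) = Y
  intro _ hT hl2
  -- Intermediate diagram: both crossings lie in the second slab and the first is empty. This is no
  -- braid word, but diagrams allow several distant crossings in one slab.
  have step1 : IsEdgeSetOf (diagramEdges n l (withSlabs Y u.length (fun _ => false)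
      (fun j => (decide (j = k) || decide (j = i)) && decide (j + 1 < n)))) T := by
    by_cases hi : i + 1 < n
    · by_cases hk : k + 1 < n
      · refine hT.slide (i := i) (r := 0) (r' := 1) (.inl ⟨rfl, rfl⟩) hi hl2 ?_ ?_ ?_ ?_ ?_ ?_ ?_ ?_
          ?_ ?_ <;> first | (simp; done) | (simp; omega) | grind
      · refine hT.slide (i := i) (r := 0) (r' := 1) (.inl ⟨rfl, rfl⟩) hi hl2 ?_ ?_ ?_ ?_ ?_ ?_ ?_ ?_
          ?_ ?_ <;> first | (simp; done) | (simp; omega) | grind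
    -- If `i` is out of range, its slab is empty and there is nothing to slide.
    · convert hT using 4
      · simp; omega
      · rw [Bool.eq_iff_iff]; simp; omega
  by_cases hk : k + 1 < n
  · refine step1.slide (i := k) (r := 1) (r' := 0) (.inr ⟨rfl, rfl⟩) hk hl2 ?_ ?_ ?_ ?_ ?_ ?_ ?_ ?_
      ?_ ?_ <;> first | (simp; done) | (simp; omega) | grind
  · convert step1 using 4
    · simp; omega
    · rw [Bool.eq_iff_iff]; simp; omega

/-! ### The braid relation -/

theorem wordCrossings_append_triple (n : ℕ) (u v : List ℕ) (a b c : ℕ) (k s : ℕ) :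
    wordCrossings n (u ++ a :: b :: c :: v) k s =
      if s < u.length then wordCrossings n u k s
      else if s = u.length then decide (k = a) && decide (k + 1 < n)
      else if s = u.length + 1 then decide (k = b) && decide (k + 1 < n)
      else if s = u.length + 2 then decide (k = c) && decide (k + 1 < n)
      else wordCrossings n v k (s - (u.length + 3)) := by
  simp only [wordCrossings]
  split_ifs with h1 h2 h3 h4
  · rw [List.getElem?_append_left h1]
  · subst h2; simp [eq_comm]
  · subst h3; simp [eq_comm]
  · subst h4; simp [eq_comm]
  · rw [List.getElem?_append_right (by omega)]
    obtain ⟨r, hr⟩ : ∃ r, s - u.length = r + 3 := ⟨s - u.length - 3, by omega⟩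
    rw [hr, show s - (u.length + 3) = r by omega]
    simp

/-- The diagrams differ only in a box of three positions and three slabs, and there both deform to
`braidCommon`. -/
theorem WordHasType.braid_rel {n i : ℕ} {u v : List ℕ} {T T' : LinkType} (hi : i + 2 < n)
    (hT : WordHasType n (u ++ i :: (i + 1) :: i :: v) T)
    (hT' : WordHasType n (u ++ (i + 1) :: i :: (i + 1) :: v) T') : T = T' := by
  unfold WordHasType at hT hT'
  have hl : (u ++ (i + 1) :: i :: (i + 1) :: v).length = (u ++ i :: (i + 1) :: i :: v).length := by
    simp
  rw [hl] at hT'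
  have hX : HasBox (wordCrossings n (u ++ i :: (i + 1) :: i :: v)) braidBoxLeft i u.length 2 3 := by
    constructor
    · intro k s hk hs
      rw [wordCrossings_append_triple]
      interval_cases k <;> interval_cases s <;> simp [braidBoxLeft] <;> omega
    · intro s hs
      rcases i with _ | i
      · simp [prevCol]
      · simp only [prevCol]
        rw [wordCrossings_append_triple]
        interval_cases s <;> simp <;> omega
  have hX' : HasBox (wordCrossings n (u ++ (i + 1) :: i :: (i + 1) :: v)) braidBoxRight
      i u.length 2 3 := by
    constructor
    · intro k s hk hs
      rw [wordCrossings_append_triple]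
      interval_cases k <;> interval_cases s <;> simp [braidBoxRight] <;> omega
    · intro s hs
      rcases i with _ | i
      · simp [prevCol]
      · simp only [prevCol]
        rw [wordCrossings_append_triple]
        interval_cases s <;> simp <;> omega
  refine HasBox.unique _ _ braidMovesLeft_check braidMovesRight_check (by omega) (by simp) hX hX'
    (by intro s hs; interval_cases s <;> simp [braidBoxLeft, braidBoxRight]) ?_ hT hT'
  intro k s hb
  rw [wordCrossings_append_triple, wordCrossings_append_triple]
  split_ifs with h1 h2 h3 h4
  · rfl
  all_goals try rw [Bool.eq_iff_iff]; simp; omega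
  rfl

/-! ### Removing the last strand -/

theorem cellEdges_latticeEdge_coord {X : ℕ → ℕ → Bool} {k s : ℕ} {a : LatticeEdge}
    (ha : a ∈ cellEdgesAt X k s) :
    (((k : ℝ) ≤ (latticeEdge k s a).1.1 ∧ (k : ℝ) ≤ (latticeEdge k s a).2.1) ∧
      ((latticeEdge k s a).1.1 ≤ k + 1 ∧ (latticeEdge k s a).2.1 ≤ k + 1) ∧
      (X k s = false → (latticeEdge k s a).1.1 = k ∧ (latticeEdge k s a).2.1 = k)) ∧
    (((s : ℝ) ≤ (latticeEdge k s a).1.2.1 ∧ (s : ℝ) ≤ (latticeEdge k s a).2.2.1) ∧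
      ((latticeEdge k s a).1.2.1 ≤ s + 1 ∧ (latticeEdge k s a).2.2.1 ≤ s + 1)) ∧
    (0 ≤ (latticeEdge k s a).1.2.2 ∧ 0 ≤ (latticeEdge k s a).2.2.2) := by
  obtain ⟨⟨h1, h2, h3, h4, h5⟩, ⟨h6, h7, h8, h9⟩, h10, h11⟩ := cellEdges_coord ha
  have c : ∀ z : ℤ, (0 ≤ z → (0 : ℝ) ≤ z) ∧ (z ≤ 2 → (z : ℝ) ≤ 2) := fun z =>
    ⟨fun h => by exact_mod_cast h, fun h => by exact_mod_cast h⟩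
  have h1' := (c _).1 h1
  have h2' := (c _).2 h2
  have h3' := (c _).1 h3
  have h4' := (c _).2 h4
  have h6' := (c _).1 h6
  have h7' := (c _).2 h7
  have h8' := (c _).1 h8
  have h9' := (c _).2 h9
  simp only [latticeEdge, latticePt]
  refine ⟨⟨⟨by linarith, by linarith⟩, ⟨by linarith, by linarith⟩, fun h => ?_⟩,
    ⟨⟨by linarith, by linarith⟩, by linarith, by linarith⟩, by exact_mod_cast h10,
    by exact_mod_cast h11⟩
  obtain ⟨h12, h13⟩ := h5 h
  rw [h12, h13]
  simp

section Loop

variable {N t l : ℝ} {O : Set (R3 × R3)} {T : LinkType}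

/-- The last strand of a braid diagram whose last two strands cross once, in the slab `t`; it has
been straightened between `y = s` and the end, and between the start and `y = r`. -/
def loopEdges (N l : ℝ) (t s r : ℕ) : Set (R3 × R3) :=
  {e | (∃ j : ℕ, t + 1 ≤ j ∧ j < s ∧ e = ((N, (j : ℝ), 0), (N, (j : ℝ) + 1, 0))) ∨
    (∃ j : ℕ, r ≤ j ∧ j < t ∧ e = ((N, (j : ℝ), 0), (N, (j : ℝ) + 1, 0))) ∨
    e = ((N - 1, (t : ℝ), 0), (N - 1 / 2, (t : ℝ) + 1 / 2, 1)) ∨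
    e = ((N - 1 / 2, (t : ℝ) + 1 / 2, 1), (N, (t : ℝ) + 1, 0)) ∨
    e = ((N, (t : ℝ), 0), (N - 1, (t : ℝ) + 1, 0)) ∨
    e = ((N, l + 1, -1), (N, -1, -1))}

/-- The triangle lies in the plane `x = N`. Other strands stay at `x ≤ N - 1`, the rest of the last
strand lies at `y ≤ s` or in the plane `z = -1`, and each of these is separated by a coordinate
function. -/
theorem loop_shorten_end {t s r : ℕ} (hts : t + 1 ≤ s) (hO : ∀ e ∈ O, e.1.1 ≤ N - 1 ∧ e.2.1 ≤ N - 1)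
    (hsl : (s : ℝ) + 1 ≤ l) (hrt : r ≤ t)
    (hT : IsEdgeSetOf (O ∪ loopEdges N l t (s + 1) r ∪
      {((N, ((s + 1 : ℕ) : ℝ), 0), (N, l + 1, -1)), ((N, -1, -1), (N, (r : ℝ), 0))}) T) :
    IsEdgeSetOf (O ∪ loopEdges N l t s r ∪
      {((N, (s : ℝ), 0), (N, l + 1, -1)), ((N, -1, -1), (N, (r : ℝ), 0))}) T := by
  have hts' : (t : ℝ) + 1 ≤ s := by exact_mod_cast hts
  have ht0 : (0 : ℝ) ≤ t := Nat.cast_nonneg _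
  have hrt' : (r : ℝ) ≤ t := by exact_mod_cast hrt
  have e1 : O ∪ loopEdges N l t (s + 1) r ∪
      {((N, ((s + 1 : ℕ) : ℝ), 0), (N, l + 1, -1)), ((N, -1, -1), (N, (r : ℝ), 0))} =
      (O ∪ loopEdges N l t s r ∪ {((N, -1, -1), (N, (r : ℝ), 0))}) ∪
      {((N, (s : ℝ), 0), (N, (s : ℝ) + 1, 0)), ((N, (s : ℝ) + 1, 0), (N, l + 1, -1))} := by
    ext e
    simp only [Set.mem_union, loopEdges, Set.mem_ofPred_eq, Set.mem_insert_iff,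
      Set.mem_singleton_iff, Nat.cast_add, Nat.cast_one]
    constructor
    · rintro ((h | ⟨j, h1, h2, h3⟩ | h) | h | h)
      · exact .inl (.inl (.inl h))
      · rcases Nat.lt_succ_iff_lt_or_eq.1 h2 with h2 | rfl
        · exact .inl (.inl (.inr (.inl ⟨j, h1, h2, h3⟩)))
        · exact .inr (.inl h3)
      · exact .inl (.inl (.inr (.inr h)))
      · exact .inr (.inr h)
      · exact .inl (.inr h)
    · rintro (((h | ⟨j, h1, h2, h3⟩ | h) | h) | h | h)
      · exact .inl (.inl h)
      · exact .inl (.inr (.inl ⟨j, h1, by omega, h3⟩))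
      · exact .inl (.inr (.inr h))
      · exact .inr (.inr h)
      · exact .inl (.inr (.inl ⟨s, hts, by omega, h⟩))
      · exact .inr (.inl h)
  rw [e1] at hT
  have := hT.delete (by simp only [ne_eq, Prod.mk.injEq]; norm_num) ?_
  · convert this using 1
    ext e
    simp only [Set.mem_union, Set.mem_insert_iff, Set.mem_singleton_iff]
    tauto
  · simp only [Set.mem_union, loopEdges, Set.mem_ofPred_eq, Set.mem_singleton_iff]
    have ylow : ∀ e : R3 × R3, e.1.2.1 ≤ s → e.2.2.1 ≤ s → e.1.2.1 ≤ s - 1 / 2 ∨ e.2.2.1 ≤ s - 1 / 2 →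
        e ≠ ((N, (s : ℝ), 0), (N, (s : ℝ) + 1, 0)) ∧ e ≠ ((N, (s : ℝ) + 1, 0), (N, l + 1, -1)) ∧
        ∃ q, DeleteCert (N, (s : ℝ), 0) (N, l + 1, -1) (N, (s : ℝ) + 1, 0) e q := by
      intro e h1 h2 h3
      refine ⟨?_, ?_, (0, 1, 0, -s), ?_⟩
      · rintro rfl; simp only at h1 h2 h3; linarith
      · rintro rfl; simp only at h1 h2 h3; linarith
      · simp only [DeleteCert, affineFn]
        exact ⟨by linarith, by linarith, by linarith, by linarith, by linarith, .inr (by linarith)⟩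
    rintro e ((he | he) | rfl)
    · obtain ⟨h1, h2⟩ := hO e he
      refine ⟨?_, ?_, (1, 0, 0, -(N - 1)), ?_⟩
      · rintro rfl; simp only at h1; linarith
      · rintro rfl; simp only at h1; linarith
      · simp only [DeleteCert, affineFn]
        exact ⟨by linarith, by linarith, by linarith, by linarith, by linarith, .inr (by linarith)⟩
    · rcases he with ⟨j, h1, h2, rfl⟩ | ⟨j, h1, h2, rfl⟩ | rfl | rfl | rfl | rfl
      · have : (j : ℝ) + 1 ≤ s := by exact_mod_cast h2
        apply ylow <;> simp only <;> first | linarith | (left; linarith)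
      · have : (j : ℝ) + 1 ≤ t := by exact_mod_cast h2
        apply ylow <;> simp only <;> first | linarith | (left; linarith)
      · apply ylow <;> simp only <;> first | linarith | (left; linarith)
      · apply ylow <;> simp only <;> first | linarith | (left; linarith)
      · apply ylow <;> simp only <;> first | linarith | (left; linarith)
      · refine ⟨?_, ?_, (0, 0, 1, 1), ?_⟩
        · simp only [ne_eq, Prod.mk.injEq]; norm_num
        · simp only [ne_eq, Prod.mk.injEq]; norm_num
        · simp only [DeleteCert, affineFn]
          exact ⟨by linarith, by linarith, by linarith, by linarith, by linarith,
            .inl (by linarith)⟩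
    · apply ylow <;> simp only <;> first | linarith | (left; linarith)

theorem loop_shorten_start {t s r : ℕ} (hts : t + 1 ≤ s)
    (hO : ∀ e ∈ O, e.1.1 ≤ N - 1 ∧ e.2.1 ≤ N - 1) (hsl : (s : ℝ) ≤ l) (hrt : r + 1 ≤ t)
    (hT : IsEdgeSetOf (O ∪ loopEdges N l t s r ∪
      {((N, (s : ℝ), 0), (N, l + 1, -1)), ((N, -1, -1), (N, (r : ℝ), 0))}) T) :
    IsEdgeSetOf (O ∪ loopEdges N l t s (r + 1) ∪
      {((N, (s : ℝ), 0), (N, l + 1, -1)), ((N, -1, -1), (N, ((r + 1 : ℕ) : ℝ), 0))}) T := by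
  have hts' : (t : ℝ) + 1 ≤ s := by exact_mod_cast hts
  have ht0 : (0 : ℝ) ≤ r := Nat.cast_nonneg _
  have hrt' : (r : ℝ) + 1 ≤ t := by exact_mod_cast hrt
  have e1 : O ∪ loopEdges N l t s r ∪
      {((N, (s : ℝ), 0), (N, l + 1, -1)), ((N, -1, -1), (N, (r : ℝ), 0))} =
      (O ∪ loopEdges N l t s (r + 1) ∪ {((N, (s : ℝ), 0), (N, l + 1, -1))}) ∪
      {((N, -1, -1), (N, (r : ℝ), 0)), ((N, (r : ℝ), 0), (N, (r : ℝ) + 1, 0))} := by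
    ext e
    simp only [Set.mem_union, loopEdges, Set.mem_ofPred_eq, Set.mem_insert_iff,
      Set.mem_singleton_iff]
    constructor
    · rintro ((h | h | ⟨j, h1, h2, h3⟩ | h) | h | h)
      · exact .inl (.inl (.inl h))
      · exact .inl (.inl (.inr (.inl h)))
      · rcases h1.eq_or_lt with rfl | h1
        · exact .inr (.inr h3)
        · exact .inl (.inl (.inr (.inr (.inl ⟨j, h1, h2, h3⟩))))
      · exact .inl (.inl (.inr (.inr (.inr h))))
      · exact .inl (.inr h)
      · exact .inr (.inl h)
    · rintro (((h | h | ⟨j, h1, h2, h3⟩ | h) | h) | h | h)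
      · exact .inl (.inl h)
      · exact .inl (.inr (.inl h))
      · exact .inl (.inr (.inr (.inl ⟨j, by omega, h2, h3⟩)))
      · exact .inl (.inr (.inr (.inr h)))
      · exact .inr (.inl h)
      · exact .inr (.inr h)
      · exact .inl (.inr (.inr (.inl ⟨r, le_rfl, hrt, h⟩)))
  rw [e1] at hT
  have := hT.delete (by simp only [ne_eq, Prod.mk.injEq]; norm_num) ?_
  · convert this using 1
    ext e
    simp only [Set.mem_union, Set.mem_insert_iff, Set.mem_singleton_iff, Nat.cast_add, Nat.cast_one]
    tauto
  · simp only [Set.mem_union, loopEdges, Set.mem_ofPred_eq, Set.mem_singleton_iff]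
    have yhigh : ∀ e : R3 × R3, (r : ℝ) + 1 ≤ e.1.2.1 → (r : ℝ) + 1 ≤ e.2.2.1 →
        e ≠ ((N, -1, -1), (N, (r : ℝ), 0)) ∧ e ≠ ((N, (r : ℝ), 0), (N, (r : ℝ) + 1, 0)) ∧
        ∃ q, DeleteCert (N, -1, -1) (N, (r : ℝ) + 1, 0) (N, (r : ℝ), 0) e q := by
      intro e h1 h2
      refine ⟨?_, ?_, (0, -1, 0, r + 1), ?_⟩
      · rintro rfl; simp only at h1 h2; linarith
      · rintro rfl; simp only at h1 h2; linarith
      · simp only [DeleteCert, affineFn]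
        exact ⟨by linarith, by linarith, by linarith, by linarith, by linarith, .inl (by linarith)⟩
    rintro e ((he | he) | rfl)
    · obtain ⟨h1, h2⟩ := hO e he
      refine ⟨?_, ?_, (1, 0, 0, -(N - 1)), ?_⟩
      · rintro rfl; simp only at h1; linarith
      · rintro rfl; simp only at h1; linarith
      · simp only [DeleteCert, affineFn]
        exact ⟨by linarith, by linarith, by linarith, by linarith, by linarith, .inr (by linarith)⟩
    · rcases he with ⟨j, h1, h2, rfl⟩ | ⟨j, h1, h2, rfl⟩ | rfl | rfl | rfl | rfl
      · have : (t : ℝ) + 1 ≤ j := by exact_mod_cast h1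
        apply yhigh <;> simp only <;> linarith
      · have : (r : ℝ) + 1 ≤ j := by exact_mod_cast h1
        apply yhigh <;> simp only <;> linarith
      · apply yhigh <;> simp only <;> linarith
      · apply yhigh <;> simp only <;> linarith
      · apply yhigh <;> simp only <;> linarith
      · refine ⟨?_, ?_, (0, 0, 1, 1), ?_⟩
        · simp only [ne_eq, Prod.mk.injEq]; norm_num
        · simp only [ne_eq, Prod.mk.injEq]; norm_num
        · simp only [DeleteCert, affineFn]
          exact ⟨by linarith, by linarith, by linarith, by linarith, by linarith,
            .inr (by linarith)⟩
    · apply yhigh <;> simp only <;> linarith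

theorem IsEdgeSetOf.delete_of_eq {S E : Set (R3 × R3)} {a b c : R3} (h : IsEdgeSetOf S T)
    (hS : S = E ∪ {(a, c), (c, b)}) (hab : a ≠ b)
    (hE : ∀ e ∈ E, e ≠ (a, c) ∧ e ≠ (c, b) ∧ ∃ q, DeleteCert a b c e q) :
    IsEdgeSetOf (E ∪ {(a, b)}) T :=
  (hS ▸ h : IsEdgeSetOf _ T).delete hab hE

/-- What is left of the last strand is a path `v M A C D F z` around the axis, and its inner
vertices are deleted in the order `C`, `D`, `A`, `F`, `M`. The first four triangles meet `x ≤ N - 1`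
at most in a vertex, so the edges of `O` are no obstacle. Only the last triangle has a side in the
plane `x = N - 1`, and there `hO'` is needed. -/
theorem loop_collapse {t : ℝ} (ht : 0 ≤ t) (htl : t + 1 ≤ l)
    (hO : ∀ e ∈ O, e.1.1 ≤ N - 1 ∧ e.2.1 ≤ N - 1)
    (hO' : ∀ e ∈ O, (e.1.2.1 ≤ t ∧ e.2.2.1 ≤ t) ∨ (t + 1 ≤ e.1.2.1 ∧ t + 1 ≤ e.2.2.1) ∨
      (e.1.1 ≤ N - 2 ∧ e.2.1 ≤ N - 2) ∨ (e.1.2.2 ≤ -1 ∧ e.2.2.2 ≤ -1))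
    (hT : IsEdgeSetOf (O ∪ {((N - 1, t, 0), (N - 1 / 2, t + 1 / 2, 1)),
      ((N - 1 / 2, t + 1 / 2, 1), (N, t + 1, 0)), ((N, t, 0), (N - 1, t + 1, 0)),
      ((N, l + 1, -1), (N, -1, -1)), ((N, t + 1, 0), (N, l + 1, -1)), ((N, -1, -1), (N, t, 0))}) T) :
    IsEdgeSetOf (O ∪ {((N - 1, t, 0), (N - 1, t + 1, 0))}) T := by
  obtain ⟨v, hv⟩ : ∃ v : R3, v = (N - 1, t, 0) := ⟨_, rfl⟩
  obtain ⟨M, hM⟩ : ∃ v : R3, v = (N - 1 / 2, t + 1 / 2, 1) := ⟨_, rfl⟩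
  obtain ⟨A, hA⟩ : ∃ v : R3, v = (N, t + 1, 0) := ⟨_, rfl⟩
  obtain ⟨C, hC⟩ : ∃ v : R3, v = (N, l + 1, -1) := ⟨_, rfl⟩
  obtain ⟨D, hD⟩ : ∃ v : R3, v = (N, -1, -1) := ⟨_, rfl⟩
  obtain ⟨F, hF⟩ : ∃ v : R3, v = (N, t, 0) := ⟨_, rfl⟩
  obtain ⟨z, hz⟩ : ∃ v : R3, v = (N - 1, t + 1, 0) := ⟨_, rfl⟩
  rw [← hv, ← hM, ← hA, ← hC, ← hD, ← hF, ← hz] at hT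
  rw [← hv, ← hz]
  have ne : ∀ {a b : R3}, a.1 ≠ b.1 ∨ a.2.1 ≠ b.2.1 ∨ a.2.2 ≠ b.2.2 → a ≠ b := by
    rintro a b h rfl
    simp at h
  have off : ∀ {a b c : R3}, (0 ≤ a.1 - (N - 1)) → (0 ≤ b.1 - (N - 1)) → (0 < c.1 - (N - 1)) →
      (0 < a.1 - (N - 1) ∨ 0 < b.1 - (N - 1)) → ∀ e ∈ O,
      e ≠ (a, c) ∧ e ≠ (c, b) ∧ ∃ q, DeleteCert a b c e q := by
    intro a b c ha hb hc hab e he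
    obtain ⟨h1, h2⟩ := hO e he
    refine ⟨?_, ?_, (1, 0, 0, -(N - 1)), ?_⟩
    · rintro rfl; simp only at h2; linarith
    · rintro rfl; simp only at h1; linarith
    · simp only [DeleteCert, affineFn]
      refine ⟨by linarith, by linarith, by linarith, by linarith, by linarith, ?_⟩
      exact hab.imp (fun h => by linarith) (fun h => by linarith)
  -- remove `C`
  have s1 := hT.delete_of_eq (E := O ∪ {(v, M), (M, A), (D, F), (F, z)}) (a := A) (c := C) (b := D)
    (by ext e; simp only [Set.mem_union, Set.mem_insert_iff, Set.mem_singleton_iff]; tauto)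
    (by subst hA hD; apply ne; simp only; right; right; norm_num) (by
      subst hv hM hA hC hD hF hz
      rintro e (he | rfl | rfl | rfl | rfl)
      · refine off ?_ ?_ ?_ ?_ e he <;> simp
      · refine ⟨?_, ?_, (0, 0, -1, 0), ?_⟩ <;> simp [DeleteCert, affineFn]
      · refine ⟨?_, ?_, (0, 0, -1, 0), ?_⟩ <;> simp [DeleteCert, affineFn]
      · refine ⟨?_, ?_, (0, 1, -(t + 1), -t), ?_⟩
        · simp
        · simp only [ne_eq, Prod.mk.injEq, not_and]; intros; linarith
        · simp only [DeleteCert, affineFn]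
          refine ⟨?_, ?_, ?_, ?_, ?_, .inl ?_⟩ <;> linarith
      · refine ⟨?_, ?_, (0, 0, -1, 0), ?_⟩ <;> simp [DeleteCert, affineFn])
  -- remove `D`
  have s2 := s1.delete_of_eq (E := O ∪ {(v, M), (M, A), (F, z)}) (a := A) (c := D) (b := F)
    (by ext e; simp only [Set.mem_union, Set.mem_insert_iff, Set.mem_singleton_iff]; tauto)
    (by subst hA hF; apply ne; simp only; right; left; linarith) (by
      subst hv hM hA hC hD hF hz
      rintro e (he | rfl | rfl | rfl)
      · refine off ?_ ?_ ?_ ?_ e he <;> simp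
      · refine ⟨?_, ?_, (1, 0, 0, -(N - 1 / 2)), ?_⟩
        · simp
        · simp
        · simp only [DeleteCert, affineFn]
          refine ⟨?_, ?_, ?_, ?_, ?_, .inl ?_⟩ <;> linarith
      · refine ⟨?_, ?_, (0, -1, -1, t + 1), ?_⟩
        · simp
        · simp
        · simp only [DeleteCert, affineFn]
          refine ⟨?_, ?_, ?_, ?_, ?_, .inr ?_⟩ <;> linarith
      · refine ⟨?_, ?_, (1, 1, -(t + 1), -(N + t)), ?_⟩
        · simp
        · simp only [ne_eq, Prod.mk.injEq, not_and]; intros; linarith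
        · simp only [DeleteCert, affineFn]
          refine ⟨?_, ?_, ?_, ?_, ?_, .inl ?_⟩ <;> linarith)
  -- remove `A`
  have s3 := s2.delete_of_eq (E := O ∪ {(v, M), (F, z)}) (a := M) (c := A) (b := F)
    (by ext e; simp only [Set.mem_union, Set.mem_insert_iff, Set.mem_singleton_iff]; tauto)
    (by subst hM hF; apply ne; simp only; right; left; linarith) (by
      subst hv hM hA hC hD hF hz
      rintro e (he | rfl | rfl)
      · refine off ?_ ?_ ?_ ?_ e he <;> simp only <;> first | linarith | (left; linarith)
      · refine ⟨?_, ?_, (1, 0, 0, -(N - 1 / 2)), ?_⟩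
        · simp
        · simp
        · simp only [DeleteCert, affineFn]
          refine ⟨?_, ?_, ?_, ?_, ?_, .inr ?_⟩ <;> linarith
      · refine ⟨?_, ?_, (0, 0, 1, 0), ?_⟩ <;> simp [DeleteCert, affineFn])
  -- remove `F`
  have s4 := s3.delete_of_eq (E := O ∪ {(v, M)}) (a := M) (c := F) (b := z)
    (by ext e; simp only [Set.mem_union, Set.mem_insert_iff, Set.mem_singleton_iff]; tauto)
    (by subst hM hz; apply ne; simp only; right; left; linarith) (by
      subst hv hM hA hC hD hF hz
      rintro e (he | rfl)
      · refine off ?_ ?_ ?_ ?_ e he <;> simp only <;> first | linarith | (left; linarith)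
      · refine ⟨?_, ?_, (1, 1, -1, -(N - 1) - t), ?_⟩
        · simp
        · simp
        · simp only [DeleteCert, affineFn]
          refine ⟨?_, ?_, ?_, ?_, ?_, .inr ?_⟩ <;> linarith)
  -- remove `M`
  refine s4.delete_of_eq (E := O) (a := v) (c := M) (b := z)
    (by ext e; simp only [Set.mem_union, Set.mem_insert_iff, Set.mem_singleton_iff]; tauto)
    (by subst hv hz; apply ne; simp only; right; left; linarith) ?_
  subst hv hM hA hC hD hF hz
  intro e he
  obtain ⟨h1, h2⟩ := hO e he
  refine ⟨?_, ?_, ?_⟩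
  · rintro rfl; simp only at h2; linarith
  · rintro rfl; simp only at h1; linarith
  rcases hO' e he with ⟨h3, h4⟩ | ⟨h3, h4⟩ | ⟨h3, h4⟩ | ⟨h3, h4⟩
  · refine ⟨(0, 1, 0, -t), ?_⟩
    simp only [DeleteCert, affineFn]
    refine ⟨?_, ?_, ?_, ?_, ?_, .inr ?_⟩ <;> linarith
  · refine ⟨(0, -1, 0, t + 1), ?_⟩
    simp only [DeleteCert, affineFn]
    refine ⟨?_, ?_, ?_, ?_, ?_, .inl ?_⟩ <;> linarith
  · refine ⟨(1, 0, 0, -(N - 2)), ?_⟩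
    simp only [DeleteCert, affineFn]
    refine ⟨?_, ?_, ?_, ?_, ?_, .inl ?_⟩ <;> linarith
  · refine ⟨(0, 0, 1, 1), ?_⟩
    simp only [DeleteCert, affineFn]
    refine ⟨?_, ?_, ?_, ?_, ?_, .inl ?_⟩ <;> linarith

theorem loop_remove {L t : ℕ} (htl : t + 1 ≤ L)
    (hO : ∀ e ∈ O, e.1.1 ≤ N - 1 ∧ e.2.1 ≤ N - 1)
    (hO' : ∀ e ∈ O, (e.1.2.1 ≤ t ∧ e.2.2.1 ≤ t) ∨ ((t : ℝ) + 1 ≤ e.1.2.1 ∧ (t : ℝ) + 1 ≤ e.2.2.1) ∨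
      (e.1.1 ≤ N - 2 ∧ e.2.1 ≤ N - 2) ∨ (e.1.2.2 ≤ -1 ∧ e.2.2.2 ≤ -1))
    (hT : IsEdgeSetOf (O ∪ loopEdges N L t L 0 ∪
      {((N, (L : ℝ), 0), (N, (L : ℝ) + 1, -1)), ((N, -1, -1), (N, 0, 0))}) T) :
    IsEdgeSetOf (O ∪ {((N - 1, (t : ℝ), 0), (N - 1, (t : ℝ) + 1, 0))}) T := by
  have htl' : (t : ℝ) + 1 ≤ L := by exact_mod_cast htl
  have a1 : ∀ d s, s + d = L → t + 1 ≤ s → IsEdgeSetOf (O ∪ loopEdges N L t s 0 ∪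
      {((N, (s : ℝ), 0), (N, (L : ℝ) + 1, -1)), ((N, -1, -1), (N, ((0 : ℕ) : ℝ), 0))}) T := by
    intro d
    induction d with
    | zero =>
      rintro s rfl -
      simpa using hT
    | succ d ih =>
      intro s hs hts
      have h1 : (s : ℝ) + 1 ≤ L := by exact_mod_cast (show s + 1 ≤ L by omega)
      exact loop_shorten_end hts hO h1 (Nat.zero_le _)
        (ih (s + 1) (by omega) (by omega))
  have a2 : ∀ r, r ≤ t → IsEdgeSetOf (O ∪ loopEdges N L t (t + 1) r ∪
      {((N, ((t + 1 : ℕ) : ℝ), 0), (N, (L : ℝ) + 1, -1)), ((N, -1, -1), (N, (r : ℝ), 0))}) T := by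
    intro r
    induction r with
    | zero => intro _; exact a1 (L - (t + 1)) (t + 1) (by omega) le_rfl
    | succ r ih =>
      intro hr
      exact loop_shorten_start le_rfl hO (by push_cast; exact htl') hr (ih (by omega))
  refine loop_collapse (Nat.cast_nonneg t) htl' hO hO' ?_
  convert a2 t le_rfl using 1
  rw [Set.union_assoc]
  congr 1
  ext e
  have b1 : ¬ ∃ j : ℕ, t + 1 ≤ j ∧ j < t + 1 ∧ e = ((N, (j : ℝ), 0), (N, (j : ℝ) + 1, 0)) := by
    rintro ⟨j, h1, h2, -⟩; omega
  have b2 : ¬ ∃ j : ℕ, t ≤ j ∧ j < t ∧ e = ((N, (j : ℝ), 0), (N, (j : ℝ) + 1, 0)) := by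
    rintro ⟨j, h1, h2, -⟩; omega
  simp only [loopEdges, Set.mem_union, Set.mem_ofPred_eq, Set.mem_insert_iff,
    Set.mem_singleton_iff, b1, b2, false_or, Nat.cast_add, Nat.cast_one, or_assoc]

end Loop

/-- On `m + 1` strands the letter `m` is out of range and stands for an empty slab. Keeping it in
the word leaves the other slabs and the closing edges in place. -/
theorem WordHasType.remove_strand {m : ℕ} {u v : List ℕ} {T : LinkType} (hu : ∀ i ∈ u, i < m)
    (hv : ∀ i ∈ v, i < m) (hT : WordHasType (m + 2) (u ++ m :: v) T) :
    WordHasType (m + 1) (u ++ m :: v) T := by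
  obtain ⟨w, hw⟩ : ∃ w, w = u ++ m :: v := ⟨_, rfl⟩
  obtain ⟨t, ht⟩ : ∃ t, t = u.length := ⟨_, rfl⟩
  have htl : t + 1 ≤ w.length := by rw [hw, ht]; simp
  have hwt : ∀ s, w[s]? = some m ↔ s = t := by
    intro s
    rw [hw, ht]
    rcases lt_trichotomy s u.length with h | rfl | h
    · rw [List.getElem?_append_left h]
      constructor
      · intro h'
        exact absurd (hu m (List.mem_of_getElem? h')) (lt_irrefl _)
      · omega
    · simp
    · rw [List.getElem?_append_right h.le]
      obtain ⟨r, hr⟩ : ∃ r, s - u.length = r + 1 := ⟨s - u.length - 1, by omega⟩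
      rw [hr, List.getElem?_cons_succ]
      constructor
      · intro h'
        exact absurd (hv m (List.mem_of_getElem? h')) (lt_irrefl _)
      · omega
  rw [← hw] at hT ⊢
  have hX1 : ∀ k s, k < m → wordCrossings (m + 2) w k s = wordCrossings (m + 1) w k s := by
    intro k s hk
    simp [wordCrossings, show k + 1 < m + 2 by omega, hk]
  have hX2 : ∀ s, wordCrossings (m + 2) w m s = decide (s = t) := by
    intro s
    simp [wordCrossings, hwt]
  have hX3 : ∀ s, wordCrossings (m + 2) w (m + 1) s = false := by
    intro s
    simp [wordCrossings]
  have hX4 : ∀ s, wordCrossings (m + 1) w m s = false := by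
    intro s
    simp [wordCrossings]
  have hp : ∀ k s, k ≤ m → prevCol (wordCrossings (m + 2) w) k s =
      prevCol (wordCrossings (m + 1) w) k s := by
    intro k s hk
    rcases k with _ | k
    · simp [prevCol]
    · simp [prevCol, hX1 k s (by omega)]
  have hp0 : prevCol (wordCrossings (m + 1) w) m t = false := by
    rcases m with _ | m
    · simp [prevCol]
    · simp [prevCol, wordCrossings, (hwt t).2 rfl]
  let O : Set (R3 × R3) := {e | (∃ k s : ℕ, k < m + 1 ∧ s < w.length ∧ ¬ (k = m ∧ s = t) ∧
    ∃ a ∈ cellEdgesAt (wordCrossings (m + 1) w) k s, e = latticeEdge k s a) ∨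
    IsClosingEdge (m + 1) w.length e}
  have e0 : diagramEdges (m + 1) w.length (wordCrossings (m + 1) w) =
      O ∪ {((((m + 1 : ℕ) : ℝ) - 1, (t : ℝ), 0), (((m + 1 : ℕ) : ℝ) - 1, (t : ℝ) + 1, 0))} := by
    have hc : cellEdgesAt (wordCrossings (m + 1) w) m t = [((0, 0, 0), (0, 2, 0))] := by
      simp [cellEdgesAt, cellEdges, hX4, hp0]
    have he : latticeEdge m t ((0, 0, 0), (0, 2, 0)) =
        ((((m + 1 : ℕ) : ℝ) - 1, (t : ℝ), 0), (((m + 1 : ℕ) : ℝ) - 1, (t : ℝ) + 1, 0)) := by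
      simp [latticeEdge, latticePt]
    ext e
    constructor
    · rintro (⟨k, s, hk, hs, a, ha, rfl⟩ | h)
      · by_cases hb : k = m ∧ s = t
        · obtain ⟨rfl, rfl⟩ := hb
          rw [hc, List.mem_singleton] at ha
          subst ha
          exact .inr he
        · exact .inl (.inl ⟨k, s, hk, hs, hb, a, ha, rfl⟩)
      · exact .inl (.inr h)
    · rintro ((⟨k, s, hk, hs, hb, a, ha, rfl⟩ | h) | h)
      · exact .inl ⟨k, s, hk, hs, a, ha, rfl⟩
      · exact .inr h
      · rw [Set.mem_singleton_iff] at h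
        subst h
        exact .inl ⟨m, t, by omega, htl, _, by rw [hc]; exact List.mem_singleton.2 rfl, he.symm⟩
  unfold WordHasType at hT ⊢
  rw [e0]
  refine loop_remove htl ?_ ?_ ?_
  · rintro e (⟨k, s, hk, hs, hb, a, ha, rfl⟩ | h)
    · obtain ⟨⟨-, h1, h2⟩, -⟩ := cellEdges_latticeEdge_coord ha
      push_cast
      rcases Nat.lt_succ_iff_lt_or_eq.1 hk with hk | rfl
      · have : (k : ℝ) + 1 ≤ m := by exact_mod_cast hk
        exact ⟨by linarith, by linarith⟩
      · obtain ⟨h3, h4⟩ := h2 (hX4 _)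
        exact ⟨by linarith, by linarith⟩
    · push_cast
      cases h with
      | _ k hk =>
        have : (k : ℝ) ≤ m := by exact_mod_cast Nat.lt_succ_iff.1 hk
        simp only
        exact ⟨by linarith, by linarith⟩
  · rintro e (⟨k, s, hk, hs, hb, a, ha, rfl⟩ | h)
    · obtain ⟨⟨-, h1, h2⟩, ⟨⟨h5, h6⟩, h7, h8⟩, -⟩ := cellEdges_latticeEdge_coord ha
      rcases natCast_trichotomy s t with rfl | h | h
      · right; right; left
        have hkm : k < m := by omega
        push_cast
        by_cases hk1 : k + 1 = m
        · have : wordCrossings (m + 1) w k s = false := by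
            simp [wordCrossings, (hwt s).2 rfl]
            omega
          obtain ⟨h3, h4⟩ := h2 this
          have : (k : ℝ) + 1 = m := by exact_mod_cast hk1
          exact ⟨by linarith, by linarith⟩
        · have : (k : ℝ) + 2 ≤ m := by exact_mod_cast (show k + 2 ≤ m by omega)
          exact ⟨by linarith, by linarith⟩
      · left; exact ⟨by linarith, by linarith⟩
      · right; left; exact ⟨by linarith, by linarith⟩
    · have h1 : (t : ℝ) + 1 ≤ w.length := by exact_mod_cast htl
      have h2 : (0 : ℝ) ≤ t := Nat.cast_nonneg _
      cases h with
      | top k hk => right; left; simp only; exact ⟨by linarith, by linarith⟩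
      | back k hk => right; right; right; simp
      | bottom k hk => left; simp only; exact ⟨by linarith, by linarith⟩
  · convert hT using 1
    have c1 : latticeEdge m t ((0, 0, 0), (1, 1, 1)) = ((((m + 1 : ℕ) : ℝ) - 1, (t : ℝ), 0),
        (((m + 1 : ℕ) : ℝ) - 1 / 2, (t : ℝ) + 1 / 2, 1)) := by
      simp [latticeEdge, latticePt]; ring
    have c2 : latticeEdge m t ((1, 1, 1), (2, 2, 0)) =
        ((((m + 1 : ℕ) : ℝ) - 1 / 2, (t : ℝ) + 1 / 2, 1), (((m + 1 : ℕ) : ℝ), (t : ℝ) + 1, 0)) := by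
      simp [latticeEdge, latticePt]; ring
    have c3 : latticeEdge m t ((2, 0, 0), (0, 2, 0)) =
        ((((m + 1 : ℕ) : ℝ), (t : ℝ), 0), (((m + 1 : ℕ) : ℝ) - 1, (t : ℝ) + 1, 0)) := by
      simp [latticeEdge, latticePt]
    have c4 : ∀ s : ℕ, latticeEdge (m + 1) s ((0, 0, 0), (0, 2, 0)) =
        ((((m + 1 : ℕ) : ℝ), (s : ℝ), 0), (((m + 1 : ℕ) : ℝ), (s : ℝ) + 1, 0)) := by
      intro s
      simp [latticeEdge, latticePt]
    have hcell : ∀ k s, k < m + 1 → ¬ (k = m ∧ s = t) →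
        cellEdgesAt (wordCrossings (m + 2) w) k s = cellEdgesAt (wordCrossings (m + 1) w) k s := by
      intro k s hk hb
      simp only [cellEdgesAt]
      rw [hp k s (by omega)]
      congr 1
      rcases Nat.lt_succ_iff_lt_or_eq.1 hk with hk | rfl
      · exact hX1 k s hk
      · rw [hX2, hX4]
        simpa using fun h => hb ⟨rfl, h⟩
    have hcell1 : cellEdgesAt (wordCrossings (m + 2) w) m t =
        [((0, 0, 0), (1, 1, 1)), ((1, 1, 1), (2, 2, 0)), ((2, 0, 0), (0, 2, 0))] := by
      simp [cellEdgesAt, cellEdges, hX2]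
    have hcell2 : ∀ s, cellEdgesAt (wordCrossings (m + 2) w) (m + 1) s =
        if s = t then [] else [((0, 0, 0), (0, 2, 0))] := by
      intro s
      simp [cellEdgesAt, cellEdges, hX3, prevCol, hX2]
    ext e
    constructor
    · rintro ((((⟨k, s, hk, hs, hb, a, ha, rfl⟩ | h)) | h) | h)
      · exact .inl ⟨k, s, by omega, hs, a, by rw [hcell k s hk hb]; exact ha, rfl⟩
      · right
        cases h with
        | top k hk => exact .top k (by omega)
        | back k hk => exact .back k (by omega)
        | bottom k hk => exact .bottom k (by omega)
      · rcases h with ⟨j, h1, h2, rfl⟩ | ⟨j, h1, h2, rfl⟩ | rfl | rfl | rfl | rfl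
        · exact .inl ⟨m + 1, j, by omega, h2, _, by
            rw [hcell2, if_neg (by omega)]; exact List.mem_singleton.2 rfl, (c4 j).symm⟩
        · exact .inl ⟨m + 1, j, by omega, by omega, _, by
            rw [hcell2, if_neg (by omega)]; exact List.mem_singleton.2 rfl, (c4 j).symm⟩
        · exact .inl ⟨m, t, by omega, htl, _, by rw [hcell1]; simp, c1.symm⟩
        · exact .inl ⟨m, t, by omega, htl, ((1, 1, 1), (2, 2, 0)), by rw [hcell1]; simp, c2.symm⟩
        · exact .inl ⟨m, t, by omega, htl, ((2, 0, 0), (0, 2, 0)), by rw [hcell1]; simp, c3.symm⟩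
        · exact .inr (.back (m + 1) (by omega))
      · rcases h with rfl | rfl
        · exact .inr (.top (m + 1) (by omega))
        · exact .inr (.bottom (m + 1) (by omega))
    · rintro (⟨k, s, hk, hs, a, ha, rfl⟩ | h)
      · by_cases hk1 : k = m + 1
        · subst hk1
          rw [hcell2] at ha
          split_ifs at ha with hst
          · simp at ha
          · rw [List.mem_singleton] at ha
            subst ha
            rw [c4]
            rcases lt_or_gt_of_ne hst with h | h
            · exact .inl (.inr (.inr (.inl ⟨s, Nat.zero_le _, h, rfl⟩)))
            · exact .inl (.inr (.inl ⟨s, h, hs, rfl⟩))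
        · by_cases hb : k = m ∧ s = t
          · obtain ⟨rfl, rfl⟩ := hb
            rw [hcell1] at ha
            simp only [List.mem_cons, List.not_mem_nil, or_false] at ha
            rcases ha with rfl | rfl | rfl
            · rw [c1]; exact .inl (.inr (.inr (.inr (.inl rfl))))
            · rw [c2]; exact .inl (.inr (.inr (.inr (.inr (.inl rfl)))))
            · rw [c3]; exact .inl (.inr (.inr (.inr (.inr (.inr (.inl rfl))))))
          · exact .inl (.inl (.inl ⟨k, s, by omega, hs, hb, a, by
              rw [← hcell k s (by omega) hb]; exact ha, rfl⟩))
      · cases h with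
        | top k hk =>
          rcases Nat.lt_succ_iff_lt_or_eq.1 hk with hk | rfl
          · exact .inl (.inl (.inr (.top k hk)))
          · exact .inr (.inl rfl)
        | back k hk =>
          rcases Nat.lt_succ_iff_lt_or_eq.1 hk with hk | rfl
          · exact .inl (.inl (.inr (.back k hk)))
          · exact .inl (.inr (.inr (.inr (.inr (.inr (.inr rfl))))))
        | bottom k hk =>
          rcases Nat.lt_succ_iff_lt_or_eq.1 hk with hk | rfl
          · exact .inl (.inl (.inr (.bottom k hk)))
          · exact .inr (.inr rfl)

/-! ### Removing an empty slab at the end -/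

/-- The three closing edges at the position `k`. -/
def closingEdgesAt (k l : ℕ) : Set (R3 × R3) :=
  {(((k : ℝ), (l : ℝ), 0), ((k : ℝ), (l : ℝ) + 1, -1)),
    (((k : ℝ), (l : ℝ) + 1, -1), ((k : ℝ), -1, -1)), (((k : ℝ), -1, -1), ((k : ℝ), 0, 0))}

theorem isClosingEdge_iff {n l : ℕ} {e : R3 × R3} :
    IsClosingEdge n l e ↔ ∃ k, k < n ∧ e ∈ closingEdgesAt k l := by
  constructor
  · rintro (⟨k, hk⟩ | ⟨k, hk⟩ | ⟨k, hk⟩)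
    · exact ⟨k, hk, .inl rfl⟩
    · exact ⟨k, hk, .inr (.inl rfl)⟩
    · exact ⟨k, hk, .inr (.inr rfl)⟩
  · rintro ⟨k, hk, rfl | rfl | rfl⟩
    · exact .top k hk
    · exact .back k hk
    · exact .bottom k hk

/-- The edges at the position `k` after `l` slabs: those of an empty slab and the closing edges. -/
def longClosingEdgesAt (k l : ℕ) : Set (R3 × R3) :=
  insert (((k : ℝ), (l : ℝ), 0), ((k : ℝ), (l : ℝ) + 1, 0)) (closingEdgesAt k (l + 1))

/-- Three moves: the far corner `C` is deleted, the new corner `c1` is inserted below `c`, and `c`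
is deleted. -/
theorem shorten_closing {R : Set (R3 × R3)} {T : LinkType} {k l : ℕ}
    (hR : ∀ e ∈ R, ((0 ≤ e.1.2.2 ∧ 0 ≤ e.2.2.2) ∧ e.1.2.1 ≤ l ∧ e.2.2.1 ≤ l) ∨
      (e.1.1 ≤ k - 1 ∧ e.2.1 ≤ k - 1) ∨ ((k : ℝ) + 1 ≤ e.1.1 ∧ (k : ℝ) + 1 ≤ e.2.1))
    (hT : IsEdgeSetOf (R ∪ longClosingEdgesAt k l) T) :
    IsEdgeSetOf (R ∪ closingEdgesAt k l) T := by
  obtain ⟨x, hx⟩ : ∃ x : ℝ, x = k := ⟨_, rfl⟩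
  obtain ⟨y, hy⟩ : ∃ y : ℝ, y = l := ⟨_, rfl⟩
  have hy0 : 0 ≤ y := hy ▸ Nat.cast_nonneg _
  simp only [longClosingEdgesAt, closingEdgesAt, Nat.cast_add, Nat.cast_one, ← hx, ← hy] at hT ⊢
  rw [← hx, ← hy] at hR
  obtain ⟨a, ha⟩ : ∃ v : R3, v = (x, y, 0) := ⟨_, rfl⟩
  obtain ⟨c, hc⟩ : ∃ v : R3, v = (x, y + 1, 0) := ⟨_, rfl⟩
  obtain ⟨C, hC⟩ : ∃ v : R3, v = (x, y + 1 + 1, -1) := ⟨_, rfl⟩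
  obtain ⟨c1, hc1⟩ : ∃ v : R3, v = (x, y + 1, -1) := ⟨_, rfl⟩
  obtain ⟨D, hD⟩ : ∃ v : R3, v = (x, -1, -1) := ⟨_, rfl⟩
  obtain ⟨b, hb⟩ : ∃ v : R3, v = (x, 0, 0) := ⟨_, rfl⟩
  rw [← ha, ← hc, ← hC, ← hD, ← hb] at hT
  rw [← ha, ← hc1, ← hD, ← hb]
  have ne : ∀ {a b : R3}, a.1 ≠ b.1 ∨ a.2.1 ≠ b.2.1 ∨ a.2.2 ≠ b.2.2 → a ≠ b := by
    rintro a b h rfl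
    simp at h
  have s1 := hT.delete_of_eq (E := R ∪ {(a, c), (D, b)}) (a := c) (c := C) (b := D)
    (by ext e; simp only [Set.mem_union, Set.mem_insert_iff, Set.mem_singleton_iff]; tauto)
    (by subst hc hD; apply ne; simp only; right; right; norm_num) (by
      subst ha hc hC hc1 hD hb
      rintro e (he | rfl | rfl)
      · rcases hR e he with ⟨⟨h1, h2⟩, h3, h4⟩ | ⟨h1, h2⟩ | ⟨h1, h2⟩
        · refine ⟨?_, ?_, (0, 0, -1, 0), ?_⟩
          · rintro rfl; simp only at h2; linarith
          · rintro rfl; simp only at h2; linarith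
          · simp only [DeleteCert, affineFn]
            refine ⟨?_, ?_, ?_, ?_, ?_, .inr ?_⟩ <;> linarith
        · refine ⟨?_, ?_, (1, 0, 0, -x + 1), ?_⟩
          · rintro rfl; simp only at h2; linarith
          · rintro rfl; simp only at h2; linarith
          · simp only [DeleteCert, affineFn]
            refine ⟨?_, ?_, ?_, ?_, ?_, .inr ?_⟩ <;> linarith
        · refine ⟨?_, ?_, (-1, 0, 0, x + 1), ?_⟩
          · rintro rfl; simp only at h2; linarith
          · rintro rfl; simp only at h2; linarith
          · simp only [DeleteCert, affineFn]
            refine ⟨?_, ?_, ?_, ?_, ?_, .inr ?_⟩ <;> linarith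
      · refine ⟨?_, ?_, (0, 0, -1, 0), ?_⟩ <;> simp [DeleteCert, affineFn]
      · refine ⟨?_, ?_, (0, 1, -1, 0), ?_⟩
        · simp
        · simp
        · simp only [DeleteCert, affineFn]
          refine ⟨?_, ?_, ?_, ?_, ?_, .inl ?_⟩ <;> linarith)
  have s2 := s1.insert (c := c1) ⟨(0, 0, 1, 1), by
      subst hc hc1 hD
      simp [CornerCert, affineFn]⟩ (by subst hc1 hD; apply ne; simp only; right; left; linarith) (by
      subst ha hc hC hc1 hD hb
      rintro e (he | rfl | rfl)
      · rcases hR e he with ⟨⟨h1, h2⟩, h3, h4⟩ | ⟨h1, h2⟩ | ⟨h1, h2⟩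
        · refine ⟨?_, (0, 0, -1, 0), ?_⟩
          · rintro rfl; simp only at h2; linarith
          · simp only [InsertCert, affineFn]
            refine ⟨?_, ?_, ?_, ?_, ?_⟩ <;> linarith
        · refine ⟨?_, (1, 0, 0, -x + 1), ?_⟩
          · rintro rfl; simp only at h2; linarith
          · simp only [InsertCert, affineFn]
            refine ⟨?_, ?_, ?_, ?_, ?_⟩ <;> linarith
        · refine ⟨?_, (-1, 0, 0, x + 1), ?_⟩
          · rintro rfl; simp only at h2; linarith
          · simp only [InsertCert, affineFn]
            refine ⟨?_, ?_, ?_, ?_, ?_⟩ <;> linarith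
      · refine ⟨?_, (0, 0, -1, 0), ?_⟩ <;> simp [InsertCert, affineFn]
      · refine ⟨?_, (0, 1, -1, 0), ?_⟩
        · simp
        · simp only [InsertCert, affineFn]
          refine ⟨?_, ?_, ?_, ?_, ?_⟩ <;> linarith)
  have s3 := s2.delete_of_eq (E := R ∪ {(c1, D), (D, b)}) (a := a) (c := c) (b := c1)
    (by ext e; simp only [Set.mem_union, Set.mem_insert_iff, Set.mem_singleton_iff]; tauto)
    (by subst ha hc1; apply ne; simp only; right; right; norm_num) (by
      subst ha hc hC hc1 hD hb
      rintro e (he | rfl | rfl)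
      · rcases hR e he with ⟨⟨h1, h2⟩, h3, h4⟩ | ⟨h1, h2⟩ | ⟨h1, h2⟩
        · refine ⟨?_, ?_, (0, 1, 0, -y), ?_⟩
          · rintro rfl; simp only at h4; linarith
          · rintro rfl; simp only at h3; linarith
          · simp only [DeleteCert, affineFn]
            refine ⟨?_, ?_, ?_, ?_, ?_, .inr ?_⟩ <;> linarith
        · refine ⟨?_, ?_, (1, 0, 0, -x + 1), ?_⟩
          · rintro rfl; simp only at h2; linarith
          · rintro rfl; simp only at h2; linarith
          · simp only [DeleteCert, affineFn]
            refine ⟨?_, ?_, ?_, ?_, ?_, .inr ?_⟩ <;> linarith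
        · refine ⟨?_, ?_, (-1, 0, 0, x + 1), ?_⟩
          · rintro rfl; simp only at h2; linarith
          · rintro rfl; simp only at h2; linarith
          · simp only [DeleteCert, affineFn]
            refine ⟨?_, ?_, ?_, ?_, ?_, .inr ?_⟩ <;> linarith
      · refine ⟨?_, ?_, (0, 0, 1, 1), ?_⟩ <;> simp [DeleteCert, affineFn]
      · refine ⟨?_, ?_, (0, 1, 0, -y), ?_⟩
        · simp
        · simp
        · simp only [DeleteCert, affineFn]
          refine ⟨?_, ?_, ?_, ?_, ?_, .inr ?_⟩ <;> linarith)
  convert s3 using 1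
  ext e
  simp only [Set.mem_union, Set.mem_insert_iff, Set.mem_singleton_iff]
  tauto

/-- The edges of the closed braid diagram on `n` strands with `l` slabs and one more empty slab,
which is removed at the positions `k < j`. -/
def trimEdges (n l : ℕ) (X : ℕ → ℕ → Bool) (j : ℕ) : Set (R3 × R3) :=
  {e | (∃ k s : ℕ, k < n ∧ s < l ∧ ∃ a ∈ cellEdgesAt X k s, e = latticeEdge k s a) ∨
    (∃ k, k < n ∧ k < j ∧ e ∈ closingEdgesAt k l) ∨
    (∃ k, k < n ∧ j ≤ k ∧ e ∈ longClosingEdgesAt k l)}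

theorem trimEdges_succ {n l j : ℕ} {X : ℕ → ℕ → Bool} {T : LinkType} (hj : j < n)
    (hT : IsEdgeSetOf (trimEdges n l X j) T) : IsEdgeSetOf (trimEdges n l X (j + 1)) T := by
  let R : Set (R3 × R3) :=
    {e | (∃ k s : ℕ, k < n ∧ s < l ∧ ∃ a ∈ cellEdgesAt X k s, e = latticeEdge k s a) ∨
      (∃ k, k < n ∧ k < j ∧ e ∈ closingEdgesAt k l) ∨
      (∃ k, k < n ∧ j + 1 ≤ k ∧ e ∈ longClosingEdgesAt k l)}
  have e1 : trimEdges n l X j = R ∪ longClosingEdgesAt j l := by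
    ext e
    constructor
    · rintro (h | h | ⟨k, hk, hjk, h⟩)
      · exact .inl (.inl h)
      · exact .inl (.inr (.inl h))
      · rcases hjk.eq_or_lt with rfl | hjk
        · exact .inr h
        · exact .inl (.inr (.inr ⟨k, hk, hjk, h⟩))
    · rintro ((h | h | ⟨k, hk, hjk, h⟩) | h)
      · exact .inl h
      · exact .inr (.inl h)
      · exact .inr (.inr ⟨k, hk, by omega, h⟩)
      · exact .inr (.inr ⟨j, hj, le_rfl, h⟩)
  have e2 : trimEdges n l X (j + 1) = R ∪ closingEdgesAt j l := by
    ext e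
    constructor
    · rintro (h | ⟨k, hk, hjk, h⟩ | h)
      · exact .inl (.inl h)
      · rcases Nat.lt_succ_iff_lt_or_eq.1 hjk with hjk | rfl
        · exact .inl (.inr (.inl ⟨k, hk, hjk, h⟩))
        · exact .inr h
      · exact .inl (.inr (.inr h))
    · rintro ((h | ⟨k, hk, hjk, h⟩ | h) | h)
      · exact .inl h
      · exact .inr (.inl ⟨k, hk, by omega, h⟩)
      · exact .inr (.inr h)
      · exact .inr (.inl ⟨j, hj, by omega, h⟩)
  rw [e1] at hT
  rw [e2]
  refine shorten_closing ?_ hT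
  rintro e (⟨k, s, hk, hs, a, ha, rfl⟩ | ⟨k, hk, hjk, h⟩ | ⟨k, hk, hjk, h⟩)
  · obtain ⟨-, ⟨-, h1, h2⟩, h3⟩ := cellEdges_latticeEdge_coord ha
    have : (s : ℝ) + 1 ≤ l := by exact_mod_cast hs
    exact .inl ⟨h3, by linarith, by linarith⟩
  · have : (k : ℝ) + 1 ≤ j := by exact_mod_cast hjk
    right; left
    rcases h with rfl | rfl | rfl <;> simp only <;> constructor <;> linarith
  · have : (j : ℝ) + 1 ≤ k := by exact_mod_cast hjk
    right; right
    rcases h with rfl | rfl | rfl | rfl <;> simp only <;> constructor <;> linarith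

theorem WordHasType.trim {n b : ℕ} {w : List ℕ} {T : LinkType} (hb : n ≤ b + 1)
    (hT : WordHasType n (w ++ [b]) T) : WordHasType n w T := by
  have hX : ∀ k s, s < w.length → wordCrossings n (w ++ [b]) k s = wordCrossings n w k s := by
    intro k s hs
    simp only [wordCrossings, List.getElem?_append_left hs]
  have hX' : ∀ k, wordCrossings n (w ++ [b]) k w.length = false := by
    intro k
    simp [wordCrossings]
    omega
  have hcell : ∀ k s, s < w.length → cellEdgesAt (wordCrossings n (w ++ [b])) k s =
      cellEdgesAt (wordCrossings n w) k s := by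
    intro k s hs
    simp only [cellEdgesAt, prevCol, hX _ s hs]
  have hcell' : ∀ k, cellEdgesAt (wordCrossings n (w ++ [b])) k w.length =
      [((0, 0, 0), (0, 2, 0))] := by
    intro k
    simp [cellEdgesAt, prevCol, hX', cellEdges]
  have c4 : ∀ k : ℕ, latticeEdge k w.length ((0, 0, 0), (0, 2, 0)) =
      (((k : ℝ), (w.length : ℝ), 0), ((k : ℝ), (w.length : ℝ) + 1, 0)) := by
    intro k
    simp [latticeEdge, latticePt]
  have e0 : diagramEdges n (w ++ [b]).length (wordCrossings n (w ++ [b])) =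
      trimEdges n w.length (wordCrossings n w) 0 := by
    have hlen : (w ++ [b]).length = w.length + 1 := by simp
    rw [hlen]
    ext e
    constructor
    · rintro (⟨k, s, hk, hs, a, ha, rfl⟩ | h)
      · rcases Nat.lt_succ_iff_lt_or_eq.1 hs with hs | rfl
        · exact .inl ⟨k, s, hk, hs, a, by rw [← hcell k s hs]; exact ha, rfl⟩
        · rw [hcell', List.mem_singleton] at ha
          subst ha
          exact .inr (.inr ⟨k, hk, Nat.zero_le _, .inl (c4 k)⟩)
      · obtain ⟨k, hk, h⟩ := isClosingEdge_iff.1 h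
        exact .inr (.inr ⟨k, hk, Nat.zero_le _, .inr h⟩)
    · rintro (⟨k, s, hk, hs, a, ha, rfl⟩ | ⟨k, hk, hjk, h⟩ | ⟨k, hk, hjk, h | h⟩)
      · exact .inl ⟨k, s, hk, by omega, a, by rw [hcell k s hs]; exact ha, rfl⟩
      · omega
      · exact .inl ⟨k, w.length, hk, by omega, _, by
          rw [hcell']; exact List.mem_singleton.2 rfl, h.trans (c4 k).symm⟩
      · exact .inr (isClosingEdge_iff.2 ⟨k, hk, h⟩)
  have e1 : diagramEdges n w.length (wordCrossings n w) =
      trimEdges n w.length (wordCrossings n w) n := by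
    ext e
    constructor
    · rintro (h | h)
      · exact .inl h
      · obtain ⟨k, hk, h⟩ := isClosingEdge_iff.1 h
        exact .inr (.inl ⟨k, hk, hk, h⟩)
    · rintro (h | ⟨k, hk, hjk, h⟩ | ⟨k, hk, hjk, h⟩)
      · exact .inl h
      · exact .inr (isClosingEdge_iff.2 ⟨k, hk, h⟩)
      · omega
  unfold WordHasType at hT ⊢
  rw [e0] at hT
  rw [e1]
  have : ∀ j, j ≤ n → IsEdgeSetOf (trimEdges n w.length (wordCrossings n w) j) T := by
    intro j
    induction j with
    | zero => exact fun _ => hT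
    | succ j ih => exact fun hj => trimEdges_succ hj (ih (by omega))
  exact this n le_rfl

/-- Markov's destabilisation: the last generator occurs once in the word. -/
theorem WordHasType.destabilize {m : ℕ} {u v : List ℕ} {T : LinkType} (hu : ∀ i ∈ u, i < m)
    (hv : ∀ i ∈ v, i < m) (hT : WordHasType (m + 2) (u ++ m :: v) T) :
    WordHasType (m + 1) (u ++ v) T := by
  have h1 := hT.remove_strand hu hv
  -- An empty slab can be exchanged with every letter, so it is carried to the end and trimmed.
  have h2 : ∀ v' u' : List ℕ, WordHasType (m + 1) (u' ++ m :: v') T →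
      WordHasType (m + 1) (u' ++ v' ++ [m]) T := by
    intro v'
    induction v' with
    | nil => intro u' h; simpa using h
    | cons i v' ih =>
      intro u' h
      have := ih (u' ++ [i]) (by simpa using h.swap (.inr (.inl le_rfl)))
      simpa using this
  exact (h2 v u h1).trim le_rfl

/-! ### Positive braids on infinitely many strands -/

inductive PosBraidRel : FreeMonoid ℕ → FreeMonoid ℕ → Prop
  | comm (i j : ℕ) (h : i + 2 ≤ j) :
      PosBraidRel (FreeMonoid.ofList [i, j]) (FreeMonoid.ofList [j, i])
  | braid (i : ℕ) :
      PosBraidRel (FreeMonoid.ofList [i, i + 1, i]) (FreeMonoid.ofList [i + 1, i, i + 1])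

/-- The monoid of positive braids on infinitely many strands. -/
abbrev PosBraid : Type := (conGen PosBraidRel).Quotient

/-- The positive braid of a word. -/
def posBraid (w : List ℕ) : PosBraid := ((FreeMonoid.ofList w : FreeMonoid ℕ) : PosBraid)

theorem posBraid_append (u v : List ℕ) : posBraid (u ++ v) = posBraid u * posBraid v := rfl

theorem posBraid_comm {i j : ℕ} (h : i + 2 ≤ j) :
    posBraid [i] * posBraid [j] = posBraid [j] * posBraid [i] :=
  (Con.eq _).2 (ConGen.Rel.of _ _ (.comm i j h))

theorem posBraid_braid (i : ℕ) :
    posBraid [i] * posBraid [i + 1] * posBraid [i] =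
      posBraid [i + 1] * posBraid [i] * posBraid [i + 1] :=
  (Con.eq _).2 (ConGen.Rel.of _ _ (.braid i))

theorem WordHasType.rel_iff {r : FreeMonoid ℕ} {r' : FreeMonoid ℕ} (h : PosBraidRel r r')
    {u v : List ℕ} {m : ℕ} {T : LinkType} (hr : ∀ i ∈ u ++ r.toList ++ v, i + 1 < m) :
    WordHasType m (u ++ r.toList ++ v) T ↔ WordHasType m (u ++ r'.toList ++ v) T := by
  cases h with
  | comm i j h =>
    simp only [FreeMonoid.toList_ofList, List.append_assoc, List.cons_append, List.nil_append]
    exact ⟨fun hT => hT.swap (.inl (.inl h)), fun hT => hT.swap (.inl (.inr h))⟩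
  | braid i =>
    simp only [FreeMonoid.toList_ofList, List.append_assoc, List.cons_append,
      List.nil_append] at hr ⊢
    have hi : i + 2 < m := hr (i + 1) (by simp)
    -- `WordHasType.braid_rel` compares given types, so both closures must first be known to be
    -- links.
    obtain ⟨T1, h1⟩ := exists_wordHasType hr
    obtain ⟨T2, h2⟩ := exists_wordHasType (n := m) (w := u ++ (i + 1) :: i :: (i + 1) :: v) (by
      intro j hj
      apply hr j
      simp at hj ⊢
      tauto)
    have h12 := h1.braid_rel hi h2
    constructor
    · intro hT
      rw [hT.unique h1, h12]
      exact h2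
    · intro hT
      rw [hT.unique h2, ← h12]
      exact h1

/-- Words with the same letters whose closures agree in all contexts. -/
def closureCon : Con (FreeMonoid ℕ) where
  -- Equality of the sets of letters carries the range condition over from one word to the other; it
  -- is used for symmetry, transitivity and products.
  r x y := (∀ i, i ∈ x.toList ↔ i ∈ y.toList) ∧
    ∀ (u v : List ℕ) (m : ℕ) (T : LinkType), (∀ i ∈ u ++ x.toList ++ v, i + 1 < m) →
      (WordHasType m (u ++ x.toList ++ v) T ↔ WordHasType m (u ++ y.toList ++ v) T)
  iseqv := by
    refine ⟨fun x => ⟨fun i => Iff.rfl, fun _ _ _ _ _ => Iff.rfl⟩, ?_, ?_⟩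
    · rintro x y ⟨h1, h2⟩
      refine ⟨fun i => (h1 i).symm, fun u v m T hm => (h2 u v m T ?_).symm⟩
      intro i hi
      apply hm i
      simp only [List.mem_append, h1] at hi ⊢
      exact hi
    · rintro x y z ⟨h1, h2⟩ ⟨h3, h4⟩
      refine ⟨fun i => (h1 i).trans (h3 i), fun u v m T hm =>
        (h2 u v m T hm).trans (h4 u v m T ?_)⟩
      intro i hi
      apply hm i
      simp only [List.mem_append, h1] at hi ⊢
      exact hi
  mul' := by
    rintro x y z t ⟨h1, h2⟩ ⟨h3, h4⟩
    refine ⟨fun i => ?_, fun u v m T hm => ?_⟩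
    · simp only [FreeMonoid.toList_mul, List.mem_append, h1, h3]
    · simp only [FreeMonoid.toList_mul] at hm ⊢
      have a1 := h2 u (z.toList ++ v) m T (by simpa [or_assoc] using hm)
      have a2 := h4 (u ++ y.toList) v m T (by
        intro i hi
        apply hm i
        simp only [List.mem_append, h1] at hi ⊢
        tauto)
      simp only [List.append_assoc] at a1 a2 ⊢
      exact a1.trans a2

/-- The congruence `closureCon` contains the braid relations, hence the congruence that they
generate. After this, closures can be rewritten by computing in the monoid `PosBraid`. -/
theorem closureCon_of_posBraid_eq {w w' : List ℕ} (h : posBraid w = posBraid w') :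
    closureCon (FreeMonoid.ofList w) (FreeMonoid.ofList w') := by
  have h' : conGen PosBraidRel (FreeMonoid.ofList w) (FreeMonoid.ofList w') := (Con.eq _).1 h
  refine (Con.conGen_le (c := closureCon)).2 ?_ h'
  intro x y hxy
  refine ⟨fun i => ?_, fun u v m T hm => WordHasType.rel_iff hxy hm⟩
  cases hxy with
  | comm i j h => simp; tauto
  | braid i => simp; tauto

theorem WordHasType.congr {m : ℕ} {w w' : List ℕ} {T : LinkType} (hT : WordHasType m w T)
    (hw : ∀ i ∈ w, i + 1 < m) (h : posBraid w = posBraid w') : WordHasType m w' T := by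
  have := ((closureCon_of_posBraid_eq h).2 [] [] m T (by simpa using hw)).1 (by simpa using hT)
  simpa using this

/-! ### Closures of braids that contain two Coxeter elements -/

/-- With C the product of the letters up to t, one has a_{t+1} C a_{t+1} = C a_{t+1} a_t: the left
factor a_{t+1} moves up to a_t, and the braid relation applies. -/
theorem posBraid_two_coxeter (t : ℕ) :
    posBraid (List.range (t + 2) ++ List.range (t + 2)) =
      posBraid (List.range (t + 1) ++ List.range (t + 1) ++ [t + 1, t]) := by
  have hc : ∀ s, s ≤ t → posBraid (List.range s) * posBraid [t + 1] =
      posBraid [t + 1] * posBraid (List.range s) := by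
    intro s
    induction s with
    | zero => intro _; exact (one_mul (posBraid [t + 1])).trans (mul_one (posBraid [t + 1])).symm
    | succ s ih =>
      intro hs
      rw [List.range_succ, posBraid_append, mul_assoc, posBraid_comm (by omega), ← mul_assoc,
        ih (by omega), mul_assoc]
  have hb := posBraid_braid t
  have h1 : posBraid [t + 1] * posBraid (List.range (t + 1)) * posBraid [t + 1] =
      posBraid (List.range (t + 1)) * (posBraid [t + 1] * posBraid [t]) := by
    rw [List.range_succ, posBraid_append, ← mul_assoc, ← hc t le_rfl, mul_assoc, mul_assoc,
      ← mul_assoc (posBraid [t + 1]), ← hb]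
    simp only [mul_assoc]
  rw [List.range_succ (n := t + 1)]
  have e : [t + 1, t] = [t + 1] ++ [t] := rfl
  rw [e]
  simp only [posBraid_append]
  rw [mul_assoc (posBraid (List.range (t + 1))) (posBraid (List.range (t + 1))), ← h1]
  simp only [mul_assoc]

/-- Each a_{t+1} on the right passes over a_{t+1} a_t and becomes a_t, so that a single a_{t+1}
remains. -/
theorem posBraid_slide_power (t q : ℕ) :
    posBraid ([t + 1, t] ++ List.replicate q (t + 1)) =
      posBraid (List.replicate q t ++ [t + 1, t]) := by
  have e : [t + 1, t] = [t + 1] ++ [t] := rfl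
  induction q with
  | zero => simp
  | succ q ih =>
    have e1 : [t + 1, t] ++ List.replicate (q + 1) (t + 1) =
        ([t + 1] ++ [t] ++ [t + 1]) ++ List.replicate q (t + 1) := by simp [List.replicate_succ]
    have e2 : List.replicate (q + 1) t ++ [t + 1, t] =
        [t] ++ (List.replicate q t ++ [t + 1, t]) := by simp [List.replicate_succ]
    rw [e1, e2, posBraid_append [t], ← ih, e]
    simp only [posBraid_append, ← mul_assoc]
    rw [← posBraid_braid t]

/-- If t + 1 is even, the other even letters are at most t - 1 and commute with it; if t + 1 is odd,
it does not occur in `w`. -/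
theorem posBraid_extract {t : ℕ} {w : List ℕ} (hw : ∀ i ∈ w, Even i ∧ i ≤ t + 1) :
    ∃ (c : ℕ) (w' : List ℕ), (∀ i ∈ w', Even i ∧ i ≤ t) ∧ c + w'.length = w.length ∧
      posBraid w = posBraid (List.replicate c (t + 1) ++ w') := by
  rcases Nat.even_or_odd (t + 1) with ht | ht
  · induction w with
    | nil => exact ⟨0, [], by simp, rfl, rfl⟩
    | cons i w ih =>
      obtain ⟨c, w', h1, h2, h3⟩ := ih fun j hj => hw j (List.mem_cons_of_mem _ hj)
      obtain ⟨hi, hit⟩ := hw i (by simp)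
      rw [← List.singleton_append, posBraid_append, h3]
      by_cases hi' : i = t + 1
      · refine ⟨c + 1, w', h1, by simp; omega, ?_⟩
        rw [← posBraid_append, hi', List.replicate_succ]
        rfl
      · have hit' : i + 2 ≤ t + 1 := by
          obtain ⟨a, ha⟩ := hi
          obtain ⟨b, hb⟩ := ht
          omega
        refine ⟨c, i :: w', ?_, by simp; omega, ?_⟩
        · intro j hj
          rcases List.mem_cons.1 hj with rfl | hj
          · exact ⟨hi, by omega⟩
          · exact h1 j hj
        · rw [← List.singleton_append (x := i) (l := w')]
          simp only [posBraid_append, ← mul_assoc]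
          congr 1
          clear h2 h3
          induction c with
          | zero => exact (mul_one (M := PosBraid) _ : _)
          | succ c ih =>
            rw [List.replicate_succ', posBraid_append, ← mul_assoc, ih, mul_assoc,
              posBraid_comm hit', mul_assoc]
  · refine ⟨0, w, fun i hi => ⟨(hw i hi).1, ?_⟩, by simp, rfl⟩
    have := hw i hi
    obtain ⟨⟨a, ha⟩, h⟩ := this
    obtain ⟨b, hb⟩ := ht
    omega

/-- The closure of two Coxeter elements times a product of commuting generators is a torus link on
two strands. -/
theorem WordHasType.two_coxeter (M : ℕ) : ∀ (q : ℕ) (w : List ℕ) (T : LinkType),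
    (∀ i ∈ w, Even i ∧ i ≤ M) →
    WordHasType (M + 2) (List.range (M + 1) ++ List.range (M + 1) ++ List.replicate q M ++ w) T →
    WordHasType 2 (List.replicate (M + 2 + q + w.length) 0) T := by
  induction M with
  | zero =>
    intro q w T hw hT
    convert hT using 1
    symm
    rw [List.eq_replicate_iff]
    constructor
    · simp; omega
    · intro i hi
      simp at hi
      rcases hi with h | h | h
      · exact h
      · exact h.2
      · have := (hw i h).2
        omega
  | succ M ih =>
    intro q w T hw hT
    obtain ⟨c, w', h1, h2, h3⟩ := posBraid_extract hw
    -- The `c` letters `M + 1` of `w` join the `q` that are already there. All of them slide over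
    -- a_{M+1} a_M and become a_M, so the last generator occurs once and can be destabilised.
    have hT' := hT.congr (w' := (List.range (M + 1) ++ List.range (M + 1) ++
      List.replicate (q + c) M) ++ (M + 1) :: (M :: w')) ?_ ?_
    · have h4 := hT'.destabilize ?_ ?_
      · have h5 := ih (q + c + 1) w' T h1 (by
          convert h4 using 1
          rw [List.replicate_succ']
          simp)
        convert h5 using 2
        omega
      · intro i hi
        simp at hi
        omega
      · intro i hi
        rcases List.mem_cons.1 hi with rfl | hi
        · omega
        · have := (h1 i hi).2
          omega
    · intro i hi
      simp at hi
      rcases hi with h | h | h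
      · omega
      · omega
      · have := (hw i h).2
        omega
    · rw [List.append_assoc, posBraid_append, posBraid_append _ w, h3, ← posBraid_append,
        posBraid_two_coxeter, ← posBraid_append]
      have e1 : List.range (M + 1) ++ List.range (M + 1) ++ [M + 1, M] ++
          (List.replicate q (M + 1) ++ (List.replicate c (M + 1) ++ w')) =
          List.range (M + 1) ++ List.range (M + 1) ++
            (([M + 1, M] ++ List.replicate (q + c) (M + 1)) ++ w') := by
        rw [List.replicate_add]
        simp only [List.append_assoc]
      rw [e1, posBraid_append, posBraid_append _ w', posBraid_slide_power, ← posBraid_append,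
        ← posBraid_append]
      simp

/-- The closure of a Coxeter element times a power of the first generator is a torus link on two
strands. -/
theorem WordHasType.one_coxeter (M : ℕ) : ∀ (c : ℕ) (T : LinkType),
    WordHasType (M + 2) (List.range (M + 1) ++ List.replicate c 0) T →
    WordHasType 2 (List.replicate (c + 1) 0) T := by
  induction M with
  | zero =>
    intro c T hT
    simpa [List.replicate_succ] using hT
  | succ M ih =>
    intro c T hT
    refine ih c T ?_
    -- The last generator of the Coxeter element occurs once, since all further letters are `0`.
    rw [List.range_succ, List.append_assoc, List.singleton_append] at hT
    refine hT.destabilize ?_ ?_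
    · intro i hi
      simpa using hi
    · intro i hi
      have := List.eq_of_mem_replicate hi
      omega

/-! ### Sequences of group elements that satisfy the braid relations -/

/-- The elements `a i` satisfy the braid relations of the generators, the cubic relations for
`i + 1 < K`. -/
structure IsBraidSeq {G : Type*} [Group G] (a : ℕ → G) (K : ℕ) : Prop where
  comm : ∀ i j, i + 2 ≤ j → Commute (a i) (a j)
  braid : ∀ i, i + 1 < K → a i * a (i + 1) * a i = a (i + 1) * a i * a (i + 1)

section BraidSeq

variable {G : Type*} [Group G] {a : ℕ → G} {K : ℕ}

def wordProd (a : ℕ → G) (w : List ℕ) : G := (w.map a).prod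

@[simp] theorem wordProd_nil : wordProd a [] = 1 := rfl

@[simp] theorem wordProd_cons (i : ℕ) (w : List ℕ) :
    wordProd a (i :: w) = a i * wordProd a w := by
  simp [wordProd]

@[simp] theorem wordProd_append (u v : List ℕ) :
    wordProd a (u ++ v) = wordProd a u * wordProd a v := by
  simp [wordProd]

/-- The product `a p ⋯ a (p + B - 1)`. -/
def ascend (a : ℕ → G) (p B : ℕ) : G := wordProd a (List.range' p B)

/-- The product `a (p + B - 1) ⋯ a p`. -/
def descend (a : ℕ → G) (p B : ℕ) : G := wordProd a (List.range' p B).reverse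

@[simp] theorem ascend_zero (p : ℕ) : ascend a p 0 = 1 := rfl

theorem ascend_succ (p B : ℕ) : ascend a p (B + 1) = ascend a p B * a (p + B) := by
  simp [ascend, List.range'_concat]

theorem ascend_succ' (p B : ℕ) : ascend a p (B + 1) = a p * ascend a (p + 1) B := by
  simp [ascend, List.range'_succ]

theorem ascend_add (p B C : ℕ) : ascend a p (B + C) = ascend a p B * ascend a (p + B) C := by
  rw [ascend, ascend, ascend, ← wordProd_append]
  congr 1
  simp

@[simp] theorem descend_zero (p : ℕ) : descend a p 0 = 1 := rfl

theorem descend_succ (p B : ℕ) : descend a p (B + 1) = a (p + B) * descend a p B := by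
  simp [descend, List.range'_concat]

theorem IsBraidSeq.comm' (h : IsBraidSeq a K) {i j : ℕ} (hij : i + 2 ≤ j ∨ j + 2 ≤ i) :
    Commute (a i) (a j) :=
  hij.elim (h.comm i j) fun h' => (h.comm j i h').symm

theorem IsBraidSeq.commute_wordProd (h : IsBraidSeq a K) {j : ℕ} {w : List ℕ}
    (hw : ∀ i ∈ w, i + 2 ≤ j ∨ j + 2 ≤ i) : Commute (a j) (wordProd a w) := by
  induction w with
  | nil => exact Commute.one_right _
  | cons i w ih =>
    rw [wordProd_cons]
    exact (h.comm' (hw i (by simp)).symm).mul_right (ih fun k hk => hw k (by simp [hk]))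

theorem IsBraidSeq.commute_words (h : IsBraidSeq a K) {u w : List ℕ}
    (hw : ∀ j ∈ u, ∀ i ∈ w, i + 2 ≤ j ∨ j + 2 ≤ i) : Commute (wordProd a u) (wordProd a w) := by
  induction u with
  | nil => exact Commute.one_left _
  | cons i u ih =>
    rw [wordProd_cons]
    exact (h.commute_wordProd (hw i (by simp))).mul_left (ih fun k hk => hw k (by simp [hk]))

theorem IsBraidSeq.commute_ascend (h : IsBraidSeq a K) {j p B : ℕ} (hj : j + 2 ≤ p ∨ p + B + 1 ≤ j) :
    Commute (a j) (ascend a p B) :=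
  h.commute_wordProd fun i hi => by
    rw [List.mem_range'_1] at hi
    omega

theorem IsBraidSeq.commute_descend (h : IsBraidSeq a K) {j p B : ℕ}
    (hj : j + 2 ≤ p ∨ p + B + 1 ≤ j) : Commute (a j) (descend a p B) :=
  h.commute_wordProd fun i hi => by
    rw [List.mem_reverse, List.mem_range'_1] at hi
    omega

/-- Only the two factors a_j a_{j+1} of the product fail to commute with a_j, and a_j a_{j+1} a_j =
a_{j+1} a_j a_{j+1} releases a_{j+1} on the left. All index shifts below come from this rule and its
mirror image `IsBraidSeq.mul_descend`. -/
theorem IsBraidSeq.ascend_mul (h : IsBraidSeq a K) {p B j : ℕ} (hp : p ≤ j) (hj : j + 1 < p + B)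
    (hK : p + B ≤ K) : ascend a p B * a j = a (j + 1) * ascend a p B := by
  induction B with
  | zero => omega
  | succ B ih =>
    rw [ascend_succ]
    by_cases hjB : j + 1 < p + B
    · rw [mul_assoc, (h.comm' (i := p + B) (j := j) (by omega)).eq, ← mul_assoc,
        ih hjB (by omega), mul_assoc]
    · obtain ⟨C, rfl⟩ : ∃ C, B = C + 1 := ⟨B - 1, by omega⟩
      obtain rfl : j = p + C := by omega
      have e : p + (C + 1) = p + C + 1 := by omega
      rw [ascend_succ, e, mul_assoc, mul_assoc, ← mul_assoc (a (p + C)), h.braid _ (by omega),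
        mul_assoc (a (p + C + 1)), ← mul_assoc (ascend a p C),
        ← (h.commute_ascend (j := p + C + 1) (p := p) (B := C) (by omega)).eq]
      simp only [mul_assoc]

theorem IsBraidSeq.mul_descend (h : IsBraidSeq a K) {p B j : ℕ} (hp : p ≤ j) (hj : j + 1 < p + B)
    (hK : p + B ≤ K) : a j * descend a p B = descend a p B * a (j + 1) := by
  induction B with
  | zero => omega
  | succ B ih =>
    rw [descend_succ]
    by_cases hjB : j + 1 < p + B
    · rw [← mul_assoc, ← (h.comm' (i := p + B) (j := j) (by omega)).eq, mul_assoc,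
        ih hjB (by omega), mul_assoc]
    · obtain ⟨C, rfl⟩ : ∃ C, B = C + 1 := ⟨B - 1, by omega⟩
      obtain rfl : j = p + C := by omega
      have e : p + (C + 1) = p + C + 1 := by omega
      rw [descend_succ, e, ← mul_assoc, ← mul_assoc, ← mul_assoc, h.braid _ (by omega), mul_assoc,
        (h.commute_descend (j := p + C + 1) (p := p) (B := C) (by omega)).eq]
      simp only [mul_assoc]

/-- Moving a shifted word over an ascending product. -/
theorem IsBraidSeq.ascend_mul_word (h : IsBraidSeq a K) {p B : ℕ} (hK : p + B ≤ K) {w : List ℕ}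
    (hw : ∀ i ∈ w, i + 1 < B) :
    ascend a p B * wordProd a (w.map (p + ·)) =
      wordProd a (w.map (p + 1 + ·)) * ascend a p B := by
  induction w with
  | nil => simp
  | cons i w ih =>
    have hi := hw i (by simp)
    rw [List.map_cons, List.map_cons, wordProd_cons, wordProd_cons, ← mul_assoc,
      h.ascend_mul (by omega) (by omega) hK, mul_assoc, ih fun k hk => hw k (by simp [hk]),
      mul_assoc, show p + i + 1 = p + 1 + i by omega]

theorem IsBraidSeq.word_mul_descend (h : IsBraidSeq a K) {p B : ℕ} (hK : p + B ≤ K) {w : List ℕ}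
    (hw : ∀ i ∈ w, i + 1 < B) :
    wordProd a (w.map (p + ·)) * descend a p B =
      descend a p B * wordProd a (w.map (p + 1 + ·)) := by
  induction w with
  | nil => simp
  | cons i w ih =>
    have hi := hw i (by simp)
    rw [List.map_cons, List.map_cons, wordProd_cons, wordProd_cons, mul_assoc,
      ih fun k hk => hw k (by simp [hk]), ← mul_assoc,
      h.mul_descend (by omega) (by omega) hK, mul_assoc, show p + i + 1 = p + 1 + i by omega]

/-! ### Powers of a Coxeter element -/

/-- The last strand is split off. A further factor C passes to the left of the descending product
and lowers its indices by one; its last letter a_M then extends the product at the top. -/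
theorem IsBraidSeq.ascend_succ_pow (h : IsBraidSeq a K) {M k : ℕ} (hk : k ≤ M + 1) (hM : M < K) :
    ascend a 0 (M + 1) ^ k = ascend a 0 M ^ k * descend a (M + 1 - k) k := by
  induction k with
  | zero => simp
  | succ k ih =>
    have e : M + 1 - k = M + 1 - (k + 1) + 1 := by omega
    obtain ⟨p, hp⟩ : ∃ p, p = M + 1 - (k + 1) := ⟨_, rfl⟩
    have key : ∀ C, C ≤ k → descend a (p + 1) C * ascend a 0 (M + 1) =
        ascend a 0 (M + 1) * descend a p C := by
      intro C
      induction C with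
      | zero => simp
      | succ C ihC =>
        intro hC
        rw [descend_succ, descend_succ, mul_assoc, ihC (by omega), ← mul_assoc,
          show p + 1 + C = p + C + 1 by omega,
          ← h.ascend_mul (by omega) (by omega) (by omega), mul_assoc]
    rw [pow_succ, ih (by omega), e, ← hp, mul_assoc, key k le_rfl, ascend_succ, descend_succ,
      show 0 + M = p + k by omega, pow_succ]
    simp only [mul_assoc]

/-- The product `∏ j < A, descend a j B`. -/
def descends (a : ℕ → G) (B : ℕ) : ℕ → G
  | 0 => 1
  | A + 1 => descends a B A * descend a A B

theorem IsBraidSeq.ascend_pow (h : IsBraidSeq a K) {A b : ℕ} (hK : A + b ≤ K) :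
    ascend a 0 (A + b) ^ (b + 1) = ascend a 0 b ^ (b + 1) * descends a (b + 1) A := by
  induction A with
  | zero => simp [descends]
  | succ A ih =>
    rw [show A + 1 + b = A + b + 1 by omega, h.ascend_succ_pow (by omega) (by omega), ih (by omega),
      descends, mul_assoc, show A + b + 1 - (b + 1) = A by omega]

/-- Two neighbouring strands are carried across `B` others, and a crossing between the two may be
made before or after. -/
theorem IsBraidSeq.mul_descend_descend (h : IsBraidSeq a K) {p B : ℕ} (hB : 0 < B)
    (hK : p + B + 1 ≤ K) :
    a (p + B) * (descend a p B * descend a (p + 1) B) =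
      descend a p B * descend a (p + 1) B * a p := by
  induction B with
  | zero => omega
  | succ B ih =>
    have e : descend a p (B + 1) * descend a (p + 1) (B + 1) =
        a (p + B) * a (p + B + 1) * (descend a p B * descend a (p + 1) B) := by
      rw [descend_succ, descend_succ, show p + 1 + B = p + B + 1 by omega, mul_assoc,
        ← mul_assoc (descend a p B),
        ← (h.commute_descend (j := p + B + 1) (p := p) (B := B) (by omega)).eq]
      simp only [mul_assoc]
    rw [e, ← add_assoc, ← mul_assoc, ← mul_assoc (a (p + B + 1)), ← h.braid _ (by omega)]
    rcases Nat.eq_zero_or_pos B with rfl | hB'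
    · simp
    · rw [mul_assoc (a (p + B) * a (p + B + 1)), ih hB' (by omega)]
      simp only [mul_assoc]

/-- Each a_{j+b+1} commutes with the rows before j, turns into a_j when it passes the rows j and j +
1, and commutes with all later rows. -/
theorem IsBraidSeq.mul_descends (h : IsBraidSeq a K) {A b j : ℕ} (hj : j + 1 < A)
    (hK : A + b ≤ K) :
    a (j + (b + 1)) * descends a (b + 1) A = descends a (b + 1) A * a j := by
  induction A with
  | zero => omega
  | succ A ih =>
    rw [descends]
    by_cases hjA : j + 1 < A
    · rw [← mul_assoc, ih hjA (by omega), mul_assoc, mul_assoc,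
        (h.commute_descend (j := j) (p := A) (B := b + 1) (by omega)).eq]
    · obtain rfl : A = j + 1 := by omega
      have hc : ∀ C, C ≤ j → Commute (a (j + (b + 1))) (descends a (b + 1) C) := by
        intro C
        induction C with
        | zero => intro _; exact Commute.one_right _
        | succ C ihC =>
          intro hC
          exact (ihC (by omega)).mul_right (h.commute_descend (by omega))
      rw [descends, mul_assoc (descends a (b + 1) j), ← mul_assoc, (hc j le_rfl).eq, mul_assoc,
        h.mul_descend_descend (by omega) (by omega)]
      simp only [mul_assoc]

/-- The product `∏ p < k, ascend a p B`, in decreasing order of `p`. -/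
def ascends (a : ℕ → G) (B : ℕ) : ℕ → G
  | 0 => 1
  | k + 1 => ascend a k B * ascends a B k

theorem IsBraidSeq.ascend_mul_ascend (h : IsBraidSeq a K) {N p B : ℕ} (hp : p + B < N)
    (hK : N ≤ K) : ascend a 0 N * ascend a p B = ascend a (p + 1) B * ascend a 0 N := by
  induction B with
  | zero => simp
  | succ B ih =>
    rw [ascend_succ, ascend_succ, ← mul_assoc, ih (by omega), mul_assoc,
      h.ascend_mul (by omega) (by omega) (by omega), mul_assoc,
      show p + 1 + B = p + B + 1 by omega]

/-- A power of a Coxeter element, split into the powers of two smaller ones. -/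
theorem IsBraidSeq.ascend_pow_add (h : IsBraidSeq a K) {A b k : ℕ} (hk : k ≤ A) (hK : A + b ≤ K) :
    ascend a 0 (A + b) ^ (b + 1 + k) =
      ascends a (b + 1) k * ascend a 0 b ^ (b + 1) * descends a (b + 1) A *
        ascend a 0 (A - 1) ^ k := by
  induction k with
  | zero => simp [ascends, h.ascend_pow hK]
  | succ k ih =>
    -- A new factor C raises every row by one. Its first `b + 1` letters become the new row 0; the
    -- other letters are left over on the right.
    have e1 : ∀ i, i ≤ k → ascend a 0 (A + b) * ascends a (b + 1) i =
        ascends a (b + 1) (i + 1) * ascend a (b + 1) (A - 1) := by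
      intro i
      induction i with
      | zero =>
        intro _
        rw [show A + b = b + 1 + (A - 1) by omega, ascend_add]
        simp [ascends]
      | succ i ih =>
        intro hi
        rw [ascends, ascends, ← mul_assoc, h.ascend_mul_ascend (by omega) hK, mul_assoc,
          ih (by omega), mul_assoc]
    -- The remaining letters start at `b + 1`, while the full twist uses only letters below `b`.
    have e2 : Commute (ascend a (b + 1) (A - 1)) (ascend a 0 b ^ (b + 1)) := by
      refine (h.commute_words ?_).pow_right _
      intro j hj i hi
      rw [List.mem_range'_1] at hi hj
      omega
    -- Passing the grid of descending rows, the remaining letters drop by `b + 1` and form the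
    -- Coxeter element of the smaller power.
    have e3 : ∀ C, C ≤ A - 1 → ascend a (b + 1) C * descends a (b + 1) A =
        descends a (b + 1) A * ascend a 0 C := by
      intro C
      induction C with
      | zero => simp
      | succ C ih =>
        intro hC
        rw [ascend_succ, ascend_succ, mul_assoc, show b + 1 + C = C + (b + 1) by omega,
          h.mul_descends (by omega) hK, ← mul_assoc, ih (by omega), mul_assoc, zero_add]
    rw [show b + 1 + (k + 1) = b + 1 + k + 1 by omega, pow_succ', ih (by omega), ← mul_assoc,
      ← mul_assoc, ← mul_assoc, e1 k le_rfl, mul_assoc (ascends a (b + 1) (k + 1)), e2.eq,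
      ← mul_assoc, mul_assoc _ (ascend a (b + 1) (A - 1)), e3 _ le_rfl, pow_succ' (ascend a 0 (A - 1))]
    simp only [mul_assoc]

/-! ### The full twist -/

/-- Moving all C to the right raises the indices of the letters a_0 in between: (a_0 C)^k = a_0 a_1
⋯ a_{k-1} C^k. For k = N the initial product is one more C. -/
theorem IsBraidSeq.fullTwist_eq (h : IsBraidSeq a K) {N : ℕ} (hN : N ≤ K) :
    (a 0 * ascend a 0 N) ^ N = ascend a 0 N ^ (N + 1) := by
  have key : ∀ k, k ≤ N → (a 0 * ascend a 0 N) ^ k = ascend a 0 k * ascend a 0 N ^ k := by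
    intro k
    induction k with
    | zero => simp
    | succ k ih =>
      intro hk
      have e : ascend a 0 N * ascend a 0 k = ascend a 1 k * ascend a 0 N := by
        exact h.ascend_mul_ascend (by omega) hN
      rw [pow_succ', ih (by omega), ascend_succ', pow_succ', mul_assoc (a 0), ← mul_assoc _ _ (_ ^ k), e]
      simp only [mul_assoc, zero_add]
  rw [key N le_rfl, pow_succ']

/-- The full twist is a power of C and also of a_0 C, so it commutes with a_0; the other generators
are conjugates of a_0 by powers of C. -/
theorem IsBraidSeq.commute_fullTwist (h : IsBraidSeq a K) {N j : ℕ} (hN : N ≤ K) (hj : j < N) :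
    Commute (ascend a 0 N ^ (N + 1)) (a j) := by
  have h1 : Commute (ascend a 0 N ^ (N + 1)) (ascend a 0 N) := (Commute.refl _).pow_left _
  have h2 : Commute (ascend a 0 N ^ (N + 1)) (a 0 * ascend a 0 N) := by
    rw [← h.fullTwist_eq hN]
    exact (Commute.refl _).pow_left _
  induction j with
  | zero => simpa using h2.mul_right h1.inv_right
  | succ j ih =>
    have e : a (j + 1) = ascend a 0 N * a j * (ascend a 0 N)⁻¹ := by
      rw [h.ascend_mul (Nat.zero_le _) (by omega) (by omega)]
      simp
    rw [e]
    exact (h1.mul_right (ih (by omega))).mul_right h1.inv_right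

theorem IsBraidSeq.commute_fullTwist_word (h : IsBraidSeq a K) {N : ℕ} (hN : N ≤ K) {w : List ℕ}
    (hw : ∀ i ∈ w, i < N) : Commute (ascend a 0 N ^ (N + 1)) (wordProd a w) := by
  induction w with
  | nil => exact Commute.one_right _
  | cons i w ih =>
    rw [wordProd_cons]
    exact (h.commute_fullTwist hN (hw i (by simp))).mul_right (ih fun k hk => hw k (by simp [hk]))

/-- The square of a Coxeter element of type `B`. -/
theorem IsBraidSeq.pole_pow (h : IsBraidSeq a K) {N k : ℕ} (hk : k + 1 ≤ N) (hN : N ≤ K) :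
    (a 0 * ascend a 0 N * a (N - 1)) ^ k =
      (a 0 * ascend a 0 N) ^ k * ascend a (N - k) k := by
  -- A letter a_{j+1} with j ≥ 1 commutes with a_0 and passes C, so it leaves a_0 C as a_j.
  have hs : ∀ k, k + 2 ≤ N → a (N - 1) * (a 0 * ascend a 0 N) ^ k =
      (a 0 * ascend a 0 N) ^ k * a (N - 1 - k) := by
    intro k
    induction k with
    | zero => simp
    | succ k ih =>
      intro hk
      obtain ⟨j, hj⟩ : ∃ j, N - 1 - (k + 1) = j := ⟨_, rfl⟩
      have e : a (j + 1) * (a 0 * ascend a 0 N) = a 0 * ascend a 0 N * a j := by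
        rw [mul_assoc, h.ascend_mul (Nat.zero_le _) (by omega) (by omega), ← mul_assoc, ← mul_assoc,
          (h.comm 0 (j + 1) (by omega)).eq]
      rw [pow_succ, ← mul_assoc, ih (by omega), show N - 1 - k = j + 1 by omega, mul_assoc, e, hj]
      simp only [mul_assoc]
  induction k with
  | zero => simp
  | succ k ih =>
    obtain ⟨j, hj⟩ : ∃ j, N - (k + 1) = j := ⟨_, rfl⟩
    rw [pow_succ', ih (by omega), mul_assoc (a 0 * ascend a 0 N), ← mul_assoc (a (N - 1)),
      hs k (by omega), pow_succ', hj, ascend_succ', show N - k = j + 1 by omega,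
      show N - 1 - k = j by omega]
    simp only [mul_assoc]

end BraidSeq

/-! ### Deleting letters and counting even letters -/

section Reduction

variable {G : Type*} [Group G] {a : ℕ → G} {K : ℕ}

/-- `y` is obtained from `x` by deleting a letter of a word for `x`. -/
def DeletesLetter (a : ℕ → G) (x y : G) : Prop :=
  ∃ (u v : List ℕ) (i : ℕ), wordProd a (u ++ i :: v) = x ∧ wordProd a (u ++ v) = y

def Reduces (a : ℕ → G) : G → G → Prop := Relation.ReflTransGen (DeletesLetter a)

theorem DeletesLetter.mul {x y : G} (h : DeletesLetter a x y) (s t : List ℕ) :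
    DeletesLetter a (wordProd a s * x * wordProd a t) (wordProd a s * y * wordProd a t) := by
  obtain ⟨u, v, i, rfl, rfl⟩ := h
  exact ⟨s ++ u, v ++ t, i, by simp [mul_assoc], by simp [mul_assoc]⟩

theorem Reduces.mul_words {x y : G} (h : Reduces a x y) (s t : List ℕ) :
    Reduces a (wordProd a s * x * wordProd a t) (wordProd a s * y * wordProd a t) := by
  induction h with
  | refl => exact .refl
  | tail _ h ih => exact Relation.ReflTransGen.tail ih (h.mul s t)

theorem Reduces.trans {x y z : G} (h : Reduces a x y) (h' : Reduces a y z) : Reduces a x z :=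
  Relation.ReflTransGen.trans h h'

/-- Reductions are multiplied by words only, so in a product the factor that is not being reduced
must be written as a word. -/
theorem Reduces.exists_word {x : G} {w : List ℕ} (h : Reduces a x (wordProd a w)) :
    ∃ w', x = wordProd a w' := by
  rcases Relation.ReflTransGen.cases_head h with rfl | ⟨y, ⟨u, v, i, rfl, -⟩, -⟩
  · exact ⟨w, rfl⟩
  · exact ⟨_, rfl⟩

theorem reduces_of_sublist {w w' : List ℕ} (h : w'.Sublist w) :
    Reduces a (wordProd a w) (wordProd a w') := by
  induction h with
  | slnil => exact .refl
  | cons i h ih => exact Relation.ReflTransGen.head ⟨[], _, i, rfl, rfl⟩ ih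
  | cons_cons i h ih => simpa using ih.mul_words [i] []

/-- `x` can be reduced to a word of `n` letters, all of which are even and less than `K`. -/
def Keeps (a : ℕ → G) (K : ℕ) (x : G) (n : ℕ) : Prop :=
  ∃ w : List ℕ, (∀ i ∈ w, Even i ∧ i < K) ∧ w.length = n ∧ Reduces a x (wordProd a w)

theorem Keeps.one : Keeps a K 1 0 := ⟨[], by simp, rfl, .refl⟩

theorem Keeps.mul {x y : G} {m n : ℕ} (hx : Keeps a K x m) (hy : Keeps a K y n) :
    Keeps a K (x * y) (m + n) := by
  obtain ⟨u, hu, rfl, h1⟩ := hx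
  obtain ⟨v, hv, rfl, h2⟩ := hy
  refine ⟨u ++ v, ?_, by simp, ?_⟩
  · intro i hi
    rcases List.mem_append.1 hi with hi | hi
    · exact hu i hi
    · exact hv i hi
  · obtain ⟨y', rfl⟩ := h2.exists_word
    have h3 := h1.mul_words [] y'
    have h4 := h2.mul_words u []
    simp only [wordProd_nil, one_mul, mul_one] at h3 h4
    rw [wordProd_append]
    exact h3.trans h4

theorem Keeps.of_reduces {x y : G} {n : ℕ} (h : Reduces a x y) (hy : Keeps a K y n) :
    Keeps a K x n := by
  obtain ⟨w, hw, hn, h2⟩ := hy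
  exact ⟨w, hw, hn, h.trans h2⟩

theorem Keeps.mono {x : G} {m n : ℕ} (hx : Keeps a K x n) (h : m ≤ n) : Keeps a K x m := by
  obtain ⟨w, hw, rfl, h1⟩ := hx
  exact ⟨w.take m, fun i hi => hw i (List.mem_of_mem_take hi), by simpa using h,
    h1.trans (reduces_of_sublist (List.take_sublist m w))⟩

theorem keeps_word {w : List ℕ} (hw : ∀ i ∈ w, Even i ∧ i < K) :
    Keeps a K (wordProd a w) w.length :=
  ⟨w, hw, rfl, .refl⟩

theorem keeps_letter {i n : ℕ} (hi : i < K) (hn : n = (i + 1) % 2) : Keeps a K (a i) n := by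
  have h : Reduces a (a i) 1 := by
    have := reduces_of_sublist (a := a) (List.nil_sublist [i])
    simpa using this
  rcases Nat.even_or_odd i with he | ho
  · have := keeps_word (a := a) (K := K) (w := [i]) (by simp [he, hi])
    have hn' : n = 1 := by
      obtain ⟨b, hb⟩ := he
      omega
    rw [hn']
    simpa using this
  · have hn' : n = 0 := by
      obtain ⟨b, hb⟩ := ho
      omega
    rw [hn']
    exact Keeps.of_reduces h .one

/-- The number of even integers among `p, …, p + B - 1`. -/
def evenCount (p B : ℕ) : ℕ := (B + 1 - p % 2) / 2

theorem keeps_ascend {p B : ℕ} (hK : p + B ≤ K) : Keeps a K (ascend a p B) (evenCount p B) := by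
  induction B with
  | zero =>
    rw [ascend_zero, show evenCount p 0 = 0 by simp only [evenCount]; omega]
    exact .one
  | succ B ih =>
    rw [ascend_succ]
    have := (ih (by omega)).mul (keeps_letter (a := a) (K := K) (i := p + B) (by omega) rfl)
    refine this.mono ?_
    simp only [evenCount]
    omega

theorem keeps_descend {p B : ℕ} (hK : p + B ≤ K) : Keeps a K (descend a p B) (evenCount p B) := by
  induction B with
  | zero =>
    rw [descend_zero, show evenCount p 0 = 0 by simp only [evenCount]; omega]
    exact .one
  | succ B ih =>
    rw [descend_succ]
    have := (keeps_letter (a := a) (K := K) (i := p + B) (by omega) rfl).mul (ih (by omega))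
    refine this.mono ?_
    simp only [evenCount]
    omega

def evenCounts (B : ℕ) : ℕ → ℕ
  | 0 => 0
  | k + 1 => evenCounts B k + evenCount k B

/-- Two consecutive rows contain `B` even letters in total. For odd `B` the rows starting at an even
index have one even letter more than the others; the parity term records this surplus and makes the
induction work. -/
theorem le_evenCounts (B k : ℕ) : k * B + (k % 2) * (B % 2) ≤ 2 * evenCounts B k := by
  induction k with
  | zero => simp
  | succ k ih =>
    rw [evenCounts, evenCount, Nat.succ_mul]
    rcases Nat.mod_two_eq_zero_or_one k with h | h
    · rw [h] at ih ⊢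
      rw [show (k + 1) % 2 = 1 by omega]
      omega
    · rw [h] at ih ⊢
      rw [show (k + 1) % 2 = 0 by omega]
      omega

/-! ### Interleaving layers with ascending and descending products -/

section Layers

variable {E O : List ℕ} {B : ℕ}

/-- Layers that alternate between the word `E` of even and the word `O` of odd letters. -/
def layer (E O : List ℕ) (i : ℕ) : List ℕ := if i % 2 = 0 then E else O

def leftLayers (a : ℕ → G) (E O : List ℕ) : ℕ → G
  | 0 => wordProd a (layer E O 0)
  | k + 1 => wordProd a (layer E O (k + 1)) * leftLayers a E O k

def rightLayers (a : ℕ → G) (E O : List ℕ) : ℕ → G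
  | 0 => 1
  | k + 1 => rightLayers a E O k * wordProd a (layer E O (k + 1))

theorem layer_add_two (i : ℕ) : layer E O (i + 2) = layer E O i := by
  simp [layer]

theorem mul_mul_pow_mul (x y : G) (n : ℕ) : x * (y * x) ^ n * y = (x * y) ^ (n + 1) := by
  induction n with
  | zero => simp
  | succ n ih =>
    rw [pow_succ (x * y), ← ih, pow_succ]
    simp only [mul_assoc]

/-- The product is w_k ⋯ w_1 w_0 w_1 ⋯ w_{k+1} with alternating layers: 2k + 2 factors that begin
with w_k. So the parity of `k` decides which kind of layer comes first. -/
theorem leftLayers_mul_rightLayers (k : ℕ) : leftLayers a E O k * rightLayers a E O (k + 1) =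
    (wordProd a (layer E O k) * wordProd a (layer E O (k + 1))) ^ (k + 1) := by
  induction k with
  | zero => simp [leftLayers, rightLayers]
  | succ k ih =>
    rw [leftLayers, rightLayers, mul_assoc, ← mul_assoc (leftLayers a E O k), ih, layer_add_two,
      ← mul_assoc, mul_mul_pow_mul]

/-- The i-th layer consists of letters of the parity of `i`, so its shift by `i` is even and no
letter is lost. -/
theorem keeps_shifted_layer {i : ℕ} (hE : ∀ j ∈ E, Even j ∧ j + 1 < B)
    (hO : ∀ j ∈ O, ¬ Even j ∧ j + 1 < B) (hK : i + B ≤ K + 1) :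
    Keeps a K (wordProd a ((layer E O i).map (i + ·))) (layer E O i).length := by
  have := keeps_word (a := a) (K := K) (w := (layer E O i).map (i + ·)) ?_
  · simpa using this
  · intro j hj
    rw [List.mem_map] at hj
    obtain ⟨j, hj, rfl⟩ := hj
    simp only [layer] at hj
    split_ifs at hj with hi
    · obtain ⟨h1, h2⟩ := hE j hj
      exact ⟨(Nat.even_iff.2 hi).add h1, by omega⟩
    · obtain ⟨h1, h2⟩ := hO j hj
      rw [Nat.not_even_iff_odd] at h1
      exact ⟨(Nat.odd_iff.2 (by omega)).add_odd h1, by omega⟩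

theorem layer_lt {i : ℕ} (hE : ∀ j ∈ E, Even j ∧ j + 1 < B) (hO : ∀ j ∈ O, ¬ Even j ∧ j + 1 < B) :
    ∀ j ∈ layer E O i, j + 1 < B := by
  intro j hj
  simp only [layer] at hj
  split_ifs at hj with hi
  · exact (hE j hj).2
  · exact (hO j hj).2

theorem IsBraidSeq.ascends_mul_word (h : IsBraidSeq a K) {w : List ℕ} (hw : ∀ j ∈ w, j + 1 < B) :
    ∀ k, k + B ≤ K + 1 → ascends a B k * wordProd a w =
      wordProd a (w.map (k + ·)) * ascends a B k := by
  intro k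
  induction k with
  | zero => simp [ascends]
  | succ k ih =>
    intro hK
    rw [ascends, mul_assoc, ih (by omega), ← mul_assoc, h.ascend_mul_word (by omega) hw, mul_assoc]

theorem IsBraidSeq.word_mul_descends (h : IsBraidSeq a K) {w : List ℕ}
    (hw : ∀ j ∈ w, j + 1 < B) : ∀ k, k + B ≤ K + 1 → wordProd a w * descends a B k =
      descends a B k * wordProd a (w.map (k + ·)) := by
  intro k
  induction k with
  | zero => simp [descends]
  | succ k ih =>
    intro hK
    rw [descends, ← mul_assoc, ih (by omega), mul_assoc, h.word_mul_descend (by omega) hw, mul_assoc]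

/-- The layer w_k crosses all `k` ascending rows to the left and is shifted by `k`; the next layer
crosses one row fewer. Thus rows and shifted layers alternate, and of the rows the even letters are
kept. -/
theorem IsBraidSeq.keeps_left (h : IsBraidSeq a K) (hE : ∀ j ∈ E, Even j ∧ j + 1 < B)
    (hO : ∀ j ∈ O, ¬ Even j ∧ j + 1 < B) : ∀ k, k + B ≤ K + 1 →
    Keeps a K (ascends a B k * leftLayers a E O k)
      (evenCounts B k + ∑ i ∈ Finset.range (k + 1), (layer E O i).length) := by
  intro k
  induction k with
  | zero =>
    intro hK
    have := keeps_shifted_layer (a := a) (i := 0) hE hO hK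
    simpa [ascends, leftLayers, evenCounts] using this
  | succ k ih =>
    intro hK
    have e : ascends a B (k + 1) * leftLayers a E O (k + 1) =
        wordProd a ((layer E O (k + 1)).map (k + 1 + ·)) * (ascend a k B *
          (ascends a B k * leftLayers a E O k)) := by
      rw [leftLayers, ← mul_assoc, h.ascends_mul_word (layer_lt hE hO) _ hK, ascends]
      simp only [mul_assoc]
    rw [e]
    refine ((keeps_shifted_layer hE hO hK).mul
      ((keeps_ascend (by omega)).mul (ih (by omega)))).mono ?_
    rw [evenCounts, Finset.sum_range_succ _ (k + 1)]
    omega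

theorem IsBraidSeq.keeps_right (h : IsBraidSeq a K) (hE : ∀ j ∈ E, Even j ∧ j + 1 < B)
    (hO : ∀ j ∈ O, ¬ Even j ∧ j + 1 < B) : ∀ k, k + B ≤ K + 1 →
    Keeps a K (rightLayers a E O k * descends a B k)
      (evenCounts B k + ∑ i ∈ Finset.range k, (layer E O (i + 1)).length) := by
  intro k
  induction k with
  | zero =>
    intro hK
    simpa [descends, rightLayers, evenCounts] using Keeps.one
  | succ k ih =>
    intro hK
    have e : rightLayers a E O (k + 1) * descends a B (k + 1) =
        (rightLayers a E O k * descends a B k) * (descend a k B *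
          wordProd a ((layer E O (k + 1)).map (k + 1 + ·))) := by
      rw [rightLayers, mul_assoc, h.word_mul_descends (layer_lt hE hO) _ hK, descends]
      simp only [mul_assoc]
    rw [e]
    refine ((ih (by omega)).mul ((keeps_descend (by omega)).mul
      (keeps_shifted_layer hE hO hK))).mono ?_
    rw [evenCounts, Finset.sum_range_succ]
    omega

/-- Rows beyond the `k` that take up layers contribute only their own even letters. -/
theorem IsBraidSeq.keeps_right_of_le (h : IsBraidSeq a K) (hE : ∀ j ∈ E, Even j ∧ j + 1 < B)
    (hO : ∀ j ∈ O, ¬ Even j ∧ j + 1 < B) {k A : ℕ} (hA : k ≤ A) (hK : A + B ≤ K + 1) :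
    Keeps a K (rightLayers a E O k * descends a B A)
      (evenCounts B A + ∑ i ∈ Finset.range k, (layer E O (i + 1)).length) := by
  induction A, hA using Nat.le_induction with
  | base => exact h.keeps_right hE hO k hK
  | succ A hA ih =>
    rw [descends, ← mul_assoc]
    refine ((ih (by omega)).mul (keeps_descend (by omega))).mono ?_
    rw [evenCounts]
    omega

theorem sum_layers (k : ℕ) : ∑ i ∈ Finset.range (k + 1), (layer E O i).length +
    ∑ i ∈ Finset.range (k + 1), (layer E O (i + 1)).length = (k + 1) * (E.length + O.length) := by
  induction k with
  | zero => simp [layer]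
  | succ k ih =>
    rw [Finset.sum_range_succ _ (k + 1), Finset.sum_range_succ _ (k + 1), layer_add_two,
      Nat.succ_mul (k + 1), ← ih]
    have : (layer E O (k + 1)).length + (layer E O k).length = E.length + O.length := by
      simp only [layer]
      split_ifs <;> omega
    omega

/-- The reduction of a power of a Coxeter element by means of a reduction of a smaller full twist
to alternating layers. -/
theorem IsBraidSeq.keeps_pow (h : IsBraidSeq a K) {A b k r : ℕ}
    (hE : ∀ j ∈ E, Even j ∧ j < b) (hO : ∀ j ∈ O, ¬ Even j ∧ j < b) (hk : k + 1 ≤ A)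
    (hK : A + b ≤ K)
    (hD : Reduces a (ascend a 0 b ^ (b + 1))
      ((wordProd a (layer E O k) * wordProd a (layer E O (k + 1))) ^ (k + 1)))
    (hr : Keeps a K (ascend a 0 (A - 1) ^ k) r) :
    Keeps a K (ascend a 0 (A + b) ^ (b + 1 + k)) (r + evenCounts (b + 1) k + evenCounts (b + 1) A +
      (k + 1) * (E.length + O.length)) := by
  have hE' : ∀ j ∈ E, Even j ∧ j + 1 < b + 1 := fun j hj => ⟨(hE j hj).1, by have := hE j hj; omega⟩
  have hO' : ∀ j ∈ O, ¬ Even j ∧ j + 1 < b + 1 := fun j hj =>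
    ⟨(hO j hj).1, by have := hO j hj; omega⟩
  rw [h.ascend_pow_add (by omega) hK]
  -- The twist is replaced by the alternating layers; their left half is woven into the ascending
  -- rows and their right half into the descending ones.
  have e : Reduces a (ascends a (b + 1) k * ascend a 0 b ^ (b + 1) * descends a (b + 1) A)
      ((ascends a (b + 1) k * leftLayers a E O k) *
        (rightLayers a E O (k + 1) * descends a (b + 1) A)) := by
    rw [← leftLayers_mul_rightLayers] at hD
    have e1 : ∀ k, ∃ w, ascends a (b + 1) k = wordProd a w := by
      intro k
      induction k with
      | zero => exact ⟨[], rfl⟩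
      | succ k ih =>
        obtain ⟨w, hw⟩ := ih
        exact ⟨List.range' k (b + 1) ++ w, by rw [ascends, hw, wordProd_append]; rfl⟩
    have e2 : ∀ k, ∃ w, descends a (b + 1) k = wordProd a w := by
      intro k
      induction k with
      | zero => exact ⟨[], rfl⟩
      | succ k ih =>
        obtain ⟨w, hw⟩ := ih
        exact ⟨w ++ (List.range' k (b + 1)).reverse, by rw [descends, hw, wordProd_append]; rfl⟩
    obtain ⟨u, hu⟩ := e1 k
    obtain ⟨v, hv⟩ := e2 A
    rw [hu, hv]
    convert hD.mul_words u v using 1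
    simp only [mul_assoc]
  have h1 := Keeps.of_reduces e ((h.keeps_left hE' hO' k (by omega)).mul
    (h.keeps_right_of_le hE' hO' hk (by omega)))
  refine (h1.mul hr).mono ?_
  rw [← sum_layers]
  omega

end Layers

end Reduction

/-! ### Bipartite forms of the full twist -/

section Poles

variable {G : Type*} [Group G] {a : ℕ → G} {K : ℕ}

/-- The letters less than `j` of the parity of `j - 1`, where `0` is taken twice. -/
def poleLayer : ℕ → List ℕ
  | 0 => []
  | 1 => [0, 0]
  | j + 2 => (j + 1) :: poleLayer j

theorem mem_poleLayer : ∀ {j i : ℕ}, i ∈ poleLayer j → i < j ∧ (i + j) % 2 = 1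
  | 0, i, h => by simp [poleLayer] at h
  | 1, i, h => by
    simp [poleLayer] at h
    omega
  | j + 2, i, h => by
    simp only [poleLayer, List.mem_cons] at h
    rcases h with rfl | h
    · omega
    · have := mem_poleLayer h
      omega

theorem length_poleLayer (j : ℕ) : (poleLayer j).length + (poleLayer (j + 1)).length = j + 2 := by
  induction j with
  | zero => rfl
  | succ j ih =>
    simp only [poleLayer, List.length_cons]
    omega

/-- The letters a_{j+1} and a_{j+2} that follow the two layers are brought to the front cyclically
and enlarge the layers. Repetition turns the linear order 0, 0, 1, …, N into the bipartite one. -/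
theorem IsBraidSeq.rotate_layers (h : IsBraidSeq a K) (j n : ℕ) :
    ascend a (j + 1) (n + 2) * (wordProd a (poleLayer j) * wordProd a (poleLayer (j + 1))) =
      wordProd a (poleLayer (j + 2)) * wordProd a (poleLayer (j + 3)) * ascend a (j + 3) n := by
  have hc : ∀ i, j + 2 ≤ i → ∀ k, k ≤ j + 1 → Commute (a i) (wordProd a (poleLayer k)) := by
    intro i hi k hk
    refine h.commute_wordProd fun l hl => ?_
    have := (mem_poleLayer hl).1
    omega
  have hasc : ∀ k, k ≤ j + 1 → Commute (ascend a (j + 3) n) (wordProd a (poleLayer k)) := by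
    intro k hk
    refine h.commute_words fun i hi l hl => ?_
    rw [List.mem_range'_1] at hi
    have := (mem_poleLayer hl).1
    omega
  rw [ascend_succ', ascend_succ', poleLayer, poleLayer, wordProd_cons, wordProd_cons]
  rw [mul_assoc (a (j + 1)), mul_assoc (a (j + 1 + 1)),
    ((hasc j (by omega)).mul_right (hasc (j + 1) le_rfl)).eq, ← mul_assoc (a (j + 1 + 1)),
    ← mul_assoc (a (j + 1 + 1)), (hc (j + 1 + 1) (by omega) j (by omega)).eq]
  simp only [mul_assoc]

/-- Cyclic rotation is a conjugation, which does not affect a power that commutes with the rotated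
factor. -/
theorem pow_mul_swap {D x y : G} {n : ℕ} (hD : Commute D x) (h : (x * y) ^ n = D) :
    (y * x) ^ n = D := by
  have e : y * x = x⁻¹ * (x * y) * x⁻¹⁻¹ := by simp
  rw [e, conj_pow, h, mul_assoc, inv_inv, hD.eq, inv_mul_cancel_left]

theorem ascend_zero_eq_layers (N : ℕ) : wordProd a (poleLayer 0) * wordProd a (poleLayer 1) *
    ascend a 1 N = a 0 * ascend a 0 (N + 1) := by
  rw [ascend_succ']
  simp [poleLayer, mul_assoc]

theorem ascend_one_eq_layers (N : ℕ) : wordProd a (poleLayer 1) * wordProd a (poleLayer 2) *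
    ascend a 2 N = a 0 * ascend a 0 (N + 2) := by
  rw [ascend_succ', ascend_succ']
  simp [poleLayer, mul_assoc]

theorem IsBraidSeq.commute_fullTwist_layer (h : IsBraidSeq a K) {N j : ℕ} (hN : N ≤ K) (hj : j ≤ N) :
    Commute (ascend a 0 N ^ (N + 1)) (wordProd a (poleLayer j)) :=
  h.commute_fullTwist_word hN fun i hi => by
    have := (mem_poleLayer hi).1
    omega

/-- A bipartite square root of the full twist. -/
theorem IsBraidSeq.layers_pow (h : IsBraidSeq a K) {N : ℕ} (hN : N + 1 ≤ K) :
    (wordProd a (poleLayer N) * wordProd a (poleLayer (N + 1))) ^ (N + 1) =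
      ascend a 0 (N + 1) ^ (N + 1 + 1) := by
  have key : ∀ n j, j + n = N → (wordProd a (poleLayer j) * wordProd a (poleLayer (j + 1)) *
      ascend a (j + 1) n) ^ (N + 1) = ascend a 0 (N + 1) ^ (N + 1 + 1) := by
    intro n j
    -- A rotation raises `j` by two, so both `j = 0` and `j = 1` are needed as starting points; the
    -- product is a_0 C in both cases.
    induction j using Nat.twoStepInduction generalizing n with
    | zero =>
      intro hj
      obtain rfl : n = N := by omega
      rw [ascend_zero_eq_layers, h.fullTwist_eq hN]
    | one =>
      intro hj
      rw [ascend_one_eq_layers, show n + 2 = N + 1 by omega, h.fullTwist_eq hN]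
    | more j ih _ =>
      intro hj
      rw [← h.rotate_layers j n]
      refine pow_mul_swap ?_ (ih (n + 2) (by omega))
      exact (h.commute_fullTwist_layer hN (by omega)).mul_right
        (h.commute_fullTwist_layer hN (by omega))
  simpa using key 0 N rfl

/-- Deleting the two letters `0` from a word for the full twist yields a power of `c`. -/
def TwistState (a : ℕ → G) (N e : ℕ) (τ c : G) : Prop :=
  ∃ u q : List ℕ, ascend a 0 (N + 1) ^ (N + 1 + 1) =
      τ ^ e * wordProd a q * (a 0 * a 0) * wordProd a u ∧
    τ ^ e * wordProd a q * wordProd a u = c ^ N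

/-- Conjugation by `z` fixes the full twist, which commutes with `z`. It rotates τ = z r to r z at
the cost of one power of τ, and leaves the pair a_0 a_0 to be deleted untouched. -/
theorem TwistState.rotate (h : IsBraidSeq a K) {N e : ℕ} (hN : N + 1 ≤ K) {z r : List ℕ} {c : G}
    (hz : ∀ i ∈ z, i < N + 1)
    (hs : TwistState a N (e + 1) (wordProd a z * wordProd a r) c) :
    TwistState a N e (wordProd a r * wordProd a z) ((wordProd a z)⁻¹ * c * wordProd a z) := by
  obtain ⟨u, q, h1, h2⟩ := hs
  have hc := h.commute_fullTwist_word hN hz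
  have e1 : (wordProd a z * wordProd a r) ^ (e + 1) =
      wordProd a z * (wordProd a r * wordProd a z) ^ e * wordProd a r :=
    (mul_mul_pow_mul _ _ _).symm
  refine ⟨u ++ z, r ++ q, ?_, ?_⟩
  · have : ascend a 0 (N + 1) ^ (N + 1 + 1) =
        (wordProd a z)⁻¹ * (ascend a 0 (N + 1) ^ (N + 1 + 1)) * wordProd a z := by
      rw [mul_assoc, hc.eq, inv_mul_cancel_left]
    rw [this, h1, e1]
    simp [mul_assoc]
  · rw [show (wordProd a z)⁻¹ * c * wordProd a z =
      (wordProd a z)⁻¹ * c * (wordProd a z)⁻¹⁻¹ by simp, conj_pow, ← h2, e1]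
    simp [mul_assoc]

theorem TwistState.reduces {N e : ℕ} {t : List ℕ} {c : G} (hs : TwistState a N e (wordProd a t) c) :
    Reduces a (ascend a 0 (N + 1) ^ (N + 1 + 1)) (c ^ N) := by
  obtain ⟨u, q, h1, h2⟩ := hs
  have hpow : ∃ p, wordProd a t ^ e = wordProd a p := by
    clear h1 h2
    induction e with
    | zero => exact ⟨[], by simp⟩
    | succ e ih =>
      obtain ⟨p, hp⟩ := ih
      exact ⟨p ++ t, by rw [pow_succ, hp, wordProd_append]⟩
  obtain ⟨p, hp⟩ := hpow
  rw [h1, ← h2, hp]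
  have := reduces_of_sublist (a := a) (w := p ++ q ++ [0, 0] ++ u) (w' := p ++ q ++ u) (by simp)
  simpa [mul_assoc] using this

/-- The layers reached from the full twist by deleting two letters. -/
theorem IsBraidSeq.twistState_layers (h : IsBraidSeq a K) {N : ℕ} (hN : N + 1 ≤ K) :
    ∃ e, (1 ≤ N → 1 ≤ e) ∧ TwistState a N e
      (wordProd a (poleLayer N) * wordProd a (poleLayer (N + 1)))
      (wordProd a (poleLayer N) * wordProd a (poleLayer (N + 1)) * a N) := by
  -- The full twist is (a_0 C)^N · a_0 a_0 · a_1 ⋯ a_N. Without the pair a_0 a_0 this is (a_0 C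
  -- a_N)^N, by `IsBraidSeq.pole_pow`.
  have start : TwistState a N N (a 0 * ascend a 0 (N + 1)) (a 0 * ascend a 0 (N + 1) * a N) := by
    refine ⟨List.range' 1 N, [], ?_, ?_⟩
    · rw [← h.fullTwist_eq hN, pow_succ, ascend_succ']
      simp [ascend, mul_assoc]
    · have := h.pole_pow (k := N) le_rfl hN
      rw [show N + 1 - 1 = N by omega, show N + 1 - N = 1 by omega] at this
      rw [this]
      simp [ascend]
  have key : ∀ n j, j + n = N → TwistState a N (N - j / 2)
      (wordProd a (poleLayer j) * wordProd a (poleLayer (j + 1)) * ascend a (j + 1) n)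
      (wordProd a (poleLayer j) * wordProd a (poleLayer (j + 1)) * ascend a (j + 1) n * a N) := by
    intro n j
    induction j using Nat.twoStepInduction generalizing n with
    | zero =>
      intro hj
      obtain rfl : n = N := by omega
      rw [ascend_zero_eq_layers]
      exact start
    | one =>
      intro hj
      rw [ascend_one_eq_layers, show n + 2 = N + 1 by omega]
      exact start
    | more j ih _ =>
      intro hj
      rw [← h.rotate_layers j n]
      have h1 := ih (n + 2) (by omega)
      have hc : ∀ k, k ≤ j + 1 → Commute (a N) (wordProd a (poleLayer k)) := by
        intro k hk
        refine h.commute_wordProd fun l hl => ?_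
        have := (mem_poleLayer hl).1
        omega
      rw [show N - j / 2 = N - (j + 2) / 2 + 1 by omega, ← wordProd_append, ascend] at h1
      have h2 := h1.rotate h hN (by
        intro i hi
        rcases List.mem_append.1 hi with hi | hi
        · have := (mem_poleLayer hi).1; omega
        · have := (mem_poleLayer hi).1; omega)
      have hc' := (hc j (by omega)).mul_right (hc (j + 1) le_rfl)
      rw [← wordProd_append] at hc' ⊢
      simp only [mul_assoc, inv_mul_cancel_left, hc'.eq] at h2 ⊢
      exact h2
  -- The rotations lead from `j = 0` or `j = 1` to `j = N` and use `N / 2` of the `N` powers. For `N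
  -- ≥ 1` at least one is left, which a further rotation can use.
  refine ⟨N - N / 2, by omega, ?_⟩
  simpa using key 0 N rfl

/-- Here the letter N is doubled as well as the letter 0. The exponent is thus one less than in
`IsBraidSeq.layers_pow`, for the price of two letters. One more rotation gives the opposite order of
the layers. -/
theorem IsBraidSeq.reduces_two_poles (h : IsBraidSeq a K) {N : ℕ} (hN1 : 1 ≤ N) (hN : N + 1 ≤ K) :
    Reduces a (ascend a 0 (N + 1) ^ (N + 1 + 1))
      ((wordProd a (poleLayer N) * wordProd a (poleLayer (N + 1) ++ [N])) ^ N) ∧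
    Reduces a (ascend a 0 (N + 1) ^ (N + 1 + 1))
      ((wordProd a (poleLayer (N + 1) ++ [N]) * wordProd a (poleLayer N)) ^ N) := by
  obtain ⟨e, he, hs⟩ := h.twistState_layers hN
  constructor
  · have h1 := hs
    rw [← wordProd_append] at h1
    have := h1.reduces
    simpa [mul_assoc] using this
  · obtain ⟨e, rfl⟩ : ∃ e', e = e' + 1 := ⟨e - 1, by have := he hN1; omega⟩
    have h1 := hs.rotate h hN fun i hi => by
      have := (mem_poleLayer hi).1; omega
    rw [← wordProd_append] at h1
    have := h1.reduces
    simpa [mul_assoc] using this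

/-- Which of the two layers is even depends on the parity of `b`, and which comes first depends on
the parity of `i`; so both orders have to be admitted. -/
theorem exists_layer_words {X Y : List ℕ} {b : ℕ} (hX : ∀ i ∈ X, i < b ∧ (i + b) % 2 = 0)
    (hY : ∀ i ∈ Y, i < b ∧ (i + b) % 2 = 1) :
    ∃ E O : List ℕ, (∀ j ∈ E, Even j ∧ j < b) ∧ (∀ j ∈ O, ¬ Even j ∧ j < b) ∧
      E.length + O.length = X.length + Y.length ∧
      ∀ i, (layer E O i = X ∧ layer E O (i + 1) = Y) ∨
        (layer E O i = Y ∧ layer E O (i + 1) = X) := by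
  rcases Nat.mod_two_eq_zero_or_one b with hb | hb
  · refine ⟨X, Y, ?_, ?_, rfl, ?_⟩
    · intro j hj
      have := hX j hj
      rw [Nat.even_iff]
      omega
    · intro j hj
      have := hY j hj
      rw [Nat.even_iff]
      omega
    · intro i
      simp only [layer]
      rcases Nat.mod_two_eq_zero_or_one i with hi | hi
      · rw [if_pos hi, if_neg (by omega)]; simp
      · rw [if_neg (by omega), if_pos (by omega)]; simp
  · refine ⟨Y, X, ?_, ?_, by omega, ?_⟩
    · intro j hj
      have := hY j hj
      rw [Nat.even_iff]
      omega
    · intro j hj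
      have := hX j hj
      rw [Nat.even_iff]
      omega
    · intro i
      simp only [layer]
      rcases Nat.mod_two_eq_zero_or_one i with hi | hi
      · rw [if_pos hi, if_neg (by omega)]; simp
      · rw [if_neg (by omega), if_pos (by omega)]; simp

/-- Weaving requires `k + 1` pairs of layers, and the bipartite form of the full twist with `b`
generators has `b` pairs; hence `b = k + 1`. All (k + 1)(k + 2) letters of the twist are kept. -/
theorem IsBraidSeq.keeps_pow_one_pole (h : IsBraidSeq a K) {A k r : ℕ} (hk : k + 1 ≤ A)
    (hK : A + (k + 1) ≤ K) (hr : Keeps a K (ascend a 0 (A - 1) ^ k) r) :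
    Keeps a K (ascend a 0 (A + (k + 1)) ^ (k + 1 + 1 + k)) (r + evenCounts (k + 2) k +
      evenCounts (k + 2) A + (k + 1) * (k + 2)) := by
  obtain ⟨E, O, hE, hO, hl, hEO⟩ := exists_layer_words (X := poleLayer k) (Y := poleLayer (k + 1))
    (b := k + 1) (fun i hi => by have := mem_poleLayer hi; omega)
    (fun i hi => by have := mem_poleLayer hi; omega)
  have h1 := h.layers_pow (N := k) (by omega)
  have h2 : (wordProd a (poleLayer (k + 1)) * wordProd a (poleLayer k)) ^ (k + 1) =
      ascend a 0 (k + 1) ^ (k + 1 + 1) :=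
    pow_mul_swap (h.commute_fullTwist_layer (by omega) (by omega)) h1
  rw [length_poleLayer] at hl
  have key := h.keeps_pow hE hO hk hK ?_ hr
  · rwa [hl] at key
  rcases hEO k with ⟨e1, e2⟩ | ⟨e1, e2⟩
  · rw [e1, e2, h1]; exact .refl
  · rw [e1, e2, h2]; exact .refl

/-- With two poles a full twist with `b` generators gives `b - 1` pairs, so `b = k + 2`. This
provides the other parity of the exponent and loses only two letters of the twist. -/
theorem IsBraidSeq.keeps_pow_two_poles (h : IsBraidSeq a K) {A k r : ℕ} (hk : k + 1 ≤ A)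
    (hK : A + (k + 2) ≤ K) (hr : Keeps a K (ascend a 0 (A - 1) ^ k) r) :
    Keeps a K (ascend a 0 (A + (k + 2)) ^ (k + 2 + 1 + k)) (r + evenCounts (k + 3) k +
      evenCounts (k + 3) A + (k + 1) * (k + 4)) := by
  obtain ⟨E, O, hE, hO, hl, hEO⟩ := exists_layer_words (X := poleLayer (k + 1))
    (Y := poleLayer (k + 2) ++ [k + 1]) (b := k + 2)
    (fun i hi => by have := mem_poleLayer hi; omega)
    (fun i hi => by
      rcases List.mem_append.1 hi with hi | hi
      · have := mem_poleLayer hi; omega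
      · rw [List.mem_singleton] at hi; omega)
  obtain ⟨h1, h2⟩ := h.reduces_two_poles (N := k + 1) (by omega) (by omega)
  have hl' := length_poleLayer (k + 1)
  have hl2 : E.length + O.length = k + 4 := by
    rw [hl, List.length_append, List.length_singleton]
    exact congrArg (· + 1) hl'
  have key := h.keeps_pow hE hO hk hK ?_ hr
  · rwa [hl2] at key
  rcases hEO k with ⟨e1, e2⟩ | ⟨e1, e2⟩
  · rw [e1, e2]; exact h1
  · rw [e1, e2]; exact h2

end Poles

/-! ### Reductions of powers of Coxeter elements -/

section Extraction

/-- A word `i :: v'` in braid-equivalent form is sought for the word `v`; the result is `v'`. The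
first argument bounds the depth of the recursion. -/
def extractLetter : ℕ → ℕ → List ℕ → Option (List ℕ)
  | 0, _, _ => none
  | _ + 1, _, [] => none
  | f + 1, i, j :: v =>
    if i = j then some v
    else if i + 2 ≤ j ∨ j + 2 ≤ i then (extractLetter f i v).map (j :: ·)
    else (extractLetter f i v).bind fun v' => (extractLetter f j v').map fun v'' => j :: i :: v''

/-- The letters of the first word are extracted one by one from the second. -/
def extractsTo (f : ℕ) : List ℕ → List ℕ → Bool
  | [], v => v.isEmpty
  | i :: u, v => match extractLetter f i v with
    | none => false
    | some v' => extractsTo f u v'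

variable {G : Type*} [Group G] {a : ℕ → G} {K : ℕ}

theorem IsBraidSeq.wordProd_extractLetter (h : IsBraidSeq a K) {f : ℕ} : ∀ {i : ℕ} {v v' : List ℕ},
    i < K → (∀ j ∈ v, j < K) → extractLetter f i v = some v' →
    wordProd a v = a i * wordProd a v' ∧ ∀ j ∈ v', j < K := by
  induction f with
  | zero =>
    intro i v v' _ _ he
    simp [extractLetter] at he
  | succ f ih =>
    intro i v v' hi hv he
    cases v with
    | nil => simp [extractLetter] at he
    | cons j v =>
      have hj : j < K := hv j (by simp)
      have hv2 : ∀ j ∈ v, j < K := fun k hk => hv k (by simp [hk])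
      rw [extractLetter] at he
      split_ifs at he with h1 h2
      · simp only [Option.some.injEq] at he
        subst h1 he
        exact ⟨wordProd_cons _ _, hv2⟩
      · rw [Option.map_eq_some_iff] at he
        obtain ⟨v2, he, rfl⟩ := he
        obtain ⟨e1, e2⟩ := ih hi hv2 he
        refine ⟨?_, by simpa using ⟨hj, e2⟩⟩
        rw [wordProd_cons, wordProd_cons, e1, ← mul_assoc, ← mul_assoc, (h.comm' h2).eq]
      -- For neighbouring letters, j v can begin with i here only by way of j i j = i j i: the
      -- search extracts i from v, and then j from the rest.
      · rw [Option.bind_eq_some_iff] at he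
        obtain ⟨v2, he, he'⟩ := he
        rw [Option.map_eq_some_iff] at he'
        obtain ⟨v3, he', rfl⟩ := he'
        obtain ⟨e1, e2⟩ := ih hi hv2 he
        obtain ⟨e3, e4⟩ := ih hj e2 he'
        refine ⟨?_, by simpa using ⟨hj, hi, e4⟩⟩
        have hb : a j * a i * a j = a i * a j * a i := by
          rcases (by omega : j = i + 1 ∨ i = j + 1) with rfl | rfl
          · exact (h.braid i hj).symm
          · exact h.braid j hi
        simp only [wordProd_cons, e1, e3, ← mul_assoc, hb]

theorem IsBraidSeq.wordProd_eq_of_extractsTo (h : IsBraidSeq a K) {f : ℕ} : ∀ {u v : List ℕ},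
    (∀ i ∈ u, i < K) → (∀ i ∈ v, i < K) → extractsTo f u v = true →
    wordProd a v = wordProd a u := by
  intro u
  induction u with
  | nil =>
    intro v _ _ he
    rw [extractsTo, List.isEmpty_iff] at he
    rw [he]
  | cons i u ih =>
    intro v hu hv he
    rw [extractsTo] at he
    split at he
    · simp at he
    · next v' hv' =>
      obtain ⟨e1, e2⟩ := h.wordProd_extractLetter (hu i (by simp)) hv hv'
      rw [e1, wordProd_cons, ih (fun k hk => hu k (by simp [hk])) e2 he]

theorem ascend_pow_eq_wordProd (N q : ℕ) :
    ascend a 0 N ^ q = wordProd a (List.replicate q (List.range N)).flatten := by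
  induction q with
  | zero => simp
  | succ q ih =>
    rw [pow_succ', ih, List.replicate_succ, List.flatten_cons, wordProd_append, ascend,
      List.range_eq_range']

/-- The word `w` is another expression for the power, chosen to have many even letters; its odd
letters are deleted. -/
theorem IsBraidSeq.keeps_of_extractsTo (h : IsBraidSeq a K) {N q f n : ℕ} {w : List ℕ}
    (hN : N ≤ K) (hw : ∀ i ∈ w, i < N)
    (he : extractsTo f w (List.replicate q (List.range N)).flatten = true)
    (hn : (w.filter (· % 2 == 0)).length = n) : Keeps a K (ascend a 0 N ^ q) n := by
  rw [ascend_pow_eq_wordProd, h.wordProd_eq_of_extractsTo (u := w) _ _ he]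
  · refine ⟨w.filter (· % 2 == 0), ?_, hn, reduces_of_sublist List.filter_sublist⟩
    intro i hi
    rw [List.mem_filter] at hi
    exact ⟨Nat.even_iff.2 (by simpa using hi.2), (hw i hi.1).trans_le hN⟩
  · exact fun i hi => (hw i hi).trans_le hN
  · intro i hi
    simp only [List.mem_flatten, List.mem_replicate] at hi
    obtain ⟨l, ⟨-, rfl⟩, hi⟩ := hi
    exact (List.mem_range.1 hi).trans_le hN

/-- For this power and the next two, the recursion with two poles yields 6, 7 and 19 letters, in
each case one less than the final bounds require. -/
theorem IsBraidSeq.keeps_cube_three (h : IsBraidSeq a K) (hK : 3 ≤ K) :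
    Keeps a K (ascend a 0 3 ^ 3) 7 :=
  h.keeps_of_extractsTo (f := 40) (w := [0, 0, 1, 0, 0, 2, 1, 0, 2]) hK (by decide)
    (by decide +kernel) (by decide)

theorem IsBraidSeq.keeps_cube_four (h : IsBraidSeq a K) (hK : 4 ≤ K) :
    Keeps a K (ascend a 0 4 ^ 3) 8 :=
  h.keeps_of_extractsTo (f := 40) (w := [0, 0, 2, 1, 0, 2, 3, 2, 1, 2, 2, 3]) hK (by decide)
    (by decide +kernel) (by decide)

theorem IsBraidSeq.keeps_fifth_six (h : IsBraidSeq a K) (hK : 6 ≤ K) :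
    Keeps a K (ascend a 0 6 ^ 5) 21 :=
  h.keeps_of_extractsTo (f := 40) (w := [0, 0, 2, 2, 4, 3, 2, 4, 1, 0, 2, 3, 2, 2, 4, 1, 2, 2, 3,
    2, 2, 4, 5, 4, 3, 2, 4, 1, 2, 3]) hK (by decide) (by decide +kernel) (by decide)

theorem mul_le_evenCounts (B k : ℕ) : k * B ≤ 2 * evenCounts B k :=
  (Nat.le_add_right _ _).trans (le_evenCounts B k)

/-- Reductions of the torus braids of type `(m + 2, m)`. -/
theorem IsBraidSeq.keeps_coxeter_pow (h : IsBraidSeq a K) : ∀ m : ℕ, m + 1 ≤ K →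
    ∃ r, 2 * (m + 2) * (m + 2) + 2 ≤ 3 * r + 6 * (m + 2) ∧
      Keeps a K (ascend a 0 (m + 1) ^ m) r := by
  intro m
  induction m using Nat.strong_induction_on with
  | _ m ih =>
    intro hK
    rcases (by omega : m = 0 ∨ m = 1 ∨ m = 3 ∨ m = 5 ∨ m = m / 2 * 2 ∧ m ≠ 0 ∨
        m = m / 2 * 2 + 1 ∧ 7 ≤ m) with rfl | rfl | rfl | rfl | ⟨hm, h0⟩ | ⟨hm, h0⟩
    · exact ⟨0, by norm_num, by simpa using Keeps.one⟩
    · exact ⟨1, by norm_num, by simpa [evenCount] using keeps_ascend (a := a) (p := 0) (B := 2) hK⟩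
    · exact ⟨8, by norm_num, h.keeps_cube_four hK⟩
    · exact ⟨21, by norm_num, h.keeps_fifth_six hK⟩
    · obtain ⟨k, rfl⟩ : ∃ k, m = 2 * k + 2 := ⟨m / 2 - 1, by omega⟩
      obtain ⟨r, hr, hr'⟩ := ih k (by omega) (by omega)
      -- The smaller power has `k + 1` generators and exponent `k`, so it is again of the type (k +
      -- 2, k).
      have hs := h.keeps_pow_one_pole (A := k + 2) (k := k) (by omega) (by omega) hr'
      rw [show k + 2 + (k + 1) = 2 * k + 2 + 1 by omega,
        show k + 1 + 1 + k = 2 * k + 2 by omega] at hs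
      refine ⟨_, ?_, hs⟩
      have h1 := mul_le_evenCounts (k + 2) k
      have h2 := mul_le_evenCounts (k + 2) (k + 2)
      -- The bound r ≥ (2n² - 6n + 2)/3 for n strands reproduces itself exactly under this step.
      nlinarith
    · obtain ⟨k, rfl⟩ : ∃ k, m = 2 * k + 3 := ⟨m / 2 - 1, by omega⟩
      obtain ⟨r, hr, hr'⟩ := ih k (by omega) (by omega)
      have hs := h.keeps_pow_two_poles (A := k + 2) (k := k) (by omega) (by omega) hr'
      rw [show k + 2 + (k + 2) = 2 * k + 3 + 1 by omega,
        show k + 2 + 1 + k = 2 * k + 3 by omega] at hs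
      refine ⟨_, ?_, hs⟩
      have h1 := mul_le_evenCounts (k + 3) k
      have h2 := mul_le_evenCounts (k + 3) (k + 2)
      -- For `k = 2` the real estimate falls just short; integrality of `r` and of the counts of
      -- even letters closes the gap.
      rcases (by omega : k = 2 ∨ 3 ≤ k) with rfl | h3
      · omega
      · nlinarith

/-- Reductions of the torus braids of type `(m + 2, m + 1)`. -/
theorem IsBraidSeq.keeps_coxeter_pow_succ (h : IsBraidSeq a K) : ∀ m : ℕ, m + 1 ≤ K →
    ∃ r, 2 * (m + 2) * (m + 2) + 3 ≤ 3 * r + 4 * (m + 2) ∧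
      Keeps a K (ascend a 0 (m + 1) ^ (m + 1)) r := by
  intro m
  induction m using Nat.strong_induction_on with
  | _ m ih =>
    intro hK
    rcases (by omega : m = 0 ∨ m = 1 ∨ m = 2 ∨ m = m / 2 * 2 + 1 ∧ 3 ≤ m ∨
        m = m / 2 * 2 ∧ 4 ≤ m) with rfl | rfl | rfl | ⟨hm, h0⟩ | ⟨hm, h0⟩
    · exact ⟨1, by norm_num, by simpa [evenCount] using keeps_ascend (a := a) (p := 0) (B := 1) hK⟩
    -- The case below the range of the recursion: with `k = 0` the smaller power is trivial.
    · have hs := h.keeps_pow_one_pole (A := 1) (k := 0) (r := 0) le_rfl hK (by simpa using Keeps.one)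
      exact ⟨_, by simp [evenCounts, evenCount], hs⟩
    · exact ⟨7, by norm_num, h.keeps_cube_three hK⟩
    · obtain ⟨k, rfl⟩ : ∃ k, m = 2 * k + 3 := ⟨m / 2 - 1, by omega⟩
      obtain ⟨r, hr, hr'⟩ := ih k (by omega) (by omega)
      -- With `k + 1` layers in place of `k`, the smaller power has `k + 1` generators and exponent
      -- `k + 1`, again of the type (k + 2, k + 1).
      have hs := h.keeps_pow_one_pole (A := k + 2) (k := k + 1) (by omega) (by omega) hr'
      rw [show k + 2 + (k + 1 + 1) = 2 * k + 3 + 1 by omega,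
        show k + 1 + 1 + 1 + (k + 1) = 2 * k + 3 + 1 by omega] at hs
      refine ⟨_, ?_, hs⟩
      have h1 := mul_le_evenCounts (k + 1 + 2) (k + 1)
      have h2 := mul_le_evenCounts (k + 1 + 2) (k + 2)
      nlinarith
    · obtain ⟨k, rfl⟩ : ∃ k, m = 2 * k + 4 := ⟨m / 2 - 2, by omega⟩
      obtain ⟨r, hr, hr'⟩ := ih k (by omega) (by omega)
      have hs := h.keeps_pow_two_poles (A := k + 2) (k := k + 1) (by omega) (by omega) hr'
      rw [show k + 2 + (k + 1 + 2) = 2 * k + 4 + 1 by omega,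
        show k + 1 + 2 + 1 + (k + 1) = 2 * k + 4 + 1 by omega] at hs
      refine ⟨_, ?_, hs⟩
      have h1 := mul_le_evenCounts (k + 1 + 3) (k + 1)
      have h2 := mul_le_evenCounts (k + 1 + 3) (k + 2)
      nlinarith

end Extraction

/-! ### Torus links -/

/-- The standard generators of the braid group, continued by `1`. -/
def braidGen (m i : ℕ) : BraidGroup m :=
  if h : i < m - 1 then PresentedGroup.of ⟨i, h⟩ else 1

theorem isBraidSeq_braidGen (m : ℕ) : IsBraidSeq (braidGen m) (m - 1) where
  comm i j hij := by
    by_cases hj : j < m - 1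
    · have hi : i < m - 1 := by omega
      rw [Commute, SemiconjBy, braidGen, braidGen, dif_pos hi, dif_pos hj, ← mul_inv_eq_one]
      exact PresentedGroup.one_of_mem (rels := braidRelators m) (.inr ⟨⟨i, hi⟩, ⟨j, hj⟩, hij, rfl⟩)
    -- The default value 1 commutes with everything, so commutation holds for all indices. The cubic
    -- relation would fail at the boundary, hence the bound `m - 1`.
    · rw [braidGen, braidGen, dif_neg hj]
      exact Commute.one_right _
  braid i hi := by
    have hi' : i < m - 1 := by omega
    rw [braidGen, braidGen, dif_pos hi', dif_pos hi, ← mul_inv_eq_one]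
    exact PresentedGroup.one_of_mem (rels := braidRelators m)
      (.inl ⟨⟨i, hi'⟩, ⟨i + 1, hi⟩, rfl, rfl⟩)

theorem wordProd_braidGen {m : ℕ} (w : PosWord m) :
    wordProd (braidGen m) (w.map Fin.val) = w.braid := by
  simp only [wordProd, PosWord.braid, List.map_map]
  congr 2
  funext i
  simp [braidGen]

theorem exists_posWord {m : ℕ} {w : List ℕ} (hw : ∀ i ∈ w, i < m - 1) :
    ∃ v : PosWord m, v.map Fin.val = w := by
  lift w to List {i // i < m - 1} using hw
  exact ⟨w.map fun i => ⟨i.1, i.2⟩, by simp [Function.comp_def]⟩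

theorem exists_posWord_braid {m : ℕ} (w : List ℕ) :
    ∃ v : PosWord m, v.braid = wordProd (braidGen m) w := by
  induction w with
  | nil => exact ⟨[], rfl⟩
  | cons i w ih =>
    obtain ⟨v, hv⟩ := ih
    by_cases hi : i < m - 1
    · refine ⟨⟨i, hi⟩ :: v, ?_⟩
      rw [wordProd_cons, ← hv, braidGen, dif_pos hi]
      simp [PosWord.braid]
    · exact ⟨v, by rw [wordProd_cons, ← hv, braidGen, dif_neg hi, one_mul]⟩

/-- A letter out of range represents 1, and its deletion does not change the braid. -/
theorem DeletesLetter.eq_or_deletesGenerator {m : ℕ} {x y : BraidGroup m}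
    (h : DeletesLetter (braidGen m) x y) : x = y ∨ DeletesGenerator x y := by
  obtain ⟨u, v, i, rfl, rfl⟩ := h
  obtain ⟨u', hu⟩ := exists_posWord_braid (m := m) u
  obtain ⟨v', hv⟩ := exists_posWord_braid (m := m) v
  rw [wordProd_append, wordProd_append, wordProd_cons, ← hu, ← hv]
  by_cases hi : i < m - 1
  · refine .inr ⟨u', v', ⟨i, hi⟩, ?_, ?_⟩
    · simp [PosWord.braid, braidGen, hi]
    · simp [PosWord.braid]
  · exact .inl (by rw [braidGen, dif_neg hi, one_mul])

theorem Reduces.deletesGenerator {m : ℕ} {x y : BraidGroup m} (h : Reduces (braidGen m) x y) :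
    Relation.ReflTransGen DeletesGenerator x y := by
  induction h with
  | refl => exact .refl
  | tail _ h ih =>
    rcases h.eq_or_deletesGenerator with rfl | h
    · exact ih
    · exact ih.tail h

theorem PosWord.isPositiveBraid_braid {m : ℕ} (w : PosWord m) : IsPositiveBraid w.braid := by
  refine Submonoid.list_prod_mem _ fun x hx => ?_
  rw [List.mem_map] at hx
  obtain ⟨i, -, rfl⟩ := hx
  exact Submonoid.subset_closure ⟨i, rfl⟩

theorem map_val_torusWord (p q : ℕ) :
    ((List.replicate q (List.finRange (p - 1))).flatten).map Fin.val =
      (List.replicate q (List.range (p - 1))).flatten := by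
  rw [List.map_flatten, List.map_replicate, List.map_coe_finRange_eq_range]

theorem wordHasType_torusLink_two (n : ℕ) :
    WordHasType 2 (List.replicate n 0) (torusLink 2 n) := by
  have := wordHasType_closure 2 (List.replicate n (List.finRange (2 - 1))).flatten
  rw [map_val_torusWord] at this
  have e : (List.replicate n (List.range (2 - 1))).flatten = List.replicate n 0 := by
    simp [List.range_succ]
  rwa [e] at this

/-- A reduction to a word whose closure is a two-strand torus link shows adjacency. -/
theorem subwordAdjacent_of_reduces {m q n : ℕ} (hm : 0 < m) {w : List ℕ}
    (hw : ∀ i ∈ w, i < m - 1)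
    (hr : Reduces (braidGen m) (ascend (braidGen m) 0 (m - 1) ^ q) (wordProd (braidGen m) w))
    (hT : ∀ T, WordHasType m w T → WordHasType 2 (List.replicate n 0) T) :
    SubwordAdjacent (torusLink 2 n) (torusLink m q) := by
  obtain ⟨v, rfl⟩ := exists_posWord hw
  have e : ascend (braidGen m) 0 (m - 1) ^ q =
      PosWord.braid (n := m) (List.replicate q (List.finRange (m - 1))).flatten := by
    rw [ascend_pow_eq_wordProd, ← wordProd_braidGen, map_val_torusWord]
  rw [e, wordProd_braidGen] at hr
  exact ⟨m, hm, _, _, v.isPositiveBraid_braid, PosWord.isPositiveBraid_braid _,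
    ⟨v, rfl, (hT _ (wordHasType_closure m v)).unique (wordHasType_torusLink_two n)⟩,
    ⟨_, rfl, rfl⟩, hr.deletesGenerator⟩

/-- One factor C is kept, and a letter a_0 from each of `n - 1` others. On one strand every closure
is the unknot, which is T_{2,1}. -/
theorem subwordAdjacent_torusLink_of_le {m q n : ℕ} (hm : 0 < m) (hn : 0 < n) (hnq : n ≤ q)
    (hmn : m = 1 → n = 1) : SubwordAdjacent (torusLink 2 n) (torusLink m q) := by
  obtain ⟨c, rfl⟩ : ∃ c, n = c + 1 := ⟨n - 1, by omega⟩
  rcases (by omega : m = 1 ∨ 2 ≤ m) with rfl | hm2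
  · obtain rfl : c = 0 := by have := hmn rfl; omega
    refine subwordAdjacent_of_reduces (w := []) hm (by simp) ?_ fun T hT => ?_
    · simp only [Nat.sub_self, ascend_zero, one_pow, wordProd_nil]
      exact Relation.ReflTransGen.refl
    · have h1 := (wordHasType_torusLink_two 1).destabilize (m := 0) (u := []) (v := [])
        (by simp) (by simp)
      rw [hT.unique h1]
      exact wordHasType_torusLink_two 1
  · obtain ⟨M, rfl⟩ : ∃ M, m = M + 2 := ⟨m - 2, by omega⟩
    refine subwordAdjacent_of_reduces (w := List.range (M + 1) ++ List.replicate c 0) hm ?_ ?_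
      fun T hT => WordHasType.one_coxeter M c T hT
    · intro i hi
      simp only [List.mem_append, List.mem_range, List.mem_replicate] at hi
      omega
    · rw [ascend_pow_eq_wordProd]
      refine reduces_of_sublist ?_
      obtain ⟨d, rfl⟩ : ∃ d, q = d + 1 := ⟨q - 1, by omega⟩
      rw [List.replicate_succ, List.flatten_cons]
      refine List.Sublist.append (List.Sublist.refl _) ?_
      have hs : (List.replicate c 0).Sublist (List.replicate d 0) :=
        (List.replicate_sublist_replicate 0).2 (by omega)
      refine hs.trans ?_
      clear hs hnq
      induction d with
      | zero => simp
      | succ d ih =>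
        rw [List.replicate_succ, List.replicate_succ, List.flatten_cons]
        exact List.Sublist.append (l₁ := [0]) (List.singleton_sublist.2 (by simp)) ih

/-- Two factors C stay intact, and the even letters of the remaining power are cut down to exactly
`N`. -/
theorem subwordAdjacent_torusLink_of_keeps {M q N r : ℕ} (hN : N ≤ r)
    (hr : Keeps (braidGen (M + 2)) (M + 1) (ascend (braidGen (M + 2)) 0 (M + 1) ^ q) r) :
    SubwordAdjacent (torusLink 2 (M + 2 + N)) (torusLink (M + 2) (q + 2)) := by
  obtain ⟨w, hw, rfl, hr⟩ := hr.mono hN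
  refine subwordAdjacent_of_reduces (w := List.range (M + 1) ++ List.range (M + 1) ++ w)
    (by omega) ?_ ?_ fun T hT => ?_
  · intro i hi
    simp only [List.mem_append, List.mem_range] at hi
    rcases hi with hi | hi
    · omega
    · exact (hw i hi).2
  · rw [show q + 2 = 2 + q by omega, pow_add, wordProd_append]
    have := hr.mul_words (List.range (M + 1) ++ List.range (M + 1)) []
    have e : wordProd (braidGen (M + 2)) (List.range (M + 1) ++ List.range (M + 1)) =
        ascend (braidGen (M + 2)) 0 (M + 1) ^ 2 := by
      rw [wordProd_append, sq, ascend, List.range_eq_range']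
    rw [wordProd_nil, mul_one, mul_one, e] at this
    rw [e]
    exact this
  · exact WordHasType.two_coxeter M 0 w T (fun i hi => ⟨(hw i hi).1, by have := (hw i hi).2; omega⟩)
      (by simpa using hT)

theorem proposition5p7 :
    (∀ m n : ℕ, 0 < m → 0 < n → (n : ℝ) ≤ (2 * (m : ℝ) ^ 2 + 4) / 3 - m →
      SubwordAdjacent (torusLink 2 n) (torusLink m m)) ∧
    (∀ m n : ℕ, 0 < m → 0 < n → (m, n) ≠ (1, 2) →
      (n : ℝ) ≤ (2 * (m : ℝ) ^ 2 - m + 5) / 3 →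
      SubwordAdjacent (torusLink 2 n) (torusLink m (m + 1))) := by
  constructor
  · intro m n hm hn h
    have h' : 3 * n + 3 * m ≤ 2 * m ^ 2 + 4 := by
      have : (3 * n + 3 * m : ℝ) ≤ 2 * m ^ 2 + 4 := by linarith
      exact_mod_cast this
    by_cases hnm : n ≤ m
    · exact subwordAdjacent_torusLink_of_le hm hn hnm (by omega)
    · obtain ⟨M, rfl⟩ : ∃ M, m = M + 2 := by
        refine ⟨m - 2, ?_⟩
        rcases (by omega : m = 1 ∨ 2 ≤ m) with rfl | hm2 <;> omega
      obtain ⟨N, rfl⟩ : ∃ N, n = M + 2 + N := ⟨n - (M + 2), by omega⟩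
      obtain ⟨r, hr, hr'⟩ := (isBraidSeq_braidGen (M + 2)).keeps_coxeter_pow M le_rfl
      refine subwordAdjacent_torusLink_of_keeps ?_ hr'
      rw [sq] at h'
      rw [mul_assoc] at hr
      -- The hypothesis gives 3N ≤ 3r + 2, and hence N ≤ r by integrality.
      omega
  · intro m n hm hn hne h
    have h' : 3 * n + m ≤ 2 * m ^ 2 + 5 := by
      have : (3 * n + m : ℝ) ≤ 2 * m ^ 2 + 5 := by linarith
      exact_mod_cast this
    by_cases hnm : n ≤ m
    · exact subwordAdjacent_torusLink_of_le hm hn (by omega) (by omega)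
    · obtain ⟨M, rfl⟩ : ∃ M, m = M + 2 := by
        refine ⟨m - 2, ?_⟩
        rcases (by omega : m = 1 ∨ 2 ≤ m) with rfl | hm2
        -- For `m = 1` the bound leaves only `n = 2`, the excluded pair.
        · exact absurd (by rw [show n = 2 by omega]) hne
        · omega
      obtain ⟨N, rfl⟩ : ∃ N, n = M + 2 + N := ⟨n - (M + 2), by omega⟩
      obtain ⟨r, hr, hr'⟩ := (isBraidSeq_braidGen (M + 2)).keeps_coxeter_pow_succ M le_rfl
      refine subwordAdjacent_torusLink_of_keeps ?_ hr'
      rw [sq] at h'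
      rw [mul_assoc] at hr
      omega
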